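/- Let $\Gamma$ be the free group on a finite set $S$ and let $k$ be a positive integer. Let $\mathcal{S}^{\mathrm u}_k(\Gamma)$ be the space of positive definite maps $\phi:\Gamma\to \mathrm{M}_k(\mathbf{C})$ with $\phi(e)=I_k$, with the topology of pointwise convergence. For a finite set $F\subset\Gamma$ and $\phi\in\mathcal{S}^{\mathrm u}_k(\Gamma)$ write $\phi[F]:=[\phi(g^{-1}h)]_{g,h\in F}$, an $F$-by-$F$ block matrix with blocks in $\mathrm{M}_k(\mathbf{C})$. The left Cayley graph of $\Gamma$ has edges $\{g,sg\}$ for $g\in\Gamma$, $s\in S\cup S^{-1}$; a finite set $F\subset\Gamma$ is grounded if it contains $e$ and is connected in this graph; and $B_n$ is the closed ball of radius $n$ around $e$ in this graph. For a finite set $F\subset\Gamma$, let $\mathcal{S}^{\mathrm u}_k(F)$ be the set of positive semidefinite $F$-by-$F$ block matrices $q$ with blocks $q(g,h)\in\mathrm{M}_k(\mathbf{C})$ such that every diagonal block is $I_k$ and $q(g_1,h_1)=q(g_2,h_2)$ whenever $g_1^{-1}h_1=g_2^{-1}h_2$, and for $q\in\mathcal{S}^{\mathrm u}_k(F)$ put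 \[ h_F(q) := \begin{cases}\log\det q-\sum_{s\in S}\log\det q[F\cap sF] & \text{if } q \text{ is nonsingular},\\ -\infty & \text{if } q \text{ is singular,}\end{cases}\] where $q[E]$ is the submatrix of $q$ with block rows and columns indexed by $E\subseteq F$. For each $n$ let $\pi_n$ be a uniformly random $n$-dimensional unitary representation of $\Gamma$: the unitary matrices $\pi_n(s)$, $s\in S$, are independent and each is distributed according to the Haar probability measure of $\mathrm{U}(n)$. For each $n\ge k$ fix an $n$-by-$k$ complex matrix $V=V_n$ with orthonormal columns, and let $\Phi^{\pi_n}_V(g):=V^\ast\pi_n(g)V$ for $g\in\Gamma$, a random element of $\mathcal{S}^{\mathrm u}_k(\Gamma)$. Then the laws $\mu_n$ of $\Phi^{\pi_n}_V$ $(n\ge k)$ obey the large deviations principle in $\mathcal{S}^{\mathrm u}_k(\Gamma)$ with the rate function $I:\mathcal{S}^{\mathrm u}_k(\Gamma)\to[0,\infty]$ given by \[ I(\phi) = -\inf\{h_F(\phi[F]) : F \text{ grounded}\} = -\lim_{n\to\infty}h_{B_n}(\phi[B_n])\qquad(\phi\in\mathcal{S}^{\mathrm u}_k(\Gamma)),\]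 where the limit exists in $[-\infty,\infty)$ for every $\phi$. Explicitly, the large deviations principle means that: (i) if $a<I(\phi)$ is real, then some neighbourhood $U$ of $\phi$ satisfies $\mu_n(U)\le e^{-an+o(n)}$; (ii) if $a>I(\phi)$ is real, then every neighbourhood $U$ of $\phi$ satisfies $\mu_n(U)\ge e^{-an-o(n)}$ (for all sufficiently large $n$); (iii) for every real $a>0$ there is a compact set $K\subseteq\mathcal{S}^{\mathrm u}_k(\Gamma)$ with $\mu_n(\mathcal{S}^{\mathrm u}_k(\Gamma)\setminus K)\le e^{-an+o(n)}$. -/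

import Mathlib

open MeasureTheory ProbabilityTheory Filter Topology Asymptotics Matrix
open scoped Pointwise ComplexOrder

noncomputable section

/-! ### The left Cayley graph of a free group, grounded sets, balls -/

/-- The left Cayley graph of the free group on `S`: its edges are the pairs `{g, s g}` with
`s` a free generator (equivalently, a generator or the inverse of one). -/
def leftCayleyGraph (S : Type*) : SimpleGraph (FreeGroup S) :=
  SimpleGraph.fromRel fun g h => ∃ s : S, h = FreeGroup.of s * g

/-- A finite subset of the free group is grounded if it contains the identity and is connected
in the left Cayley graph. -/
def IsGrounded {S : Type*} (F : Finset (FreeGroup S)) : Prop :=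
  1 ∈ F ∧ ((leftCayleyGraph S).induce (F : Set (FreeGroup S))).Connected

theorem finite_cayleyBall (S : Type*) [Finite S] (n : ℕ) :
    {g : FreeGroup S | (leftCayleyGraph S).edist 1 g ≤ n}.Finite := by
  have key : ∀ m : ℕ,
      {g : FreeGroup S | ∃ p : (leftCayleyGraph S).Walk g 1, p.length ≤ m}.Finite := by
    intro m
    induction m with
    | zero =>
      refine (Set.finite_singleton (1 : FreeGroup S)).subset ?_
      rintro g ⟨p, hp⟩
      exact p.eq_of_length_eq_zero (Nat.le_zero.mp hp)
    | succ m ih =>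
      refine (((Set.finite_singleton (1 : FreeGroup S)).union
        (Set.finite_iUnion fun s : S => ih.image fun g => FreeGroup.of s * g)).union
        (Set.finite_iUnion fun s : S => ih.image fun g => (FreeGroup.of s)⁻¹ * g)).subset ?_
      rintro g ⟨p, hp⟩
      cases p with
      | nil => exact Or.inl (Or.inl rfl)
      | @cons _ h _ hadj q =>
        have hq : q.length ≤ m := by simpa using hp
        rw [leftCayleyGraph, SimpleGraph.fromRel_adj] at hadj
        obtain ⟨-, ⟨s, hs⟩ | ⟨s, hs⟩⟩ := hadj
        · exact Or.inr (Set.mem_iUnion.mpr ⟨s, h, ⟨q, hq⟩, by simp [hs]⟩)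
        · exact Or.inl (Or.inr (Set.mem_iUnion.mpr ⟨s, h, ⟨q, hq⟩, by simp [hs]⟩))
  refine (key n).subset fun g hg => ?_
  have hg' : (leftCayleyGraph S).edist 1 g ≤ n := hg
  have hne : (leftCayleyGraph S).edist 1 g ≠ ⊤ :=
    ne_top_of_le_ne_top (ENat.natCast_ne_top n) hg'
  obtain ⟨p, hp⟩ := SimpleGraph.exists_walk_of_edist_ne_top hne
  refine ⟨p.reverse, ?_⟩
  rw [← hp] at hg'
  simpa using hg'

/-- The closed ball `B_n` of radius `n` around the identity in the left Cayley graph. -/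
def cayleyBall (S : Type*) [Finite S] (n : ℕ) : Finset (FreeGroup S) :=
  (finite_cayleyBall S n).toFinset

/-! ### Positive definite functions and their finite restrictions -/

/-- The space `S^u_k(Γ)` of unital positive definite maps `φ : Γ → M_k`: those with `φ(e) = I_k` and
`∑_{g, h, i, j} conj (a_i(g)) a_j(h) φ_{ij}(g⁻¹ h) ≥ 0` for all finitely supported `a_1, …, a_k`.
(Boundedness is automatic.) As a subspace of a function space, it carries the topology of
pointwise convergence. -/
def unitalPD (Γ : Type*) [Group Γ] (k : ℕ) : Set (Γ → Matrix (Fin k) (Fin k) ℂ) :=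
  {φ | φ 1 = 1 ∧
    (Matrix.of fun p q : Γ × Fin k => φ (p.1⁻¹ * q.1) p.2 q.2).PosSemidef}

instance (Γ : Type*) [Group Γ] (k : ℕ) : MeasurableSpace (unitalPD Γ k) := borel _

instance (Γ : Type*) [Group Γ] (k : ℕ) : BorelSpace (unitalPD Γ k) := ⟨rfl⟩

/-- The space `S^u_k(F)` of partial positive definite functions over `F`: the positive semidefinite
`F`-by-`F` block matrices `Q`, with blocks `Q(g,h)` in `M_k`, whose diagonal blocks are `I_k` and
which satisfy `Q(g₁,h₁) = Q(g₂,h₂)` whenever `g₁⁻¹ h₁ = g₂⁻¹ h₂`. -/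
def partialPD {Γ : Type*} [Group Γ] (k : ℕ) (F : Finset Γ) :
    Set (Matrix (F × Fin k) (F × Fin k) ℂ) :=
  {Q | Q.PosSemidef ∧
    (∀ (g : F) (i j : Fin k), Q (g, i) (g, j) = (1 : Matrix (Fin k) (Fin k) ℂ) i j) ∧
    ∀ g₁ h₁ g₂ h₂ : F, (g₁ : Γ)⁻¹ * h₁ = (g₂ : Γ)⁻¹ * h₂ →
      ∀ i j : Fin k, Q (g₁, i) (h₁, j) = Q (g₂, i) (h₂, j)}

/-- The block matrix `φ[F] = [φ(g⁻¹ h)]_{g,h ∈ F}`. -/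
def restrictPD {Γ : Type*} [Group Γ] {k : ℕ} (φ : unitalPD Γ k) (F : Finset Γ) :
    partialPD k F :=
  ⟨Matrix.of fun p q : F × Fin k => φ.1 ((p.1 : Γ)⁻¹ * q.1) p.2 q.2,
    φ.2.2.submatrix fun p : F × Fin k => ((p.1 : Γ), p.2),
    fun g i j => by
      have h : φ.1 1 = 1 := φ.2.1
      simp [h],
    fun g₁ h₁ g₂ h₂ h i j => by simp [h]⟩

/-- The submatrix `q[E]` of an `F`-by-`F` block matrix `q` with block rows and block columns indexed
by `E ⊆ F`. -/
def subBlock {Γ : Type*} {k : ℕ} {E F : Finset Γ} (h : E ⊆ F)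
    (q : Matrix (F × Fin k) (F × Fin k) ℂ) : Matrix (E × Fin k) (E × Fin k) ℂ :=
  q.submatrix (fun p => (⟨p.1, h p.1.2⟩, p.2)) (fun p => (⟨p.1, h p.1.2⟩, p.2))

open Classical in
/-- `h_F(q) = log det q - ∑_{s ∈ S} log det q[F ∩ sF]` if `q` is nonsingular, and `-∞` otherwise.
(The determinants are real, because the matrices are positive semidefinite.) -/
def hF {S : Type*} [Fintype S] {k : ℕ} (F : Finset (FreeGroup S)) (q : partialPD k F) : EReal :=
  if IsUnit q.1 then
    ((Real.log q.1.det.re - ∑ s : S,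
      Real.log (subBlock
        (Finset.inter_subset_left : F ∩ (FreeGroup.of s • F) ⊆ F) q.1).det.re : ℝ) : EReal)
  else ⊥

/-! ### Types of tuples in representations -/

/-- The set `U(k,n)` of orthonormal `k`-tuples in `ℂⁿ`, as matrices with orthonormal columns. -/
def unitaryTuples (k n : ℕ) : Set (Matrix (Fin n) (Fin k) ℂ) := {V | Vᴴ * V = 1}

theorem posSemidef_gram {m ι : Type*} [Fintype m] (W : Matrix m ι ℂ) :
    (Wᴴ * W).PosSemidef := by
  classical
  refine ⟨Matrix.isHermitian_conjTranspose_mul_self W, fun x => ?_⟩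
  have h : (x.sum fun i xi => x.sum fun j xj => star xi * (Wᴴ * W) i j * xj)
      = ∑ a, star (∑ i ∈ x.support, W a i * x i) * ∑ j ∈ x.support, W a j * x j := by
    simp_rw [star_sum, Finset.sum_mul_sum]
    rw [Finset.sum_comm]
    refine Finset.sum_congr rfl fun i _ => ?_
    rw [Finset.sum_comm]
    refine Finset.sum_congr rfl fun j _ => ?_
    change star (x i) * (Wᴴ * W) i j * x j = _
    rw [Matrix.mul_apply, Finset.mul_sum, Finset.sum_mul]
    refine Finset.sum_congr rfl fun a _ => ?_
    rw [Matrix.conjTranspose_apply, star_mul']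
    ring
  rw [h]
  exact Finset.sum_nonneg fun a _ => star_mul_self_nonneg _

/-- The type `Φ^π_V(g) = V* π(g) V` of the tuple `V` in the representation `π`. -/
def typeOf {Γ : Type*} [Group Γ] {k n : ℕ} (π : Γ →* unitaryGroup (Fin n) ℂ)
    (V : unitaryTuples k n) : unitalPD Γ k :=
  ⟨fun g => (V.1)ᴴ * (π g : Matrix (Fin n) (Fin n) ℂ) * V.1, by
    have hV : (V.1)ᴴ * V.1 = 1 := V.2
    refine ⟨by simp [hV], ?_⟩
    have h := posSemidef_gram
      (Matrix.of fun (a : Fin n) (p : Γ × Fin k) =>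
        ((π p.1 : Matrix (Fin n) (Fin n) ℂ) * V.1) a p.2)
    convert h using 1
    ext p q
    have h2 : (V.1)ᴴ * (π (p.1⁻¹ * q.1) : Matrix (Fin n) (Fin n) ℂ) * V.1
        = ((π p.1 : Matrix (Fin n) (Fin n) ℂ) * V.1)ᴴ
          * ((π q.1 : Matrix (Fin n) (Fin n) ℂ) * V.1) := by
      rw [map_mul, map_inv, Matrix.conjTranspose_mul]
      simp [Matrix.mul_assoc, Matrix.star_eq_conjTranspose]
    simp only [Matrix.of_apply]
    rw [h2, Matrix.mul_apply, Matrix.mul_apply]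
    rfl⟩

/-! ### Uniformly random representations -/

instance (n : ℕ) : MeasurableSpace (unitaryGroup (Fin n) ℂ) := borel _

instance (n : ℕ) : BorelSpace (unitaryGroup (Fin n) ℂ) := ⟨rfl⟩

/-- `π` is a uniformly random `n`-dimensional unitary representation of the free group on `S`:
the unitary matrices `π(s)`, `s ∈ S`, are independent, and each of them is distributed according to
the Haar probability measure of `U(n)`. -/
structure IsUniformRandomRep {S Ω : Type*} [MeasurableSpace Ω] (P : Measure Ω)
    [IsProbabilityMeasure P] {n : ℕ}
    (π : Ω → (FreeGroup S →* unitaryGroup (Fin n) ℂ)) : Prop where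
  measurable : ∀ s : S, Measurable fun ω => π ω (FreeGroup.of s)
  indep : iIndepFun (fun (s : S) (ω : Ω) => π ω (FreeGroup.of s)) P
  haar : ∀ s : S, (P.map fun ω => π ω (FreeGroup.of s)).IsHaarMeasure

/-! ### Large deviations principles -/

/-- The sequence `(μ_n)_{n ≥ N}` of Borel probability measures on `X` obeys the large deviations
principle with rate function `I : X → [0,∞]`. Each `ε` is an error term `o(n)`. -/
structure LDP {X : Type*} [TopologicalSpace X] [MeasurableSpace X] {N : ℕ}
    (μ : ∀ n : ℕ, N ≤ n → Measure X) (I : X → EReal) : Prop where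
  prob : ∀ (n : ℕ) (hn : N ≤ n), IsProbabilityMeasure (μ n hn)
  nonneg : ∀ x, 0 ≤ I x
  upper : ∀ (x : X) (a : ℝ), (a : EReal) < I x → ∃ U ∈ 𝓝 x, ∃ ε : ℕ → ℝ,
    ε =o[atTop] (fun n : ℕ => (n : ℝ)) ∧
    ∀ᶠ n : ℕ in atTop, ∀ hn : N ≤ n, (μ n hn).real U ≤ Real.exp (-a * n + ε n)
  lower : ∀ (x : X) (a : ℝ), I x < (a : EReal) → ∀ U ∈ 𝓝 x, ∃ ε : ℕ → ℝ,
    ε =o[atTop] (fun n : ℕ => (n : ℝ)) ∧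
    ∀ᶠ n : ℕ in atTop, ∀ hn : N ≤ n, Real.exp (-a * n - ε n) ≤ (μ n hn).real U
  tight : ∀ a : ℝ, 0 < a → ∃ K : Set X, IsCompact K ∧ ∃ ε : ℕ → ℝ,
    ε =o[atTop] (fun n : ℕ => (n : ℝ)) ∧
    ∀ᶠ n : ℕ in atTop, ∀ hn : N ≤ n, (μ n hn).real Kᶜ ≤ Real.exp (-a * n + ε n)

end

set_option linter.unusedSectionVars false

/-! The restriction to `F` of the random type is the Gram matrix of the vectors `π(g) v_i`, `g ∈ F`.
The heart of the matter is that, for grounded `F`, this Gram matrix lies near `q` with probability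
`exp(n h_F(q) + o(n))`. This is shown by computing one volume in two ways. Consider unitaries `U_s`
together with arbitrary tuples `W` of vectors indexed by `F × Fin k`, and require every edge defect
`W(x) - U_s W(s⁻¹x)`, `x ∈ F ∩ sF`, to lie in the image of a polyball of small radius `ρ` under a
matrix `D_s` with `D_sᴴ D_s = q[F ∩ sF]`. Such a `W` is within `O(ρ)` of the orbit of its block at
the identity (`exists_norm_sub_orbitTuple_le`).

With `U` fixed, a grounded set is a tree, its edges correspond to its elements other than `e`, and
the block at `e` together with the edge defects are volume-preserving coordinates
(`tupVol_edgeDiff`). The volume is therefore about `p ∏_s (det q[F ∩ sF] · ρ^{2k|F ∩ sF|})^n`, where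
`p` is the probability sought (`lintegral_edgeNear`). With `W` fixed, the `U_s` are independent, and
a Haar unitary moves one nearly orthonormal tuple of `m` vectors to within `ρ` of another with
probability about `ρ^{2mn}` (`exists_nhds_one_hit_le`, `exists_nhds_one_le_hit`), while the `W` with
Gram matrix near `q` have volume about `(det q)^n`. The powers of `ρ` cancel, leaving `p ≈ (det q /
∏_s det q[F ∩ sF])^n`. Volumes are normalised so that the unit ball has mass one; nearly orthonormal
tuples then fill almost all of the unit polyball.

The upper bound needs only nonsingular edge blocks. A minimal grounded set on which `φ` is singular
has them (`exists_singular_posDef_edgeBlock`), so there the decay beats every exponential rate.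
Monotonicity of `h_F` in `F` (`hF_anti`) follows from the probability bounds, because the event for
the larger set implies that for the smaller one; the infimum is then the limit along balls.
Neighbourhoods in the compact space of positive definite maps depend on finitely many values, so the
estimates for finite `F` give the full principle. -/

/-! ### Normalised volume on `ℂⁿ` -/

/-- The Hermitian space `ℂⁿ`. -/
abbrev Cn (n : ℕ) : Type := EuclideanSpace ℂ (Fin n)

/-- Lebesgue measure on `ℂⁿ`, normalised so that the unit ball has measure one. -/
noncomputable def ballVol (n : ℕ) : Measure (Cn n) :=
  (volume (Metric.ball (0 : Cn n) 1))⁻¹ • volume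

instance (n : ℕ) : (ballVol n).IsAddHaarMeasure :=
  Measure.IsAddHaarMeasure.smul _ (ENNReal.inv_ne_zero.2 measure_ball_lt_top.ne)
    (ENNReal.inv_ne_top.2 (Metric.measure_ball_pos _ _ one_pos).ne')

theorem finrank_real_Cn (n : ℕ) : Module.finrank ℝ (Cn n) = 2 * n := by
  rw [finrank_real_of_complex]; simp

theorem ballVol_ball {n : ℕ} (x : Cn n) {r : ℝ} (hr : 0 < r) :
    ballVol n (Metric.ball x r) = ENNReal.ofReal r ^ (2 * n) := by
  rw [Measure.addHaar_ball_of_pos _ _ hr, finrank_real_Cn, ENNReal.ofReal_pow hr.le]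
  have : ballVol n (Metric.ball 0 1) = 1 := by
    rw [ballVol, Measure.smul_apply, smul_eq_mul]
    exact ENNReal.inv_mul_cancel (Metric.measure_ball_pos _ _ one_pos).ne' measure_ball_lt_top.ne
  rw [this, mul_one]

theorem measurePreserving_ballVol {n : ℕ} (H : Cn n ≃ₗᵢ[ℂ] Cn n) :
    MeasurePreserving H (ballVol n) (ballVol n) := by
  let H' : Cn n ≃ₗᵢ[ℝ] Cn n :=
    { H.toLinearEquiv.restrictScalars ℝ with norm_map' := H.norm_map }
  exact (LinearIsometryEquiv.measurePreserving H').smul_measure _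

/-! ### Tuples of vectors, their linear combinations and their volume -/

section Comb

variable {ι κ : Type*} [Fintype ι] [Fintype κ] {n : ℕ}

/-- Lebesgue measure on tuples of vectors, normalised on the product of unit balls. -/
noncomputable def tupVol (ι : Type*) [Fintype ι] (n : ℕ) : Measure (ι → Cn n) :=
  Measure.pi fun _ => ballVol n

instance : (tupVol ι n).IsAddHaarMeasure :=
  Measure.pi.isAddHaarMeasure _

instance : SigmaFinite (tupVol ι n) := by unfold tupVol; infer_instance

/-- The tuples all of whose members have norm less than `r`. -/
def polyball (ι : Type*) (n : ℕ) (r : ℝ) : Set (ι → Cn n) := {Z | ∀ j, ‖Z j‖ < r}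

theorem polyball_eq_pi (r : ℝ) :
    polyball ι n r = Set.univ.pi fun _ => Metric.ball (0 : Cn n) r := by
  ext Z; simp [polyball]

theorem isOpen_polyball (r : ℝ) : IsOpen (polyball ι n r) := by
  rw [polyball_eq_pi]; exact isOpen_set_pi Set.finite_univ fun _ _ => Metric.isOpen_ball

theorem tupVol_polyball {r : ℝ} (hr : 0 < r) :
    tupVol ι n (polyball ι n r) = ENNReal.ofReal r ^ (2 * n * Fintype.card ι) := by
  rw [polyball_eq_pi, tupVol, Measure.pi_pi]
  simp [ballVol_ball _ hr, ← pow_mul]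

/-- The tuple of linear combinations of the vectors `Z i` with the columns of `D` as
coefficients. -/
noncomputable def comb (D : Matrix ι κ ℂ) : (ι → Cn n) →ₗ[ℂ] (κ → Cn n) where
  toFun Z j := ∑ i, D i j • Z i
  map_add' Z Z' := by ext; simp [Finset.sum_add_distrib]
  map_smul' c Z := by
    funext j; simp [Finset.smul_sum, smul_smul, mul_comm]

theorem comb_apply (D : Matrix ι κ ℂ) (Z : ι → Cn n) (j : κ) :
    comb D Z j = ∑ i, D i j • Z i := rfl

theorem gram_comb (D : Matrix ι κ ℂ) (Z : ι → Cn n) :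
    gram ℂ (comb D Z) = Dᴴ * gram ℂ Z * D := by
  ext a b
  simp only [gram_apply, comb_apply, sum_inner, inner_sum, inner_smul_left, inner_smul_right,
    Matrix.mul_apply, conjTranspose_apply, Finset.sum_mul]
  simp only [Finset.mul_sum]
  refine Finset.sum_congr rfl fun i _ => Finset.sum_congr rfl fun j _ => ?_
  simp; ring

theorem comb_mul {l : Type*} [Fintype l] (D : Matrix ι κ ℂ) (D' : Matrix κ l ℂ) (Z : ι → Cn n) :
    comb D' (comb D Z) = comb (D * D') Z := by
  funext a
  simp only [comb_apply, Matrix.mul_apply, Finset.smul_sum, Finset.sum_smul, smul_smul]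
  rw [Finset.sum_comm]
  refine Finset.sum_congr rfl fun i _ => Finset.sum_congr rfl fun j _ => ?_
  rw [mul_comm]

theorem comb_one [DecidableEq ι] (Z : ι → Cn n) : comb (1 : Matrix ι ι ℂ) Z = Z := by
  funext a; simp [comb_apply, Matrix.one_apply]

theorem comb_isometry (D : Matrix ι κ ℂ) (Z : ι → Cn n) (H : Cn n ≃ₗᵢ[ℂ] Cn n) :
    comb D (fun i => H (Z i)) = fun j => H (comb D Z j) := by
  funext a; simp [comb_apply]

/-- Sorted by the coordinates of `ℂⁿ`, the map is `n` copies of `Dᵀ`. -/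
theorem det_comb [DecidableEq ι] (D : Matrix ι ι ℂ) :
    LinearMap.det (comb (n := n) D) = D.det ^ n := by
  let e : (ι → Cn n) ≃ₗ[ℂ] (Fin n → ι → ℂ) :=
    { toFun := fun Z a i => Z i a
      map_add' := fun _ _ => rfl
      map_smul' := fun _ _ => rfl
      invFun := fun Y i => WithLp.toLp 2 fun a => Y a i
      left_inv := fun _ => rfl
      right_inv := fun _ => rfl }
  rw [← LinearMap.det_conj (comb D) e]
  have : (e : (ι → Cn n) →ₗ[ℂ] (Fin n → ι → ℂ)) ∘ₗ comb D ∘ₗ (e.symm : _ →ₗ[ℂ] (ι → Cn n))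
      = LinearMap.pi fun a : Fin n => (toLin' Dᵀ) ∘ₗ LinearMap.proj a := by
    ext1 a
    refine LinearMap.ext fun x => ?_
    funext b c
    change (∑ i, D i c • WithLp.toLp 2 (fun b => (Pi.single a x : Fin n → ι → ℂ) b i)) b = _
    simp [mulVec, dotProduct]
  rw [this, LinearMap.det_pi]
  simp

/-- Volume sees the real determinant, which is the squared modulus of the complex one. -/
theorem tupVol_image_comb [DecidableEq ι] (D : Matrix ι ι ℂ) (s : Set (ι → Cn n)) :
    tupVol ι n (comb D '' s) = ENNReal.ofReal (‖D.det‖ ^ 2) ^ n * tupVol ι n s := by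
  have := Measure.addHaar_image_linearMap (tupVol ι n) ((comb D).restrictScalars ℝ) s
  rw [LinearMap.coe_restrictScalars] at this
  rw [this, LinearMap.det_restrictScalars, det_comb, Algebra.norm_complex_eq]
  simp [Complex.normSq_eq_norm_sq, ENNReal.ofReal_pow, ← pow_mul, mul_comm]

end Comb

/-! ### Volume of tuples with prescribed approximate Gram matrix -/

section Volume

variable {ι κ : Type*} [Fintype ι] [Fintype κ] [DecidableEq ι] {n : ℕ}

open scoped MatrixOrder in
theorem exists_posSemidef_sqrt {A : Matrix ι ι ℂ} (hA : A.PosSemidef) :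
    ∃ B : Matrix ι ι ℂ, B.PosSemidef ∧ B * B = A :=
  ⟨CFC.sqrt A, (CFC.sqrt_nonneg A).posSemidef, CFC.sqrt_mul_sqrt_self A hA.nonneg⟩

theorem exists_conjTranspose_mul_self {A : Matrix ι ι ℂ} (hA : A.PosDef) :
    ∃ D : Matrix ι ι ℂ, Dᴴ * D = A ∧ D.det ≠ 0 ∧ ‖D.det‖ ^ 2 = A.det.re := by
  obtain ⟨B, hB, rfl⟩ := exists_posSemidef_sqrt hA.posSemidef
  refine ⟨B, by rw [hB.isHermitian.eq], ?_, ?_⟩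
  · intro h
    have := hA.det_pos
    simp [h] at this
  · have h : (B * B).det = star B.det * B.det := by
      rw [← det_conjTranspose, ← det_mul, hB.isHermitian.eq]
    rw [h, Complex.star_def, ← Complex.normSq_eq_conj_mul_self, Complex.normSq_eq_norm_sq]
    norm_cast

theorem comb_inv_comb {D : Matrix ι ι ℂ} (hD : D.det ≠ 0) (W : ι → Cn n) :
    comb D (comb D⁻¹ W) = W := by
  rw [comb_mul, nonsing_inv_mul _ hD.isUnit, comb_one]

theorem comb_comb_inv {D : Matrix ι ι ℂ} (hD : D.det ≠ 0) (W : ι → Cn n) :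
    comb D⁻¹ (comb D W) = W := by
  rw [comb_mul, mul_nonsing_inv _ hD.isUnit, comb_one]

theorem re_gram_self (Z : ι → Cn n) (j : ι) : (gram ℂ Z j j).re = ‖Z j‖ ^ 2 := by
  rw [gram_apply, inner_self_eq_norm_sq_to_K]
  norm_cast

/-- The volume of the tuples with Gram matrix near `q` is asymptotically at most
`(det q) ^ n`. -/
theorem exists_nhds_tupVol_gram_le {q : Matrix ι ι ℂ} (hq : q.PosSemidef) {c : ℝ}
    (hc : q.det.re < c) :
    ∃ N ∈ 𝓝 q, IsOpen N ∧ ∀ n, tupVol ι n {W | gram ℂ W ∈ N} ≤ ENNReal.ofReal c ^ n := by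
  -- As `q` may be singular, it is replaced by `q + τ`, with `τ` so small that its determinant, and
  -- the factor lost to polyballs of radius `√(1 + τ)`, stay within `c`.
  have hcont : Continuous fun τ : ℝ =>
      (q + (τ : ℂ) • (1 : Matrix ι ι ℂ)).det.re * (1 + τ) ^ Fintype.card ι := by
    fun_prop
  have h0 : ∀ᶠ τ : ℝ in 𝓝 (0 : ℝ),
      (q + (τ : ℂ) • (1 : Matrix ι ι ℂ)).det.re * (1 + τ) ^ Fintype.card ι < c :=
    (hcont.tendsto 0).eventually_lt_const (by simpa using hc)
  obtain ⟨τ, hτ, hτ0⟩ := ((h0.filter_mono nhdsWithin_le_nhds).and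
    (self_mem_nhdsWithin : Set.Ioi (0 : ℝ) ∈ 𝓝[>] 0)).exists
  have hτ0 : 0 < τ := hτ0
  have hpd : (q + (τ : ℂ) • (1 : Matrix ι ι ℂ)).PosDef :=
    Matrix.PosDef.posSemidef_add hq (Matrix.PosDef.one.smul (by exact_mod_cast hτ0))
  obtain ⟨D, hD, hD0, hdet⟩ := exists_conjTranspose_mul_self hpd
  have hu : IsUnit D.det := hD0.isUnit
  -- For a Gram matrix of `W` the condition bounds the squared norms of the members of `comb D⁻¹ W`.
  -- It holds at `q`, where the matrix is `1 - τ (D⁻¹)ᴴ D⁻¹`, with diagonal at most one.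
  refine ⟨{M | ∀ j, (((D⁻¹)ᴴ * M * D⁻¹) j j).re < 1 + τ}, ?_, ?_, ?_⟩
  · refine IsOpen.mem_nhds ?_ ?_
    · simp only [Set.ofPred_forall]
      refine isOpen_iInter_of_finite fun j => isOpen_lt ?_ continuous_const
      fun_prop
    · intro j
      have : (D⁻¹)ᴴ * q * D⁻¹ = 1 - (τ : ℂ) • ((D⁻¹)ᴴ * D⁻¹) := by
        have h1 : q = Dᴴ * D - (τ : ℂ) • (1 : Matrix ι ι ℂ) := by rw [hD]; simp
        have h2 : (D⁻¹)ᴴ * (Dᴴ * D) * D⁻¹ = 1 := by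
          rw [Matrix.mul_assoc, Matrix.mul_assoc, mul_nonsing_inv _ hu, Matrix.mul_one,
            ← conjTranspose_mul, mul_nonsing_inv _ hu, conjTranspose_one]
        rw [h1, Matrix.mul_sub, Matrix.sub_mul, h2]
        simp
      have h3 : 0 ≤ ((D⁻¹)ᴴ * D⁻¹) j j :=
        (Matrix.posSemidef_conjTranspose_mul_self D⁻¹).diag_nonneg
      have h4 : 0 ≤ (((D⁻¹)ᴴ * D⁻¹) j j).re := (Complex.le_def.1 h3).1
      rw [this]
      simp only [Matrix.sub_apply, Matrix.one_apply_eq, Matrix.smul_apply, Complex.sub_re,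
        Complex.one_re, smul_eq_mul, Complex.re_ofReal_mul]
      nlinarith [mul_nonneg hτ0.le h4]
  · simp only [Set.ofPred_forall]
    refine isOpen_iInter_of_finite fun j => isOpen_lt ?_ continuous_const
    fun_prop
  · intro n
    have hsub : {W : ι → Cn n | gram ℂ W ∈ {M | ∀ j, (((D⁻¹)ᴴ * M * D⁻¹) j j).re < 1 + τ}}
        ⊆ comb D '' polyball ι n (√(1 + τ)) := by
      intro W hW
      refine ⟨comb D⁻¹ W, fun j => ?_, comb_inv_comb hD0 W⟩
      have := hW j
      rw [← gram_comb, re_gram_self] at this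
      exact Real.lt_sqrt_of_sq_lt this
    have h1τ : 0 < 1 + τ := by linarith
    calc _ ≤ _ := measure_mono hsub
      _ = ENNReal.ofReal ((q + (τ : ℂ) • (1 : Matrix ι ι ℂ)).det.re * (1 + τ) ^ Fintype.card ι)
          ^ n := by
        rw [tupVol_image_comb, tupVol_polyball (Real.sqrt_pos.2 h1τ), hdet,
          ENNReal.ofReal_mul (by rw [← hdet]; positivity), mul_pow, ENNReal.ofReal_pow h1τ.le,
          ← pow_mul, mul_comm 2 n, mul_assoc, mul_left_comm, mul_comm n, pow_mul,
          ← ENNReal.ofReal_pow (Real.sqrt_nonneg _), Real.sq_sqrt h1τ.le, mul_comm]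
      _ ≤ _ := by gcongr

/-- The product of balls of radius one, except for radius `r` at `j`. -/
theorem tupVol_pi_ball (j : ι) {r : ℝ} (hr : 0 < r) :
    tupVol ι n (Set.univ.pi fun b => Metric.ball (0 : Cn n) (if b = j then r else 1))
      = ENNReal.ofReal r ^ (2 * n) := by
  rw [tupVol, Measure.pi_pi]
  rw [Finset.prod_eq_single j]
  · simp [ballVol_ball _ hr]
  · intro b _ hb
    simp [hb, ballVol_ball _ one_pos]
  · simp

/-- In the expanded square the cross term is at most `-δ²` and the last term at most `δ²/2`; the
coefficient `δ/2` is optimal for `‖x‖² = 2`. A vector correlated with `x` can thus be pushed into a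
smaller ball. -/
theorem norm_sq_sub_smul_lt {x y : Cn n} {z : ℂ} {δ : ℝ} (hδ : 0 < δ) (hz : ‖z‖ = 1)
    (hx : ‖x‖ ^ 2 ≤ 2) (hy : ‖y‖ < 1) (h : δ ≤ (z * inner ℂ x y).re) :
    ‖y + (-(δ / 2 : ℝ) * star z : ℂ) • x‖ < √(1 - δ ^ 2 / 2) := by
  apply Real.lt_sqrt_of_sq_lt
  rw [@norm_add_sq ℂ, inner_smul_right, norm_smul]
  have h1 : RCLike.re ((-(δ / 2 : ℝ) * star z : ℂ) * inner ℂ y x)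
      = -(δ / 2) * (z * inner ℂ x y).re := by
    rw [← inner_conj_symm]
    have : (-(δ / 2 : ℝ) * star z : ℂ) * (starRingEnd ℂ) (inner ℂ x y)
        = ((-(δ / 2) : ℝ) : ℂ) * (starRingEnd ℂ) (z * inner ℂ x y) := by
      simp; ring
    rw [this]
    change (((-(δ / 2) : ℝ) : ℂ) * _).re = _
    rw [Complex.re_ofReal_mul, Complex.conj_re]
  have h2 : ‖(-(δ / 2 : ℝ) * star z : ℂ)‖ = δ / 2 := by
    rw [norm_mul, norm_star, hz, norm_neg, Complex.norm_real, Real.norm_of_nonneg (by positivity),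
      mul_one]
  rw [h1, h2, mul_pow]
  nlinarith [norm_nonneg y]

/-- Tuples in the product of unit balls that are nearly orthonormal and nearly orthogonal to
the members of `X`. -/
def nearOrtho (δ : ℝ) (X : κ → Cn n) : Set (ι → Cn n) :=
  {Z | Z ∈ polyball ι n 1 ∧ (∀ i j, ‖gram ℂ Z i j - (1 : Matrix ι ι ℂ) i j‖ < δ) ∧
    ∀ i j, ‖inner ℂ (X i) (Z j)‖ < δ}

/-- The fourth roots of unity. -/
def quarter : Fin 4 → ℂ := ![1, -1, Complex.I, -Complex.I]

theorem norm_quarter (a : Fin 4) : ‖quarter a‖ = 1 := by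
  fin_cases a <;> simp [quarter]

theorem exists_quarter_le_re {z : ℂ} {δ : ℝ} (h : 2 * δ ≤ ‖z‖) :
    ∃ a, δ ≤ (quarter a * z).re := by
  by_contra! hc
  have h0 := hc 0
  have h1 := hc 1
  have h2 := hc 2
  have h3 := hc 3
  simp [quarter] at h0 h1 h2 h3
  have := Complex.norm_le_abs_re_add_abs_im z
  have h5 : |z.re| < δ := abs_lt.2 ⟨by linarith, h0⟩
  have h6 : |z.im| < δ := abs_lt.2 ⟨by linarith, by linarith⟩
  linarith

/-- A transvection, which preserves volume, carries these correlated tuples into a product of balls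
with one radius shrunk by `norm_sq_sub_smul_lt`. Their volume is therefore exponentially small in
`n`. -/
theorem tupVol_inner_self_ge {i j : ι} (hij : i ≠ j) {z : ℂ} {δ : ℝ} (hδ : 0 < δ) (hδ1 : δ < 1)
    (hz : ‖z‖ = 1) :
    tupVol ι n {Z | Z ∈ polyball ι n 1 ∧ δ ≤ (z * inner ℂ (Z i) (Z j)).re}
      ≤ ENNReal.ofReal (√(1 - δ ^ 2 / 2)) ^ (2 * n) := by
  have hr : 0 < √(1 - δ ^ 2 / 2) := Real.sqrt_pos.2 (by nlinarith)
  set D : Matrix ι ι ℂ := transvection i j (-(δ / 2 : ℝ) * star z : ℂ)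
  have hdet : D.det = 1 := det_transvection_of_ne _ _ hij _
  have h := tupVol_image_comb (n := n) D
    {Z | Z ∈ polyball ι n 1 ∧ δ ≤ (z * inner ℂ (Z i) (Z j)).re}
  rw [hdet] at h
  simp only [norm_one, one_pow, ENNReal.ofReal_one, one_mul] at h
  rw [← h, ← tupVol_pi_ball j hr]
  refine measure_mono ?_
  rintro _ ⟨Z, ⟨hZ, hZ'⟩, rfl⟩ b -
  have hD : comb D Z b = Z b + if b = j then (-(δ / 2 : ℝ) * star z : ℂ) • Z i else 0 := by
    simp only [comb_apply, D, transvection, Matrix.add_apply, add_smul, Finset.sum_add_distrib]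
    congr 1
    · simp [Matrix.one_apply]
    · simp only [Matrix.single_apply]
      by_cases hb : b = j
      · simp [hb]
      · simp [hb, Ne.symm hb]
  rw [hD, mem_ball_zero_iff]
  split_ifs with hb
  · subst hb
    exact norm_sq_sub_smul_lt hδ hz (by nlinarith [hZ i, norm_nonneg (Z i)]) (hZ b) hZ'
  · simpa using hZ b

/-- Since `x` is a fixed vector here, a translation replaces the transvection. -/
theorem tupVol_inner_ge {x : Cn n} (hx : ‖x‖ ^ 2 ≤ 2) (j : ι) {z : ℂ} {δ : ℝ} (hδ : 0 < δ)
    (hδ1 : δ < 1) (hz : ‖z‖ = 1) :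
    tupVol ι n {Z | Z ∈ polyball ι n 1 ∧ δ ≤ (z * inner ℂ x (Z j)).re}
      ≤ ENNReal.ofReal (√(1 - δ ^ 2 / 2)) ^ (2 * n) := by
  have hr : 0 < √(1 - δ ^ 2 / 2) := Real.sqrt_pos.2 (by nlinarith)
  rw [← tupVol_pi_ball j hr, ← measure_preimage_add_right (tupVol ι n)
    (Pi.single j ((-(δ / 2 : ℝ) * star z : ℂ) • x))
    (Set.univ.pi fun b => Metric.ball (0 : Cn n) (if b = j then √(1 - δ ^ 2 / 2) else 1))]
  refine measure_mono ?_
  rintro Z ⟨hZ, hZ'⟩ b -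
  rw [mem_ball_zero_iff]
  change ‖Z b + (Pi.single j ((-(δ / 2 : ℝ) * star z : ℂ) • x) : ι → Cn n) b‖ < _
  by_cases hb : b = j
  · subst hb
    simpa using norm_sq_sub_smul_lt hδ hz hx (hZ b) hZ'
  · simpa [hb] using hZ b

theorem tupVol_norm_sq_le (j : ι) {δ : ℝ} (hδ : 0 < δ) (hδ1 : δ < 1) :
    tupVol ι n {Z | Z ∈ polyball ι n 1 ∧ ‖Z j‖ ^ 2 ≤ 1 - δ}
      ≤ ENNReal.ofReal (√(1 - δ ^ 2 / 2)) ^ (2 * n) := by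
  have hr : 0 < √(1 - δ ^ 2 / 2) := Real.sqrt_pos.2 (by nlinarith)
  rw [← tupVol_pi_ball j hr]
  refine measure_mono ?_
  rintro Z ⟨hZ, hZ'⟩ b -
  rw [mem_ball_zero_iff]
  split_ifs with hb
  · subst hb
    exact Real.lt_sqrt_of_sq_lt (by nlinarith)
  · exact hZ b

theorem polyball_subset_nearOrtho_union {d δ : ℝ} (hd : 2 * d ≤ δ) (hd0 : 0 < d)
    (X : κ → Cn n) :
    polyball ι n 1 ⊆ (nearOrtho δ X ∪ ⋃ j, {Z | Z ∈ polyball ι n 1 ∧ ‖Z j‖ ^ 2 ≤ 1 - d}) ∪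
      ((⋃ t : {p : ι × ι // p.1 ≠ p.2} × Fin 4, {Z | Z ∈ polyball ι n 1 ∧
          d ≤ (quarter t.2 * inner ℂ (Z t.1.1.1) (Z t.1.1.2)).re}) ∪
        ⋃ t : (κ × ι) × Fin 4, {Z | Z ∈ polyball ι n 1 ∧
          d ≤ (quarter t.2 * inner ℂ (X t.1.1) (Z t.1.2)).re}) := by
  intro Z hZ
  by_contra hc
  simp only [Set.mem_union, Set.mem_iUnion, Set.mem_ofPred_eq, not_or, not_exists, not_and,
    not_le] at hc
  obtain ⟨⟨h0, h1⟩, h2, h3⟩ := hc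
  refine h0 ⟨hZ, fun i j => ?_, fun i j => ?_⟩
  · by_cases hij : i = j
    · subst hij
      have h4 : gram ℂ Z i i = ((‖Z i‖ ^ 2 : ℝ) : ℂ) := by
        rw [gram_apply, inner_self_eq_norm_sq_to_K]; simp
      have h5 := h1 i hZ
      have h6 := hZ i
      rw [h4, Matrix.one_apply_eq, ← Complex.ofReal_one, ← Complex.ofReal_sub, Complex.norm_real,
        Real.norm_eq_abs, abs_lt]
      constructor <;> nlinarith [norm_nonneg (Z i)]
    · rw [Matrix.one_apply_ne hij, sub_zero, gram_apply]
      by_contra! h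
      obtain ⟨a, ha⟩ := exists_quarter_le_re (hd.trans h)
      exact (h2 (⟨(i, j), hij⟩, a) hZ).not_ge ha
  · by_contra! h
    obtain ⟨a, ha⟩ := exists_quarter_le_re (hd.trans h)
    exact (h3 ((i, j), a) hZ).not_ge ha

variable (ι κ) in
-- The rest of the unit polyball is covered by finitely many exponentially small sets, whose number
-- `C` and bounds depend on neither `X` nor, for `C`, on `n`. Uniformity in `X` matters: `X` will be
-- moved by a random unitary.
theorem eventually_half_le_tupVol_nearOrtho {δ : ℝ} (hδ : 0 < δ) :
    ∀ᶠ n in atTop, ∀ X : κ → Cn n, (∀ i, ‖X i‖ ^ 2 ≤ 2) →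
      ENNReal.ofReal (1 / 2) ≤ tupVol ι n (nearOrtho δ X) := by
  classical
  obtain ⟨d, hd, hd0, hd1⟩ : ∃ d, 2 * d ≤ δ ∧ 0 < d ∧ d < 1 :=
    ⟨min δ 1 / 2, by linarith [min_le_left δ 1], by positivity, by linarith [min_le_right δ 1]⟩
  set r := √(1 - d ^ 2 / 2)
  set C : ℕ := Fintype.card ι + (Fintype.card ({p : ι × ι // p.1 ≠ p.2} × Fin 4)
    + Fintype.card ((κ × ι) × Fin 4))
  have hr1 : r ^ 2 < 1 := by
    rw [Real.sq_sqrt (by nlinarith)]; nlinarith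
  have hlim : Tendsto (fun n : ℕ => C * (r ^ 2) ^ n) atTop (𝓝 0) := by
    simpa using (tendsto_pow_atTop_nhds_zero_of_lt_one (sq_nonneg r) hr1).const_mul (C : ℝ)
  filter_upwards [hlim.eventually_le_const (show (0 : ℝ) < 1 / 2 by norm_num)] with n hn X hX
  have h1 : ENNReal.ofReal 1 ≤ tupVol ι n (nearOrtho δ X) + C * ENNReal.ofReal r ^ (2 * n) := by
    calc ENNReal.ofReal 1 = tupVol ι n (polyball ι n 1) := by
          rw [tupVol_polyball one_pos]; simp
      _ ≤ _ := measure_mono (polyball_subset_nearOrtho_union hd hd0 X)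
      _ ≤ _ := measure_union_le _ _
      _ ≤ _ := add_le_add (measure_union_le _ _) (measure_union_le _ _)
      _ ≤ (tupVol ι n (nearOrtho δ X) + ∑ j : ι, ENNReal.ofReal r ^ (2 * n))
          + (∑ t : {p : ι × ι // p.1 ≠ p.2} × Fin 4, ENNReal.ofReal r ^ (2 * n)
          + ∑ t : (κ × ι) × Fin 4, ENNReal.ofReal r ^ (2 * n)) := by
        refine add_le_add (add_le_add le_rfl ?_) (add_le_add ?_ ?_)
        · exact (measure_iUnion_fintype_le _ _).trans
            (Finset.sum_le_sum fun j _ => tupVol_norm_sq_le j hd0 hd1)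
        · exact (measure_iUnion_fintype_le _ _).trans (Finset.sum_le_sum fun t _ =>
            tupVol_inner_self_ge t.1.2 hd0 hd1 (norm_quarter _))
        · exact (measure_iUnion_fintype_le _ _).trans (Finset.sum_le_sum fun t _ =>
            tupVol_inner_ge (hX _) _ hd0 hd1 (norm_quarter _))
      _ = _ := by
        simp only [Finset.sum_const, Finset.card_univ, nsmul_eq_mul, C]
        push_cast
        ring
  have h2 : (C : ENNReal) * ENNReal.ofReal r ^ (2 * n) ≤ ENNReal.ofReal (1 / 2) := by
    rw [← ENNReal.ofReal_pow (Real.sqrt_nonneg _), ← ENNReal.ofReal_natCast,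
      ← ENNReal.ofReal_mul (by positivity), pow_mul]
    exact ENNReal.ofReal_le_ofReal hn
  have h3 : ENNReal.ofReal 1 = ENNReal.ofReal (1 / 2) + ENNReal.ofReal (1 / 2) := by
    rw [← ENNReal.ofReal_add (by norm_num) (by norm_num)]; norm_num
  rw [h3] at h1
  exact (ENNReal.add_le_add_iff_right ENNReal.ofReal_ne_top).1 (h1.trans (add_le_add le_rfl h2))

end Volume

/-! ### Nearly orthonormal tuples up to unitary transformations -/

section Isometry

variable {ι : Type*} [Fintype ι] [DecidableEq ι]

theorem orthonormal_of_gram_eq_one {n : ℕ} {Z : ι → Cn n} (h : gram ℂ Z = 1) :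
    Orthonormal ℂ Z := by
  rw [orthonormal_iff_ite]
  intro i j
  rw [← gram_apply, h, Matrix.one_apply]

/-- Both families extend to orthonormal bases, and the change of basis is the required unitary. -/
theorem exists_linearIsometryEquiv_of_orthonormal {n : ℕ} {Z Z' : ι → Cn n}
    (hZ : Orthonormal ℂ Z) (hZ' : Orthonormal ℂ Z') :
    ∃ H : Cn n ≃ₗᵢ[ℂ] Cn n, ∀ j, H (Z j) = Z' j := by
  have hcard : Fintype.card ι ≤ Fintype.card (Fin n) := by
    simpa using hZ.linearIndependent.fintype_card_le_finrank
  obtain ⟨e⟩ := Function.Embedding.nonempty_of_card_le hcard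
  have key : ∀ Y : ι → Cn n, Orthonormal ℂ Y →
      ∃ b : OrthonormalBasis (Fin n) ℂ (Cn n), ∀ j, b (e j) = Y j := by
    intro Y hY
    let v : Fin n → Cn n := Function.extend e Y 0
    have hv : ∀ j, v (e j) = Y j := fun j => e.injective.extend_apply _ _ _
    have ho : Orthonormal ℂ ((Set.range e).domRestrict v) := by
      have : (Set.range e).domRestrict v = Y ∘ (Equiv.ofInjective e e.injective).symm := by
        funext ⟨x, j, hj⟩
        subst hj
        rw [Set.domRestrict_apply, Function.comp_apply]
        refine (hv j).trans (congrArg Y ?_)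
        rw [Equiv.eq_symm_apply]; rfl
      rw [this]
      exact hY.comp _ (Equiv.injective _)
    obtain ⟨b, hb⟩ := ho.exists_orthonormalBasis_extension_of_card_eq (by simp)
    exact ⟨b, fun j => by rw [hb _ ⟨j, rfl⟩, hv]⟩
  obtain ⟨b, hb⟩ := key Z hZ
  obtain ⟨b', hb'⟩ := key Z' hZ'
  exact ⟨b.equiv b' (Equiv.refl _), fun j => by rw [← hb, ← hb']; simp⟩

/-- Polar decomposition: let `P` be the square root of the Gram matrix and let `Z₀` be `comb P⁻¹ Z`.
The errors `Z - Z₀` have Gram matrix `(P - 1)²`, which is dominated by `(P² - 1)²` because the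
difference is `(P - 1)(P² + 2P)(P - 1)`. -/
theorem exists_orthonormal_near {n : ℕ} (Z : ι → Cn n) (hdet : (gram ℂ Z).det ≠ 0) :
    ∃ Z₀ : ι → Cn n, gram ℂ Z₀ = 1 ∧
      ∀ j, ‖Z j - Z₀ j‖ ^ 2 ≤ (((gram ℂ Z - 1)ᴴ * (gram ℂ Z - 1) : Matrix ι ι ℂ) j j).re := by
  obtain ⟨P, hP, hPP⟩ := exists_posSemidef_sqrt (Matrix.posSemidef_gram ℂ Z)
  have hP' : Pᴴ = P := hP.isHermitian.eq
  have hPdet : P.det ≠ 0 := fun h => hdet (by rw [← hPP, det_mul, h, zero_mul])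
  have hu : IsUnit P.det := hPdet.isUnit
  have hZ₀ : gram ℂ (comb P⁻¹ Z) = 1 := by
    rw [gram_comb, ← hPP, conjTranspose_nonsing_inv, hP', ← Matrix.mul_assoc,
      nonsing_inv_mul _ hu, Matrix.one_mul, mul_nonsing_inv _ hu]
  refine ⟨comb P⁻¹ Z, hZ₀, fun j => ?_⟩
  have h1 : Z j - comb P⁻¹ Z j = comb (P - 1) (comb P⁻¹ Z) j := by
    conv_lhs => rw [← comb_inv_comb hPdet Z]
    rw [comb_comb_inv hPdet]
    simp only [comb_apply _ (comb P⁻¹ Z), Matrix.sub_apply, sub_smul, Finset.sum_sub_distrib]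
    simp [Matrix.one_apply]
  have h2 : (gram ℂ Z - 1)ᴴ * (gram ℂ Z - 1) - (P - 1)ᴴ * (P - 1)
      = (P - 1)ᴴ * (P * P + P + P) * (P - 1) := by
    rw [← hPP]
    simp only [conjTranspose_sub, conjTranspose_mul, hP', conjTranspose_one]
    noncomm_ring
  have h3 : ((P - 1)ᴴ * (P * P + P + P) * (P - 1)).PosSemidef := by
    refine PosSemidef.conjTranspose_mul_mul_same ?_ _
    rw [hPP]
    exact ((Matrix.posSemidef_gram ℂ Z).add hP).add hP
  have h4 := (Complex.le_def.1 (h3.diag_nonneg (i := j))).1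
  rw [← h2, Matrix.sub_apply, Complex.sub_re] at h4
  rw [h1, ← re_gram_self, gram_comb, hZ₀, Matrix.mul_one]
  simpa using h4

variable (ι) in
/-- Nearly orthonormal tuples are near to each other, up to a unitary transformation. -/
theorem exists_nhds_one_linearIsometryEquiv {η : ℝ} (hη : 0 < η) :
    ∃ N ∈ 𝓝 (1 : Matrix ι ι ℂ), ∀ (n : ℕ) (Z Z' : ι → Cn n), gram ℂ Z ∈ N → gram ℂ Z' ∈ N →
      ∃ H : Cn n ≃ₗᵢ[ℂ] Cn n, ∀ j, ‖H (Z j) - Z' j‖ < η := by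
  have h1 : ∀ᶠ M in 𝓝 (1 : Matrix ι ι ℂ), M.det ≠ 0 :=
    (Continuous.matrix_det continuous_id).continuousAt.eventually_ne (by simp)
  have h2 : ∀ᶠ M in 𝓝 (1 : Matrix ι ι ℂ), ∀ j,
      (((M - 1)ᴴ * (M - 1) : Matrix ι ι ℂ) j j).re < (η / 2) ^ 2 := by
    rw [eventually_all]
    intro j
    have hc : Continuous fun M : Matrix ι ι ℂ => (((M - 1)ᴴ * (M - 1) : Matrix ι ι ℂ) j j).re := by fun_prop
    refine (hc.tendsto 1).eventually_lt_const ?_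
    simp; positivity
  refine ⟨_, h1.and h2, fun n Z Z' hZ hZ' => ?_⟩
  obtain ⟨Y, hY, hYZ⟩ := exists_orthonormal_near Z hZ.1
  obtain ⟨Y', hY', hYZ'⟩ := exists_orthonormal_near Z' hZ'.1
  obtain ⟨H, hH⟩ := exists_linearIsometryEquiv_of_orthonormal (orthonormal_of_gram_eq_one hY)
    (orthonormal_of_gram_eq_one hY')
  refine ⟨H, fun j => ?_⟩
  have h3 : ‖Z j - Y j‖ < η / 2 :=
    lt_of_pow_lt_pow_left₀ 2 (by positivity) ((hYZ j).trans_lt (hZ.2 j))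
  have h4 : ‖Z' j - Y' j‖ < η / 2 :=
    lt_of_pow_lt_pow_left₀ 2 (by positivity) ((hYZ' j).trans_lt (hZ'.2 j))
  calc ‖H (Z j) - Z' j‖ = ‖H (Z j - Y j) - (Z' j - Y' j)‖ := by rw [map_sub, hH]; congr 1; abel
    _ ≤ ‖H (Z j - Y j)‖ + ‖Z' j - Y' j‖ := norm_sub_le _ _
    _ < η := by rw [H.norm_map]; linarith

end Isometry

/-! ### The action of `U(n)` on `ℂⁿ` -/

section Action

/-- The unitary group acts on `ℂⁿ` by linear isometries. -/
noncomputable def uact (n : ℕ) : unitaryGroup (Fin n) ℂ ≃* (Cn n ≃ₗᵢ[ℂ] Cn n) :=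
  (Unitary.mapEquiv
    { (Matrix.toEuclideanCLM (n := Fin n) (𝕜 := ℂ) : _ ≃* (Cn n →L[ℂ] Cn n)) with
      map_star' := map_star (Matrix.toEuclideanCLM (n := Fin n) (𝕜 := ℂ)) }).toMulEquiv.trans
    Unitary.linearIsometryEquiv

variable {n : ℕ}

theorem uact_apply (U : unitaryGroup (Fin n) ℂ) (x : Cn n) :
    uact n U x = WithLp.toLp 2 ((U : Matrix (Fin n) (Fin n) ℂ) *ᵥ x.ofLp) := by
  rfl

theorem Continuous.uact {α : Type*} [TopologicalSpace α] {f : α → unitaryGroup (Fin n) ℂ}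
    {g : α → Cn n} (hf : Continuous f) (hg : Continuous g) :
    Continuous fun a => uact n (f a) (g a) := by
  simp only [uact_apply]
  exact (PiLp.continuous_toLp 2 _).comp ((continuous_subtype_val.comp hf).matrix_mulVec
    ((PiLp.continuous_ofLp 2 _).comp hg))

instance : SecondCountableTopology (unitaryGroup (Fin n) ℂ) :=
  haveI : SecondCountableTopology (Matrix (Fin n) (Fin n) ℂ) :=
    inferInstanceAs (SecondCountableTopology (Fin n → Fin n → ℂ))
  inferInstanceAs (SecondCountableTopology
    ((unitaryGroup (Fin n) ℂ : Set (Matrix (Fin n) (Fin n) ℂ))))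

instance : CompactSpace (unitaryGroup (Fin n) ℂ) := by
  refine isCompact_iff_compactSpace.mp
    (?_ : IsCompact (unitaryGroup (Fin n) ℂ : Set (Matrix (Fin n) (Fin n) ℂ)))
  have hK : IsCompact (Set.univ.pi fun _ : Fin n => Set.univ.pi fun _ : Fin n =>
      Metric.closedBall (0 : ℂ) 1) :=
    isCompact_univ_pi fun _ => isCompact_univ_pi fun _ => isCompact_closedBall _ _
  refine IsCompact.of_isClosed_subset (X := Matrix (Fin n) (Fin n) ℂ) hK
    (isClosed_unitary (R := Matrix (Fin n) (Fin n) ℂ)) fun U hU i _ j _ => ?_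
  rw [mem_closedBall_zero_iff]
  exact entry_norm_bound_of_unitary hU i j


end Action

/-! ### Entrywise neighbourhoods of matrices -/

section EntryBall

variable {ι : Type*} [Fintype ι]

/-- The matrices all of whose entries are within `δ` of those of `M`. -/
def entryBall (M : Matrix ι ι ℂ) (δ : ℝ) : Set (Matrix ι ι ℂ) :=
  {M' | ∀ i j, ‖M' i j - M i j‖ < δ}

theorem entryBall_eq_pi (M : Matrix ι ι ℂ) (δ : ℝ) :
    entryBall M δ = Set.univ.pi fun i => Set.univ.pi fun j => Metric.ball (M i j) δ := by
  ext M'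
  constructor
  · exact fun h i _ j _ => mem_ball_iff_norm.2 (h i j)
  · exact fun h i j => mem_ball_iff_norm.1 (h i trivial j trivial)

theorem isOpen_entryBall (M : Matrix ι ι ℂ) (δ : ℝ) : IsOpen (entryBall M δ) := by
  rw [entryBall_eq_pi]
  exact isOpen_set_pi Set.finite_univ fun _ _ =>
    isOpen_set_pi Set.finite_univ fun _ _ => Metric.isOpen_ball

theorem entryBall_mem_nhds (M : Matrix ι ι ℂ) {δ : ℝ} (hδ : 0 < δ) : entryBall M δ ∈ 𝓝 M :=
  (isOpen_entryBall M δ).mem_nhds fun i j => by simpa using hδ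

theorem entryBall_mono (M : Matrix ι ι ℂ) {δ δ' : ℝ} (h : δ ≤ δ') :
    entryBall M δ ⊆ entryBall M δ' := fun _ hM i j => (hM i j).trans_le h

theorem exists_entryBall_subset {M : Matrix ι ι ℂ} {N : Set (Matrix ι ι ℂ)} (hN : N ∈ 𝓝 M) :
    ∃ δ > 0, entryBall M δ ⊆ N := by
  obtain ⟨δ, hδ, h⟩ := (Metric.mem_nhds_iff (α := ι → ι → ℂ)).1 hN
  exact ⟨δ, hδ, fun M' hM' => h ((dist_pi_lt_iff hδ).2 fun i =>
    (dist_pi_lt_iff hδ).2 fun j => (dist_eq_norm _ _).trans_lt (hM' i j))⟩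

theorem continuous_gram {n : ℕ} : Continuous fun Z : ι → Cn n => gram ℂ Z := by
  refine continuous_pi fun i => continuous_pi fun j => ?_
  simp only [gram_apply]
  fun_prop

theorem gram_isometry {n : ℕ} (H : Cn n ≃ₗᵢ[ℂ] Cn n) (Z : ι → Cn n) :
    gram ℂ (fun i => H (Z i)) = gram ℂ Z := by
  ext i j
  simp

end EntryBall

theorem isOpen_nearOrtho {ι κ : Type*} [Fintype ι] [Fintype κ] [DecidableEq ι] {n : ℕ} (δ : ℝ)
    (X : κ → Cn n) : IsOpen (nearOrtho (ι := ι) δ X) := by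
  refine (isOpen_polyball 1).inter (((isOpen_entryBall 1 δ).preimage continuous_gram).inter ?_)
  have : {Z : ι → Cn n | ∀ i j, ‖inner ℂ (X i) (Z j)‖ < δ}
      = ⋂ i, ⋂ j, {Z | ‖inner ℂ (X i) (Z j)‖ < δ} := by ext; simp
  change IsOpen {Z : ι → Cn n | ∀ i j, ‖inner ℂ (X i) (Z j)‖ < δ}
  rw [this]
  exact isOpen_iInter_of_finite fun i => isOpen_iInter_of_finite fun j =>
    isOpen_lt (by fun_prop) continuous_const

/-! ### Hitting probabilities of a Haar unitary: upper bound -/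

section Hit

variable {ι : Type*} [Fintype ι] {n : ℕ}

/-- The probability that a random unitary matrix moves each `X j` to a point within
distance `ρ` of `Y j`. -/
noncomputable def hit (ν : Measure (unitaryGroup (Fin n) ℂ)) (X Y : ι → Cn n) (ρ : ℝ) : ENNReal :=
  ν {U | ∀ j, ‖Y j - uact n U (X j)‖ < ρ}

theorem isOpen_setOf_hit (X : ι → Cn n) (ρ : ℝ) :
    IsOpen {p : (ι → Cn n) × unitaryGroup (Fin n) ℂ | ∀ j, ‖p.1 j - uact n p.2 (X j)‖ < ρ} := by
  simp only [Set.ofPred_forall]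
  refine isOpen_iInter_of_finite fun j => isOpen_lt ?_ continuous_const
  have : Continuous fun p : (ι → Cn n) × unitaryGroup (Fin n) ℂ => uact n p.2 (X j) :=
    continuous_snd.uact continuous_const
  exact (((continuous_apply j).comp continuous_fst).sub this).norm

variable (ν : Measure (unitaryGroup (Fin n) ℂ))

/-- Left invariance allows the target to be rotated at no cost. Up to a small change of radius, the
hitting probability thus depends on the target only up to a unitary transformation. -/
theorem hit_le_of_near [ν.IsMulLeftInvariant] (X : ι → Cn n) {Y Y' : ι → Cn n} {ρ η ρ' : ℝ}
    (H : Cn n ≃ₗᵢ[ℂ] Cn n) (hH : ∀ j, ‖H (Y j) - Y' j‖ < η) (hρ : ρ + η ≤ ρ') :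
    hit ν X Y ρ ≤ hit ν X Y' ρ' := by
  obtain ⟨G, rfl⟩ := (uact n).surjective H
  rw [hit, hit, ← measure_preimage_mul ν G {U | ∀ j, ‖Y' j - uact n U (X j)‖ < ρ'}]
  refine measure_mono fun U hU j => ?_
  have h1 : Y' j - uact n (G * U) (X j)
      = uact n G (Y j - uact n U (X j)) - (uact n G (Y j) - Y' j) := by
    rw [map_mul, map_sub, LinearIsometryEquiv.coe_mul, Function.comp_apply]; abel
  change ‖Y' j - uact n (G * U) (X j)‖ < ρ'
  rw [h1]
  have h2 := hU j
  have h3 := norm_sub_le (uact n G (Y j - uact n U (X j))) (uact n G (Y j) - Y' j)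
  rw [LinearIsometryEquiv.norm_map] at h3
  linarith [hH j]

/-- Fubini: averaging over targets turns hitting probabilities into volumes of neighbourhoods of the
moved tuple. -/
theorem setLIntegral_hit [SFinite ν] (X : ι → Cn n) (ρ : ℝ) (A : Set (ι → Cn n)) :
    ∫⁻ Y in A, hit ν X Y ρ ∂(tupVol ι n) =
      ∫⁻ U, (tupVol ι n).restrict A {Y | ∀ j, ‖Y j - uact n U (X j)‖ < ρ} ∂ν := by
  have hm := (isOpen_setOf_hit X ρ).measurableSet
  have h1 := Measure.prod_apply (μ := (tupVol ι n).restrict A) (ν := ν) hm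
  have h2 := Measure.prod_apply_symm (μ := (tupVol ι n).restrict A) (ν := ν) hm
  exact h1.symm.trans h2

theorem tupVol_near (X : ι → Cn n) {ρ : ℝ} (hρ : 0 < ρ) :
    tupVol ι n {Y | ∀ j, ‖Y j - X j‖ < ρ}
      = ENNReal.ofReal (ρ ^ (2 * Fintype.card ι)) ^ n := by
  have h := tupVol_polyball (ι := ι) (n := n) hρ
  rw [← measure_preimage_add_right (tupVol ι n) (-X)] at h
  rw [← ENNReal.ofReal_pow (by positivity), ← pow_mul, ENNReal.ofReal_pow hρ.le,
    show 2 * Fintype.card ι * n = 2 * n * Fintype.card ι by ring, ← h]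
  simp [polyball, sub_eq_add_neg]

/-- The diagonal of `Dᴴ * D` holds the squared norms of the columns of `D`, so it bounds every
coefficient. -/
theorem norm_comb_lt [DecidableEq ι] {D : Matrix ι ι ℂ} {b η : ℝ} (hb : 0 < b)
    (hD : ∀ j, ((Dᴴ * D) j j).re ≤ b ^ 2) {E : ι → Cn n} (hE : ∀ j, ‖E j‖ < η)
    (j : ι) : ‖comb D E j‖ ≤ b * Fintype.card ι * η := by
  have h1 : ∀ i, ‖D i j‖ ≤ b := by
    intro i
    have h2 : ((Dᴴ * D) j j).re = ∑ i, ‖D i j‖ ^ 2 := by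
      simp only [Matrix.mul_apply, conjTranspose_apply, Complex.re_sum]
      refine Finset.sum_congr rfl fun i _ => ?_
      rw [Complex.star_def, ← Complex.normSq_eq_conj_mul_self, Complex.normSq_eq_norm_sq,
        Complex.ofReal_re]
    have h3 : ‖D i j‖ ^ 2 ≤ ∑ i, ‖D i j‖ ^ 2 :=
      Finset.single_le_sum (f := fun i => ‖D i j‖ ^ 2) (fun _ _ => by positivity)
        (Finset.mem_univ i)
    exact le_of_sq_le_sq (h3.trans (h2 ▸ hD j)) hb.le
  calc ‖comb D E j‖ ≤ ∑ i, ‖D i j • E i‖ := norm_sum_le _ _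
    _ ≤ ∑ _i : ι, b * η := Finset.sum_le_sum fun i _ => by
        rw [norm_smul]; exact mul_le_mul (h1 i) (hE i).le (norm_nonneg _) hb.le
    _ = _ := by simp; ring

variable (ι) in
-- Targets with nearly the same Gram matrix as `Y` are hit about equally often, so the probability
-- for `Y` is at most an average: the volume of a `(1 + η)ρ`-neighbourhood over the volume of the
-- targets. The neighbourhood `N` is chosen before `ρ`. For this reason the targets are images of
-- nearly orthonormal tuples under a `D` with `Dᴴ * D = gram ℂ Y`, which can be matched to `Y` at
-- any scale.
theorem exists_nhds_one_hit_le [DecidableEq ι] {κ : ℝ} (hκ : 0 < κ) :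
    ∃ N ∈ 𝓝 (1 : Matrix ι ι ℂ), ∀ ρ : ℝ, 0 < ρ → ∀ᶠ n in atTop,
      ∀ (ν : Measure (unitaryGroup (Fin n) ℂ)) [ν.IsMulLeftInvariant] [IsProbabilityMeasure ν]
        (X Y : ι → Cn n), gram ℂ Y ∈ N →
        hit ν X Y ρ ≤ 2 * ENNReal.ofReal ((1 + κ) * ρ ^ (2 * Fintype.card ι)) ^ n := by
  obtain ⟨η, hη, hη0⟩ : ∃ η : ℝ, (1 + η) ^ (2 * Fintype.card ι) < 1 + κ / 2 ∧ 0 < η := by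
    have hc : Continuous fun η : ℝ => (1 + η) ^ (2 * Fintype.card ι) := by fun_prop
    have := (hc.tendsto 0).eventually_lt_const (show _ < 1 + κ / 2 by simpa using hκ)
    exact ((this.filter_mono nhdsWithin_le_nhds).and
      (self_mem_nhdsWithin : Set.Ioi (0 : ℝ) ∈ 𝓝[>] 0)).exists
  have h1 : ∀ᶠ M in 𝓝 (1 : Matrix ι ι ℂ), 1 + κ / 2 < M.det.re * (1 + κ) := by
    have hc : Continuous fun M : Matrix ι ι ℂ => M.det.re * (1 + κ) := by fun_prop
    refine (hc.tendsto 1).eventually_const_lt ?_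
    simpa using hκ
  have h2 : ∀ᶠ M in 𝓝 (1 : Matrix ι ι ℂ), ∀ j, (M j j).re < 2 ^ 2 := by
    rw [eventually_all]
    intro j
    have hc : Continuous fun M : Matrix ι ι ℂ => (M j j).re := by fun_prop
    refine (hc.tendsto 1).eventually_lt_const ?_
    norm_num
  refine ⟨_, h1.and h2, fun ρ hρ => ?_⟩
  -- By `norm_comb_lt` with `b = 2`, an error `η'` before applying `D` becomes less than `η * ρ`
  -- afterwards.
  set η' := η * ρ / (2 * Fintype.card ι + 1)
  have hη' : 0 < η' := by positivity
  obtain ⟨N₁, hN₁, hst⟩ := exists_nhds_one_linearIsometryEquiv ι hη'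
  obtain ⟨δ, hδ, hδN⟩ := exists_entryBall_subset hN₁
  filter_upwards [eventually_half_le_tupVol_nearOrtho ι Empty hδ] with n hn ν _ _ X Y hY
  have hvol := hn Empty.elim (fun i => i.elim)
  set S : Set (ι → Cn n) := nearOrtho δ (Empty.elim : Empty → Cn n)
  obtain ⟨hY1, hY2⟩ := hY
  set d := (gram ℂ Y).det.re
  have hd : 0 < d := by
    by_contra! h
    nlinarith
  have hpd : (gram ℂ Y).PosDef := by
    rw [(Matrix.posSemidef_gram ℂ Y).posDef_iff_det_ne_zero]
    intro h
    simp [d, h] at hd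
  obtain ⟨D, hD, hD0, hdet⟩ := exists_conjTranspose_mul_self hpd
  have hgram1 : gram ℂ (comb D⁻¹ Y) = 1 := by
    rw [gram_comb, ← hD, ← Matrix.mul_assoc, ← conjTranspose_mul, mul_nonsing_inv _ hD0.isUnit,
      conjTranspose_one, Matrix.one_mul, mul_nonsing_inv _ hD0.isUnit]
  have hle : ∀ Y' ∈ comb D '' S, hit ν X Y ρ ≤ hit ν X Y' ((1 + η) * ρ) := by
    rintro _ ⟨Z', hZ', rfl⟩
    obtain ⟨H, hH⟩ := hst n (comb D⁻¹ Y) Z' (hgram1 ▸ mem_of_mem_nhds hN₁) (hδN hZ'.2.1)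
    refine hit_le_of_near ν X H (η := η * ρ) (fun j => ?_) (by linarith)
    have h3 : H (Y j) - comb D Z' j = comb D (fun i => H (comb D⁻¹ Y i) - Z' i) j := by
      conv_lhs => rw [← comb_inv_comb hD0 Y]
      rw [← congrFun (comb_isometry D (comb D⁻¹ Y) H) j]
      simp only [comb_apply _ (fun i => H (comb D⁻¹ Y i)), comb_apply _ Z', comb_apply D
        (fun i => H (comb D⁻¹ Y i) - Z' i), smul_sub, Finset.sum_sub_distrib]
    rw [h3]
    refine (norm_comb_lt two_pos (fun j => ?_) hH j).trans_lt ?_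
    · rw [hD]; exact (hY2 j).le
    · rw [mul_div_assoc', div_lt_iff₀ (by positivity)]
      nlinarith [mul_pos hη0 hρ]
  have hS : tupVol ι n (comb D '' S) ≥ ENNReal.ofReal d ^ n * ENNReal.ofReal (1 / 2) := by
    rw [tupVol_image_comb, hdet]
    gcongr
  have hint : hit ν X Y ρ * (ENNReal.ofReal d ^ n * ENNReal.ofReal (1 / 2))
      ≤ ENNReal.ofReal (((1 + η) * ρ) ^ (2 * Fintype.card ι)) ^ n := by
    calc _ ≤ hit ν X Y ρ * tupVol ι n (comb D '' S) := by gcongr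
      _ = ∫⁻ _ in comb D '' S, hit ν X Y ρ ∂(tupVol ι n) := by rw [setLIntegral_const]
      _ ≤ ∫⁻ Y' in comb D '' S, hit ν X Y' ((1 + η) * ρ) ∂(tupVol ι n) := by
        refine setLIntegral_mono_ae' ?_ (ae_of_all _ hle)
        have : comb D '' S = comb (n := n) D⁻¹ ⁻¹' S := by
          ext W
          constructor
          · rintro ⟨Z, hZ, rfl⟩
            rwa [Set.mem_preimage, comb_comb_inv hD0]
          · exact fun hW => ⟨_, hW, comb_inv_comb hD0 W⟩
        rw [this]
        exact ((isOpen_nearOrtho _ _).preimage (LinearMap.continuous_of_finiteDimensional _)).measurableSet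
      _ ≤ ∫⁻ Y' in Set.univ, hit ν X Y' ((1 + η) * ρ) ∂(tupVol ι n) :=
        lintegral_mono_set (Set.subset_univ _)
      _ = ∫⁻ _U, ENNReal.ofReal (((1 + η) * ρ) ^ (2 * Fintype.card ι)) ^ n ∂ν := by
        rw [setLIntegral_hit]
        refine lintegral_congr fun U => ?_
        rw [Measure.restrict_univ, tupVol_near (fun j => uact n U (X j)) (by positivity)]
      _ = _ := by simp
  have h4 : ENNReal.ofReal (((1 + η) * ρ) ^ (2 * Fintype.card ι)) ^ n
      ≤ ENNReal.ofReal d ^ n * ENNReal.ofReal ((1 + κ) * ρ ^ (2 * Fintype.card ι)) ^ n := by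
    rw [← mul_pow, ← ENNReal.ofReal_mul hd.le, mul_pow (1 + η), ← mul_assoc]
    refine pow_le_pow_left' (ENNReal.ofReal_le_ofReal ?_) n
    exact mul_le_mul_of_nonneg_right (hη.le.trans hY1.le) (by positivity)
  have h5 : ENNReal.ofReal d ^ n ≠ 0 := pow_ne_zero _ (by simpa using hd)
  have h6 : ENNReal.ofReal d ^ n ≠ ⊤ := by finiteness
  have h7 : (2 : ENNReal) * ENNReal.ofReal (1 / 2) = 1 := by
    rw [← ENNReal.ofReal_ofNat, ← ENNReal.ofReal_mul (by norm_num)]; norm_num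
  rw [← ENNReal.mul_le_mul_iff_right h5 h6]
  calc ENNReal.ofReal d ^ n * hit ν X Y ρ
      = 2 * (hit ν X Y ρ * (ENNReal.ofReal d ^ n * ENNReal.ofReal (1 / 2))) := by
        have h8 : 2 * (hit ν X Y ρ * (ENNReal.ofReal d ^ n * ENNReal.ofReal (1 / 2)))
            = 2 * ENNReal.ofReal (1 / 2) * (ENNReal.ofReal d ^ n * hit ν X Y ρ) := by ring
        rw [h8, h7, one_mul]
    _ ≤ 2 * (ENNReal.ofReal d ^ n * ENNReal.ofReal ((1 + κ) * ρ ^ (2 * Fintype.card ι)) ^ n) := by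
        exact mul_le_mul_right (hint.trans h4) 2
    _ = _ := by ring

end Hit

/-! ### Hitting probabilities of a Haar unitary: lower bound -/

section HitLower

variable {ι : Type*} [Fintype ι] [DecidableEq ι] {n : ℕ}

theorem norm_sq_lt_of_gram_mem_entryBall {Z : ι → Cn n} {δ : ℝ}
    (h : gram ℂ Z ∈ entryBall 1 δ) (j : ι) : ‖Z j‖ ^ 2 < 1 + δ := by
  have h1 := h j j
  have h2 := (Complex.abs_re_le_norm _).trans_lt h1
  rw [Complex.sub_re, re_gram_self, Matrix.one_apply_eq, Complex.one_re, abs_lt] at h2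
  linarith

theorem tupVol_gram_entryBall_le {δ θ : ℝ} (hδ : 0 < δ) (hδθ : δ ≤ θ) :
    tupVol ι n {Z | gram ℂ Z ∈ entryBall 1 δ}
      ≤ ENNReal.ofReal ((1 + θ) ^ Fintype.card ι) ^ n := by
  have hθ : 0 < 1 + θ := by linarith
  calc _ ≤ tupVol ι n (polyball ι n (√(1 + θ))) := measure_mono fun Z hZ j =>
        Real.lt_sqrt_of_sq_lt ((norm_sq_lt_of_gram_mem_entryBall hZ j).trans_le (by linarith))
    _ = _ := by
      rw [tupVol_polyball (Real.sqrt_pos.2 hθ), mul_assoc, pow_mul, ← ENNReal.ofReal_pow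
        (Real.sqrt_nonneg _), Real.sq_sqrt hθ.le, mul_comm, pow_mul, ENNReal.ofReal_pow hθ.le]

theorem gram_add_smul_mem_entryBall {X G : ι → Cn n} {a r δ : ℝ} (ha : 0 ≤ a) (hr : 0 ≤ r)
    (har : a ^ 2 + r ^ 2 = 1) (hδ : 0 < δ) (hX : gram ℂ X ∈ entryBall 1 (δ / 4))
    (hG : G ∈ nearOrtho (δ / 4) X) :
    gram ℂ (fun j => (r : ℂ) • G j + (a : ℂ) • X j) ∈ entryBall 1 δ := by
  intro i j
  have e : gram ℂ (fun j => (r : ℂ) • G j + (a : ℂ) • X j) i j - (1 : Matrix ι ι ℂ) i j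
      = ((r ^ 2 : ℝ) : ℂ) * (gram ℂ G i j - (1 : Matrix ι ι ℂ) i j)
        + ((a * r : ℝ) : ℂ) * (inner ℂ (X i) (G j) + inner ℂ (G i) (X j))
        + ((a ^ 2 : ℝ) : ℂ) * (gram ℂ X i j - (1 : Matrix ι ι ℂ) i j) := by
    simp only [gram_apply, inner_add_left, inner_add_right, inner_smul_left, inner_smul_right,
      Complex.conj_ofReal]
    have : (a : ℂ) ^ 2 + (r : ℂ) ^ 2 = 1 := by exact_mod_cast har
    push_cast
    linear_combination (1 : Matrix ι ι ℂ) i j * this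
  have h1 := hG.2.1 i j
  have h2 := hG.2.2 i j
  have h3 := hG.2.2 j i
  rw [norm_inner_symm] at h3
  have h4 := hX i j
  have h5 := norm_add_le (inner ℂ (X i) (G j)) (inner ℂ (G i) (X j))
  rw [e]
  refine (norm_add₃_le).trans_lt ?_
  rw [norm_mul, norm_mul, norm_mul, Complex.norm_real, Complex.norm_real, Complex.norm_real,
    Real.norm_of_nonneg (by positivity), Real.norm_of_nonneg (by positivity),
    Real.norm_of_nonneg (by positivity)]
  have h6 : r ^ 2 * ‖gram ℂ G i j - (1 : Matrix ι ι ℂ) i j‖ ≤ r ^ 2 * (δ / 4) := by gcongr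
  have h7 : a ^ 2 * ‖gram ℂ X i j - (1 : Matrix ι ι ℂ) i j‖ ≤ a ^ 2 * (δ / 4) :=
    mul_le_mul_of_nonneg_left h4.le (by positivity)
  have h8 : a * r * ‖inner ℂ (X i) (G j) + inner ℂ (G i) (X j)‖ ≤ a * r * (δ / 2) :=
    mul_le_mul_of_nonneg_left (by linarith) (by positivity)
  have h9 : 2 * (a * r) ≤ 1 := by nlinarith [sq_nonneg (a - r)]
  nlinarith

/-- Near a nearly orthonormal tuple, a large part of the volume consists of nearly orthonormal
tuples. -/
theorem le_tupVol_near_inter {X : ι → Cn n} {r ρ δ : ℝ} (hr : 0 < r) (hr1 : r < 1)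
    (hρ : r + 2 * r ^ 2 ≤ ρ) (hδ : 0 < δ) (hδ1 : δ ≤ 1) (hX : gram ℂ X ∈ entryBall 1 (δ / 4))
    (hvol : ENNReal.ofReal (1 / 2) ≤ tupVol ι n (nearOrtho (δ / 4) X)) :
    ENNReal.ofReal (1 / 2) * ENNReal.ofReal (r ^ (2 * Fintype.card ι)) ^ n
      ≤ tupVol ι n ({Y | ∀ j, ‖Y j - X j‖ < ρ} ∩ {Y | gram ℂ Y ∈ entryBall 1 δ}) := by
  -- The tuples `r G + a X`, with `G` nearly orthonormal and nearly orthogonal to `X`, are nearly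
  -- orthonormal because `a² + r² = 1`. They lie within `r + 2r²` of `X`, since `1 - a ≤ r²` and the
  -- members of `X` have norm at most two.
  set a := √(1 - r ^ 2)
  have ha : a ^ 2 = 1 - r ^ 2 := Real.sq_sqrt (by nlinarith)
  have ha0 : 0 ≤ a := Real.sqrt_nonneg _
  have ha1 : a ≤ 1 := by nlinarith
  have hsub : comb ((r : ℂ) • (1 : Matrix ι ι ℂ)) '' (nearOrtho (δ / 4) X) ⊆
      (fun Y => Y + fun j => (a : ℂ) • X j) ⁻¹'
        ({Y | ∀ j, ‖Y j - X j‖ < ρ} ∩ {Y | gram ℂ Y ∈ entryBall 1 δ}) := by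
    rintro _ ⟨G, hG, rfl⟩
    have hc : comb ((r : ℂ) • (1 : Matrix ι ι ℂ)) G = fun j => (r : ℂ) • G j := by
      funext j; simp [comb_apply, Matrix.one_apply]
    rw [hc]
    refine ⟨fun j => ?_, gram_add_smul_mem_entryBall ha0 hr.le (by linarith) hδ hX hG⟩
    have hX2 : ‖X j‖ ≤ 2 := by
      have := norm_sq_lt_of_gram_mem_entryBall hX j
      nlinarith [norm_nonneg (X j)]
    have e : ((r : ℂ) • G j + (a : ℂ) • X j) - X j = (r : ℂ) • G j - ((1 - a : ℝ) : ℂ) • X j := by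
      push_cast; rw [sub_smul, one_smul]; abel
    change ‖((r : ℂ) • G j + (a : ℂ) • X j) - X j‖ < ρ
    rw [e]
    refine (norm_sub_le _ _).trans_lt ?_
    rw [norm_smul, norm_smul, Complex.norm_real, Complex.norm_real, Real.norm_of_nonneg hr.le,
      Real.norm_of_nonneg (by linarith)]
    have h1 : r * ‖G j‖ < r * 1 := mul_lt_mul_of_pos_left (hG.1 j) hr
    have h2 : (1 - a) * ‖X j‖ ≤ r ^ 2 * 2 :=
      mul_le_mul (by nlinarith) hX2 (norm_nonneg _) (by positivity)
    linarith
  rw [← measure_preimage_add_right (tupVol ι n) (fun j => (a : ℂ) • X j)]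
  refine le_trans ?_ (measure_mono hsub)
  rw [tupVol_image_comb, mul_comm]
  refine mul_le_mul' (le_of_eq ?_) hvol
  congr 2
  rw [det_smul, det_one, mul_one, norm_pow, Complex.norm_real, Real.norm_of_nonneg hr.le, ← pow_mul,
    mul_comm]

variable (ι) in
theorem exists_nhds_one_le_hit {κ : ℝ} (hκ : 0 < κ) (hκ1 : κ < 1) :
    -- The probability is bounded below by its average over nearly orthonormal targets, enough of
    -- which lie close to the moved tuple by `le_tupVol_near_inter`. In contrast to the upper bound,
    -- `N` depends on `ρ`.
    ∃ ρ₀ > 0, ∀ ρ : ℝ, 0 < ρ → ρ ≤ ρ₀ → ∃ N ∈ 𝓝 (1 : Matrix ι ι ℂ), ∀ᶠ n in atTop,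
      ∀ (ν : Measure (unitaryGroup (Fin n) ℂ)) [ν.IsMulLeftInvariant] [IsProbabilityMeasure ν]
        (X Y : ι → Cn n), gram ℂ X ∈ N → gram ℂ Y ∈ N →
        ENNReal.ofReal (1 / 2) * ENNReal.ofReal ((1 - κ) * ρ ^ (2 * Fintype.card ι)) ^ n
          ≤ hit ν X Y ρ := by
  obtain ⟨θ, ⟨hθ, hθ1⟩, hθ0⟩ : ∃ θ : ℝ, ((1 - κ) * (1 + θ) ^ Fintype.card ι
      < (1 - θ) ^ (2 * Fintype.card ι) ∧ θ < 1) ∧ 0 < θ := by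
    have hc : Continuous fun θ : ℝ => (1 - κ) * (1 + θ) ^ Fintype.card ι := by fun_prop
    have hc' : Continuous fun θ : ℝ => (1 - θ) ^ (2 * Fintype.card ι) := by fun_prop
    have h1 := hc.continuousAt.eventually_lt hc'.continuousAt
      (show (1 - κ) * (1 + (0 : ℝ)) ^ Fintype.card ι < (1 - 0) ^ (2 * Fintype.card ι) by simpa)
    exact (((h1.and (eventually_lt_nhds one_pos)).filter_mono nhdsWithin_le_nhds).and
      (self_mem_nhdsWithin : Set.Ioi (0 : ℝ) ∈ 𝓝[>] 0)).exists
  -- For `ρ ≤ θ / 4` and `r = (1 - θ) * ρ` one has `r + 2r² ≤ ρ - θρ/2`, the radius that remains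
  -- after the target has been moved by `θρ/2`.
  refine ⟨θ / 4, by positivity, fun ρ hρ hρθ => ?_⟩
  obtain ⟨N₁, hN₁, hst⟩ := exists_nhds_one_linearIsometryEquiv ι
    (show 0 < θ * ρ / 2 by positivity)
  obtain ⟨δ₁, hδ₁, hδN⟩ := exists_entryBall_subset hN₁
  set δ := min δ₁ θ
  have hδ : 0 < δ := lt_min hδ₁ hθ0
  have hδθ : δ ≤ θ := min_le_right _ _
  refine ⟨entryBall 1 (δ / 4), entryBall_mem_nhds _ (by positivity), ?_⟩
  filter_upwards [eventually_half_le_tupVol_nearOrtho ι ι (show 0 < δ / 4 by positivity)]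
    with n hn ν _ _ X Y hX hY
  set r := (1 - θ) * ρ
  have hr : 0 < r := mul_pos (by linarith) hρ
  have hrρ : r ≤ ρ := by nlinarith
  set A : Set (ι → Cn n) := {Z | gram ℂ Z ∈ entryBall 1 δ}
  have hA : IsOpen A := (isOpen_entryBall 1 δ).preimage continuous_gram
  have hle : ∀ Y' ∈ A, hit ν X Y' (ρ - θ * ρ / 2) ≤ hit ν X Y ρ := by
    intro Y' hY'
    obtain ⟨H, hH⟩ := hst n Y' Y (hδN (entryBall_mono _ (min_le_left _ _) hY'))
      (hδN (entryBall_mono _ (by linarith [min_le_left δ₁ θ]) hY))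
    exact hit_le_of_near ν X H hH (by linarith)
  have hint : ENNReal.ofReal (1 / 2) * ENNReal.ofReal (r ^ (2 * Fintype.card ι)) ^ n
      ≤ hit ν X Y ρ * ENNReal.ofReal ((1 + θ) ^ Fintype.card ι) ^ n := by
    calc _ = ∫⁻ _U, ENNReal.ofReal (1 / 2) * ENNReal.ofReal (r ^ (2 * Fintype.card ι)) ^ n ∂ν := by
          simp
      _ ≤ ∫⁻ U, (tupVol ι n).restrict A
            {Y | ∀ j, ‖Y j - uact n U (X j)‖ < ρ - θ * ρ / 2} ∂ν := by
          refine lintegral_mono fun U => ?_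
          rw [Measure.restrict_apply' hA.measurableSet]
          have hg := gram_isometry (uact n U) X
          refine le_tupVol_near_inter hr (by nlinarith) ?_ hδ (hδθ.trans hθ1.le) (by rwa [hg])
            (hn _ fun j => ?_)
          · have : r ^ 2 ≤ ρ * ρ := by rw [sq]; gcongr
            nlinarith
          · have := norm_sq_lt_of_gram_mem_entryBall hX j
            rw [LinearIsometryEquiv.norm_map]
            linarith
      _ = ∫⁻ Y' in A, hit ν X Y' (ρ - θ * ρ / 2) ∂(tupVol ι n) := (setLIntegral_hit ν X _ A).symm
      _ ≤ ∫⁻ _ in A, hit ν X Y ρ ∂(tupVol ι n) :=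
          setLIntegral_mono_ae' hA.measurableSet (ae_of_all _ hle)
      _ = hit ν X Y ρ * tupVol ι n A := by rw [setLIntegral_const]
      _ ≤ _ := by gcongr; exact tupVol_gram_entryBall_le hδ hδθ
  have h5 : ENNReal.ofReal ((1 + θ) ^ Fintype.card ι) ^ n ≠ 0 :=
    pow_ne_zero _ (by simp; positivity)
  have h6 : ENNReal.ofReal ((1 + θ) ^ Fintype.card ι) ^ n ≠ ⊤ := by finiteness
  rw [← ENNReal.mul_le_mul_iff_left h5 h6]
  refine le_trans ?_ hint
  rw [mul_assoc, ← mul_pow, ← ENNReal.ofReal_mul (by nlinarith [pow_pos hρ (2 * Fintype.card ι)])]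
  refine mul_le_mul' le_rfl (pow_le_pow_left' (ENNReal.ofReal_le_ofReal ?_) n)
  rw [mul_pow, mul_right_comm]
  exact mul_le_mul_of_nonneg_right hθ.le (by positivity)

end HitLower

/-! ### Reduced words, grounded sets and balls -/

section Words

open FreeGroup

variable {S : Type*} [DecidableEq S]

/-- Left multiplication by a letter either prepends it or cancels the first letter. This makes the
left Cayley graph a tree, with parents obtained by dropping the first letter. -/
theorem toWord_mk_singleton_mul (a : S × Bool) (y : FreeGroup S) :
    (FreeGroup.mk [a] * y).toWord = a :: y.toWord ∨
      y.toWord = (a.1, !a.2) :: (FreeGroup.mk [a] * y).toWord := by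
  have h : (FreeGroup.mk [a] * y).toWord = reduce (a :: y.toWord) := by
    conv_lhs => rw [← mk_toWord (x := y)]
    rw [mul_mk, toWord_mk, List.singleton_append]
  rw [h, reduce.cons, reduce_toWord]
  rcases hy : y.toWord with _ | ⟨b, l⟩
  · exact Or.inl rfl
  · by_cases hab : a.1 = b.1 ∧ a.2 = !b.2
    · right
      simp [hab]
    · left
      simp [hab]

/-- The group element obtained from `g` by deleting the first letter of its reduced word. -/
def wordParent (g : FreeGroup S) : FreeGroup S := FreeGroup.mk g.toWord.tail

theorem toWord_wordParent (g : FreeGroup S) : (wordParent g).toWord = g.toWord.tail := by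
  rw [wordParent, toWord_mk]
  exact IsReduced.reduce_eq (List.IsChain.tail isReduced_toWord)

theorem exists_toWord_eq_cons {g : FreeGroup S} (hg : g ≠ 1) :
    ∃ a, g.toWord = a :: (wordParent g).toWord ∧ g = FreeGroup.mk [a] * wordParent g := by
  rw [toWord_wordParent]
  rcases h : g.toWord with _ | ⟨a, l⟩
  · exact absurd (toWord_eq_nil_iff.1 h) hg
  · refine ⟨a, rfl, ?_⟩
    rw [wordParent, mul_mk, h, List.tail_cons, List.singleton_append, ← h, mk_toWord]

theorem wordParent_of_toWord_eq {g h : FreeGroup S} {a : S × Bool}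
    (hg : g.toWord = a :: h.toWord) : wordParent g = h := by
  rw [wordParent, hg, List.tail_cons, mk_toWord]

theorem norm_wordParent {g : FreeGroup S} (hg : g ≠ 1) : (wordParent g).norm + 1 = g.norm := by
  obtain ⟨a, ha, -⟩ := exists_toWord_eq_cons hg
  rw [FreeGroup.norm, FreeGroup.norm, ha, List.length_cons]

/-- A finite set of group elements closed under taking suffixes of reduced words. -/
def SuffixClosed (F : Finset (FreeGroup S)) : Prop :=
  1 ∈ F ∧ ∀ g ∈ F, g ≠ 1 → wordParent g ∈ F

theorem mk_true_eq (s : S) : (FreeGroup.mk [(s, true)] : FreeGroup S) = FreeGroup.of s := rfl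

theorem mk_false_eq (s : S) : (FreeGroup.mk [(s, false)] : FreeGroup S) = (FreeGroup.of s)⁻¹ := rfl

theorem exists_of_adj {g h : FreeGroup S} (hgh : (leftCayleyGraph S).Adj g h) :
    ∃ a, h = FreeGroup.mk [a] * g := by
  rw [leftCayleyGraph, SimpleGraph.fromRel_adj] at hgh
  obtain ⟨-, ⟨s, hs⟩ | ⟨s, hs⟩⟩ := hgh
  · exact ⟨(s, true), hs⟩
  · exact ⟨(s, false), by rw [mk_false_eq, hs]; group⟩

theorem adj_wordParent {g : FreeGroup S} (hg : g ≠ 1) :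
    (leftCayleyGraph S).Adj g (wordParent g) := by
  obtain ⟨⟨s, b⟩, ha, hb⟩ := exists_toWord_eq_cons hg
  rw [leftCayleyGraph, SimpleGraph.fromRel_adj]
  refine ⟨fun h => ?_, ?_⟩
  · have := norm_wordParent hg
    rw [← h] at this
    omega
  · cases b
    · left
      refine ⟨s, ?_⟩
      conv_rhs => rw [hb, mk_false_eq]
      group
    · right
      exact ⟨s, hb⟩

/-- A walk inside `F` from `g` to the identity must leave the set of words ending in the word of
`g`, and the only edge out of that set joins `g` to its parent. -/
theorem IsGrounded.suffixClosed {F : Finset (FreeGroup S)} (hF : IsGrounded F) :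
    SuffixClosed F := by
  refine ⟨hF.1, fun g hg hg1 => ?_⟩
  have key : ∀ (u v : (F : Set (FreeGroup S)))
      (_p : ((leftCayleyGraph S).induce (F : Set (FreeGroup S))).Walk u v),
      g.toWord <:+ u.1.toWord → ¬ g.toWord <:+ v.1.toWord → wordParent g ∈ F := by
    intro u v p
    induction p with
    | nil => exact fun h h' => absurd h h'
    | @cons u w v huw p ih =>
      intro hu hv
      by_cases hw : g.toWord <:+ w.1.toWord
      · exact ih hw hv
      · obtain ⟨a, ha⟩ : ∃ a, w.1 = FreeGroup.mk [a] * u.1 :=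
          exists_of_adj (SimpleGraph.comap_adj.1 huw)
        rcases toWord_mk_singleton_mul a u.1 with h | h
        · refine absurd ?_ hw
          rw [ha, h]
          exact hu.trans (List.suffix_cons _ _)
        · rw [← ha] at h
          rw [h, List.suffix_cons_iff] at hu
          rcases hu with hu | hu
          · rw [wordParent_of_toWord_eq hu]
            exact w.2
          · exact absurd hu hw
  obtain ⟨p⟩ := hF.2.preconnected ⟨g, hg⟩ ⟨1, hF.1⟩
  refine key _ _ p List.suffix_rfl fun h => hg1 ?_
  rw [toWord_one, List.suffix_nil] at h
  exact toWord_eq_nil_iff.1 h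

theorem SuffixClosed.isGrounded {F : Finset (FreeGroup S)} (hF : SuffixClosed F) :
    IsGrounded F := by
  have key : ∀ (m : ℕ) (g : FreeGroup S) (hg : g ∈ F), g.norm = m →
      ((leftCayleyGraph S).induce (F : Set (FreeGroup S))).Reachable ⟨g, hg⟩ ⟨1, hF.1⟩ := by
    intro m
    induction m with
    | zero =>
      intro g hg h
      have := FreeGroup.norm_eq_zero.1 h
      subst this
      exact SimpleGraph.Reachable.refl _
    | succ m ih =>
      intro g hg h
      have hg1 : g ≠ 1 := by rintro rfl; simp at h
      have h1 := norm_wordParent hg1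
      refine SimpleGraph.Reachable.trans (SimpleGraph.Adj.reachable ?_)
        (ih (wordParent g) (hF.2 g hg hg1) (by omega))
      exact SimpleGraph.comap_adj.2 (adj_wordParent hg1)
  refine ⟨hF.1, ?_⟩
  have : Nonempty (F : Set (FreeGroup S)) := ⟨⟨1, hF.1⟩⟩
  exact ⟨fun u v => (key _ u.1 u.2 rfl).trans (key _ v.1 v.2 rfl).symm⟩

theorem mem_cayleyBall [Finite S] {n : ℕ} {g : FreeGroup S} :
    g ∈ cayleyBall S n ↔ g.norm ≤ n := by
  rw [cayleyBall, Set.Finite.mem_toFinset]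
  change (leftCayleyGraph S).edist 1 g ≤ n ↔ _
  constructor
  · intro hg
    obtain ⟨p, hp⟩ := SimpleGraph.exists_walk_of_edist_ne_top
      (ne_top_of_le_ne_top (ENat.natCast_ne_top n) hg)
    have key : ∀ (u v : FreeGroup S) (p : (leftCayleyGraph S).Walk u v),
        v.norm ≤ p.length + u.norm := by
      intro u v p
      induction p with
      | nil => simp
      | @cons u w v h p ih =>
        obtain ⟨a, rfl⟩ := exists_of_adj h
        have h1 := FreeGroup.norm_mul_le (FreeGroup.mk [a]) u
        have h2 : (FreeGroup.mk [a]).norm ≤ 1 := FreeGroup.norm_mk_le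
        rw [SimpleGraph.Walk.length_cons]
        omega
    have h := key _ _ p
    rw [← hp] at hg
    have hg : p.length ≤ n := by exact_mod_cast hg
    simp at h
    omega
  · intro hg
    have key : ∀ (m : ℕ) (g : FreeGroup S), g.norm = m →
        ∃ p : (leftCayleyGraph S).Walk g 1, p.length = m := by
      intro m
      induction m with
      | zero =>
        intro g h
        have := FreeGroup.norm_eq_zero.1 h
        subst this
        exact ⟨SimpleGraph.Walk.nil, rfl⟩
      | succ m ih =>
        intro g h
        have hg1 : g ≠ 1 := by rintro rfl; simp at h
        obtain ⟨p, hp⟩ := ih (wordParent g) (by have := norm_wordParent hg1; omega)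
        exact ⟨SimpleGraph.Walk.cons (adj_wordParent hg1) p, by simp [hp]⟩
    obtain ⟨p, hp⟩ := key _ g rfl
    refine (SimpleGraph.edist_le p.reverse).trans ?_
    rw [SimpleGraph.Walk.length_reverse, hp]
    exact_mod_cast hg

theorem suffixClosed_cayleyBall [Finite S] (n : ℕ) : SuffixClosed (cayleyBall S n) := by
  refine ⟨by simp [mem_cayleyBall], fun g hg hg1 => ?_⟩
  rw [mem_cayleyBall] at hg ⊢
  have := norm_wordParent hg1
  omega

theorem exists_subset_cayleyBall [Finite S] (F : Finset (FreeGroup S)) :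
    ∃ n, F ⊆ cayleyBall S n :=
  ⟨F.sup FreeGroup.norm, fun _ hg => mem_cayleyBall.2 (Finset.le_sup (f := FreeGroup.norm) hg)⟩

theorem cayleyBall_mono [Finite S] {m n : ℕ} (h : m ≤ n) : cayleyBall S m ⊆ cayleyBall S n :=
  fun _ hg => mem_cayleyBall.2 ((mem_cayleyBall.1 hg).trans h)

end Words

/-! ### The edges of a grounded set -/

section Edges

variable {S : Type*} [DecidableEq S] {F : Finset (FreeGroup S)}

/-- The set `F ∩ sF`, which indexes the edges of `F` with label `s`. -/
abbrev EdgeSet (F : Finset (FreeGroup S)) (s : S) : Finset (FreeGroup S) :=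
  F ∩ (FreeGroup.of s • F)

theorem mem_edgeSet {s : S} {x : FreeGroup S} :
    x ∈ EdgeSet F s ↔ x ∈ F ∧ (FreeGroup.of s)⁻¹ * x ∈ F := by
  rw [EdgeSet, Finset.mem_inter, Finset.mem_smul_finset]
  refine and_congr_right fun _ => ⟨?_, fun h => ⟨_, h, by simp⟩⟩
  rintro ⟨y, hy, rfl⟩
  simpa using hy

/-- The end of an edge. -/
def edgeTgt {s : S} (x : EdgeSet F s) : F := ⟨x.1, (mem_edgeSet.1 x.2).1⟩

/-- The beginning of an edge. -/
def edgeSrc {s : S} (x : EdgeSet F s) : F := ⟨(FreeGroup.of s)⁻¹ * x.1, (mem_edgeSet.1 x.2).2⟩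

theorem edge_cases (s : S) (x : FreeGroup S) :
    (x ≠ 1 ∧ wordParent x = (FreeGroup.of s)⁻¹ * x) ∨
      ((FreeGroup.of s)⁻¹ * x ≠ 1 ∧ wordParent ((FreeGroup.of s)⁻¹ * x) = x) := by
  have h := toWord_mk_singleton_mul (s, true) ((FreeGroup.of s)⁻¹ * x)
  rw [mk_true_eq, mul_inv_cancel_left] at h
  rcases h with h | h
  · refine Or.inl ⟨?_, wordParent_of_toWord_eq h⟩
    rintro rfl
    simp at h
  · refine Or.inr ⟨?_, wordParent_of_toWord_eq h⟩
    intro h1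
    rw [h1] at h
    simp at h

/-- The end of an edge of a suffix closed set that is further from the identity. -/
def edgeChild (e : Σ s : S, EdgeSet F s) : F :=
  if e.2.1 ≠ 1 ∧ wordParent e.2.1 = (FreeGroup.of e.1)⁻¹ * e.2.1 then edgeTgt e.2 else edgeSrc e.2

theorem edgeChild_spec (e : Σ s : S, EdgeSet F s) :
    ((edgeChild e).1 = e.2.1 ∧ (edgeChild e).1 ≠ 1 ∧
        wordParent (edgeChild e).1 = (FreeGroup.of e.1)⁻¹ * e.2.1) ∨
      ((edgeChild e).1 = (FreeGroup.of e.1)⁻¹ * e.2.1 ∧ (edgeChild e).1 ≠ 1 ∧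
        wordParent (edgeChild e).1 = e.2.1) := by
  by_cases h : e.2.1 ≠ 1 ∧ wordParent e.2.1 = (FreeGroup.of e.1)⁻¹ * e.2.1
  · left
    rw [edgeChild, if_pos h]
    exact ⟨rfl, h⟩
  · right
    rw [edgeChild, if_neg h]
    exact ⟨rfl, (edge_cases e.1 e.2.1).resolve_left h⟩

/-- The child and its parent determine the label and the direction, as a generator is never the
inverse of a generator. With `SuffixClosed.exists_edgeChild_eq`, edges correspond to the elements
other than the identity. -/
theorem edgeChild_injective : Function.Injective (edgeChild (F := F)) := by
  rintro ⟨s, x⟩ ⟨t, y⟩ h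
  have key : ∀ {s t : S} {x y : FreeGroup S}, s = t → x = y → ∀ (hx : x ∈ EdgeSet F s)
      (hy : y ∈ EdgeSet F t), (⟨s, ⟨x, hx⟩⟩ : Σ s : S, EdgeSet F s) = ⟨t, ⟨y, hy⟩⟩ := by
    rintro s t x y rfl rfl _ _; rfl
  have hne : ∀ s t : S, FreeGroup.of s ≠ (FreeGroup.of t)⁻¹ := by
    intro s t h
    have := congrArg FreeGroup.toWord h
    rw [FreeGroup.toWord_inv, FreeGroup.toWord_of, FreeGroup.toWord_of] at this
    simp [FreeGroup.invRev] at this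
  have h1 := edgeChild_spec ⟨s, x⟩
  have h2 := edgeChild_spec ⟨t, y⟩
  rw [← h] at h2
  set g := (edgeChild ⟨s, x⟩).1
  simp only at h1 h2
  rcases h1 with ⟨h1, -, h1'⟩ | ⟨h1, -, h1'⟩ <;> rcases h2 with ⟨h2, -, h2'⟩ | ⟨h2, -, h2'⟩
  · rw [h1', ← h1, ← h2] at h2'
    exact key (FreeGroup.of_injective (inv_injective (mul_right_cancel h2'))) (h1.symm.trans h2) _ _
  · rw [h1'] at h2'
    rw [← h2', ← h1] at h2
    refine absurd (?_ : FreeGroup.of s = (FreeGroup.of t)⁻¹) (hne _ _)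
    have h3 : (FreeGroup.of t)⁻¹ * (FreeGroup.of s)⁻¹ = 1 := by
      rw [← mul_assoc] at h2
      exact (mul_eq_right.1 h2.symm)
    rw [mul_eq_one_iff_eq_inv, inv_inv] at h3
    exact h3.symm
  · rw [h1'] at h2'
    rw [h2', ← h2] at h1
    refine absurd (?_ : FreeGroup.of s = (FreeGroup.of t)⁻¹) (hne _ _)
    have h3 : (FreeGroup.of s)⁻¹ * (FreeGroup.of t)⁻¹ = 1 := by
      rw [← mul_assoc] at h1
      exact (mul_eq_right.1 h1.symm)
    rw [mul_eq_one_iff_eq_inv] at h3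
    exact inv_injective (h3.trans rfl)
  · rw [h1'] at h2'
    rw [h1, h2'] at h2
    exact key (FreeGroup.of_injective (inv_injective (mul_right_cancel h2))) h2' _ _

theorem SuffixClosed.exists_edgeChild_eq (hF : SuffixClosed F) {g : F} (hg : g.1 ≠ 1) :
    ∃ e : Σ s : S, EdgeSet F s, edgeChild e = g := by
  obtain ⟨⟨s, b⟩, ha, hb⟩ := exists_toWord_eq_cons hg
  have hp := hF.2 g.1 g.2 hg
  cases b
  · rw [mk_false_eq] at hb
    have hx : wordParent g.1 ∈ EdgeSet F s := mem_edgeSet.2 ⟨hp, by rw [← hb]; exact g.2⟩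
    refine ⟨⟨s, ⟨wordParent g.1, hx⟩⟩, Subtype.ext ?_⟩
    rcases edgeChild_spec ⟨s, ⟨wordParent g.1, hx⟩⟩ with ⟨-, h2, h3⟩ | ⟨h1, -, -⟩
    · rcases edgeChild_spec ⟨s, ⟨wordParent g.1, hx⟩⟩ with ⟨h1, -, -⟩ | ⟨h1, -, -⟩
      · simp only at h1 h3
        rw [h1, ← hb] at h3
        rw [h1] at h2
        have h4 := norm_wordParent hg
        have h5 := norm_wordParent h2
        rw [h3] at h5
        omega
      · exact h1.trans hb.symm
    · exact h1.trans hb.symm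
  · rw [mk_true_eq] at hb
    have hx : g.1 ∈ EdgeSet F s := mem_edgeSet.2 ⟨g.2, by
      conv in (_ * _) => rw [hb]
      simpa using hp⟩
    refine ⟨⟨s, ⟨g.1, hx⟩⟩, Subtype.ext ?_⟩
    have h : g.1 ≠ 1 ∧ wordParent g.1 = (FreeGroup.of s)⁻¹ * g.1 :=
      ⟨hg, by conv_rhs => rw [hb]
              simp⟩
    rw [edgeChild, if_pos h]
    rfl

theorem edgeChild_ne_one (e : Σ s : S, EdgeSet F s) : (edgeChild e).1 ≠ 1 := by
  rcases edgeChild_spec e with h | h <;> exact h.2.1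

end Edges

/-! ### Volume-preserving coordinates on tuples indexed by a tree -/

theorem LinearMap.det_one_sub_of_isNilpotent {K M : Type*} [Field K] [AddCommGroup M] [Module K M]
    [Module.Finite K M] {f : Module.End K M} (hf : IsNilpotent f) :
    LinearMap.det (1 - f) = 1 := by
  have h := LinearMap.eval_charpoly f 1
  rw [IsNilpotent.charpoly_eq_X_pow_finrank hf] at h
  simpa using h.symm

theorem measurableSet_split {α σ ι : Type*} {κ : σ → Type*} [Finite σ]
    {n : ℕ} (e : α ⊕ (Σ s, κ s) ≃ ι) {B : Set (α → Cn n)}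
    (hB : MeasurableSet B) {C : ∀ s, Set (κ s → Cn n)} (hC : ∀ s, MeasurableSet (C s)) :
    MeasurableSet {Z : ι → Cn n | (fun i => Z (e (Sum.inl i))) ∈ B ∧
      ∀ s, (fun j => Z (e (Sum.inr ⟨s, j⟩))) ∈ C s} := by
  refine MeasurableSet.inter ((by fun_prop :
    Measurable fun Z : ι → Cn n => fun i => Z (e (Sum.inl i))) hB) ?_
  have : {Z : ι → Cn n | ∀ s, (fun j => Z (e (Sum.inr ⟨s, j⟩))) ∈ C s}
      = ⋂ s, (fun Z : ι → Cn n => fun j => Z (e (Sum.inr ⟨s, j⟩))) ⁻¹' C s := by ext; simp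
  change MeasurableSet {Z : ι → Cn n | ∀ s, (fun j => Z (e (Sum.inr ⟨s, j⟩))) ∈ C s}
  rw [this]
  exact MeasurableSet.iInter fun s => (by fun_prop :
    Measurable fun Z : ι → Cn n => fun j => Z (e (Sum.inr ⟨s, j⟩))) (hC s)

theorem tupVol_split {α σ ι : Type*} {κ : σ → Type*} [Fintype α] [Fintype σ] [Fintype ι]
    [∀ s, Fintype (κ s)] {n : ℕ} (e : α ⊕ (Σ s, κ s) ≃ ι) {B : Set (α → Cn n)}
    (hB : MeasurableSet B) {C : ∀ s, Set (κ s → Cn n)} (hC : ∀ s, MeasurableSet (C s)) :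
    tupVol ι n {Z | (fun i => Z (e (Sum.inl i))) ∈ B ∧
        ∀ s, (fun j => Z (e (Sum.inr ⟨s, j⟩))) ∈ C s}
      = tupVol α n B * ∏ s, tupVol (κ s) n (C s) := by
  let G : (α → Cn n) × (∀ s, κ s → Cn n) → (ι → Cn n) :=
    fun z i => Sum.elim z.1 (fun p => z.2 p.1 p.2) (e.symm i)
  have hG : Measurable G := by
    refine measurable_pi_iff.2 fun i => ?_
    rcases h : e.symm i with a | ⟨s, j⟩
    · simp only [G, h, Sum.elim_inl]; fun_prop
    · simp only [G, h, Sum.elim_inr]; fun_prop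
  set M := (tupVol α n).prod (Measure.pi fun s => tupVol (κ s) n)
  have hmap : tupVol ι n = M.map G := by
    refine Measure.pi_eq fun s hs => ?_
    rw [Measure.map_apply hG (MeasurableSet.univ_pi hs)]
    have hpre : G ⁻¹' (Set.univ.pi s) = (Set.univ.pi fun a => s (e (Sum.inl a))) ×ˢ
        (Set.univ.pi fun t => Set.univ.pi fun j => s (e (Sum.inr ⟨t, j⟩))) := by
      ext z
      simp only [Set.mem_preimage, Set.mem_univ_pi, Set.mem_prod]
      constructor
      · intro h
        exact ⟨fun a => by simpa [G] using h (e (Sum.inl a)),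
          fun t j => by simpa [G] using h (e (Sum.inr ⟨t, j⟩))⟩
      · rintro ⟨h1, h2⟩ i
        obtain ⟨x, rfl⟩ := e.surjective i
        rcases x with a | ⟨t, j⟩
        · simpa [G] using h1 a
        · simpa [G] using h2 t j
    rw [hpre, Measure.prod_prod, Measure.pi_pi, tupVol, Measure.pi_pi]
    simp only [tupVol, Measure.pi_pi]
    rw [← Equiv.prod_comp e, Fintype.prod_sum_type, Fintype.prod_sigma]
  rw [hmap, Measure.map_apply hG (measurableSet_split e hB hC)]
  have : G ⁻¹' {Z : ι → Cn n | (fun i => Z (e (Sum.inl i))) ∈ B ∧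
        ∀ s, (fun j => Z (e (Sum.inr ⟨s, j⟩))) ∈ C s} = B ×ˢ Set.univ.pi C := by
    ext z
    simp [G]
  rw [this, Measure.prod_prod, Measure.pi_pi]

section Tree

variable {S : Type*} [DecidableEq S] [Fintype S] {F : Finset (FreeGroup S)} {k n : ℕ}

/-- The edges of a suffix closed set correspond to its members other than the identity. -/
noncomputable def edgeEquiv (hF : SuffixClosed F) (k : ℕ) :
    Fin k ⊕ (Σ s : S, EdgeSet F s × Fin k) ≃ F × Fin k :=
  Equiv.ofBijective
    (Sum.elim (fun i => (⟨1, hF.1⟩, i)) fun p => (edgeChild ⟨p.1, p.2.1⟩, p.2.2)) <| by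
    constructor
    · rintro (i | ⟨s, x, i⟩) (j | ⟨t, y, j⟩) h
      · simpa using h
      · exact absurd (congrArg (fun q : F × Fin k => q.1.1) h).symm (edgeChild_ne_one _)
      · exact absurd (congrArg (fun q : F × Fin k => q.1.1) h) (edgeChild_ne_one _)
      · obtain ⟨h1, h2⟩ := Prod.ext_iff.1 h
        have h1 := edgeChild_injective h1
        simp only [Sum.elim_inr] at h2
        subst h2
        cases h1
        rfl
    · rintro ⟨g, i⟩
      by_cases hg : g.1 = 1
      · exact ⟨Sum.inl i, by simp [← hg]⟩
      · obtain ⟨⟨s, x⟩, h⟩ := hF.exists_edgeChild_eq hg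
        exact ⟨Sum.inr ⟨s, x, i⟩, by simp [h]⟩

/-- The defects `Y_s - U_s X_s` of a tuple along the edges with label `s`. -/
noncomputable def edgeDiff (U : S → unitaryGroup (Fin n) ℂ) (W : F × Fin k → Cn n) (s : S) :
    EdgeSet F s × Fin k → Cn n :=
  fun p => W (edgeTgt p.1, p.2) - uact n (U s) (W (edgeSrc p.1, p.2))

/-- The operator that moves each vector of a tuple from the parent to the child. -/
noncomputable def treeShift (hF : SuffixClosed F) (U : S → unitaryGroup (Fin n) ℂ) :
    Module.End ℝ (F × Fin k → Cn n) where
  toFun W p := if h : p.1.1 = 1 then 0 else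
    uact n (FreeGroup.lift U (p.1.1 * (wordParent p.1.1)⁻¹))
      (W (⟨wordParent p.1.1, hF.2 _ p.1.2 h⟩, p.2))
  map_add' W W' := by
    funext p
    by_cases h : p.1.1 = 1 <;> simp [h]
  map_smul' c W := by
    funext p
    by_cases h : p.1.1 = 1
    · simp [h]
    · simp only [h, dite_false, Pi.smul_apply, RingHom.id_apply]
      rw [← Complex.coe_smul, map_smul, Complex.coe_smul]

theorem treeShift_apply_one (hF : SuffixClosed F) (U : S → unitaryGroup (Fin n) ℂ)
    (W : F × Fin k → Cn n) {p : F × Fin k} (h : p.1.1 = 1) : treeShift hF U W p = 0 :=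
  dif_pos h

theorem treeShift_apply (hF : SuffixClosed F) (U : S → unitaryGroup (Fin n) ℂ)
    (W : F × Fin k → Cn n) {p : F × Fin k} (h : p.1.1 ≠ 1) :
    treeShift hF U W p = uact n (FreeGroup.lift U (p.1.1 * (wordParent p.1.1)⁻¹))
      (W (⟨wordParent p.1.1, hF.2 _ p.1.2 h⟩, p.2)) :=
  dif_neg h

/-- After `m` applications the value vanishes at all words shorter than `m`. -/
theorem isNilpotent_treeShift (hF : SuffixClosed F) (U : S → unitaryGroup (Fin n) ℂ) :
    IsNilpotent (treeShift (k := k) hF U) := by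
  have key : ∀ (m : ℕ) (W : F × Fin k → Cn n) (p : F × Fin k), p.1.1.norm < m →
      ((treeShift hF U) ^ m) W p = 0 := by
    intro m
    induction m with
    | zero => intro W p hp; omega
    | succ m ih =>
      intro W p hp
      rw [pow_succ', Module.End.mul_apply]
      by_cases h : p.1.1 = 1
      · exact treeShift_apply_one hF U _ h
      · have := norm_wordParent h
        rw [treeShift_apply hF U _ h, ih _ _ (by simp only; omega), map_zero]
  refine ⟨F.sup FreeGroup.norm + 1, ?_⟩
  refine LinearMap.ext fun W => funext fun p => key _ W p ?_
  exact Nat.lt_succ_of_le (Finset.le_sup (f := FreeGroup.norm) p.1.2)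

theorem measurePreserving_one_sub_treeShift (hF : SuffixClosed F)
    (U : S → unitaryGroup (Fin n) ℂ) :
    MeasurePreserving (fun W => W - treeShift hF U W) (tupVol (F × Fin k) n)
      (tupVol (F × Fin k) n) := by
  have hdet := LinearMap.det_one_sub_of_isNilpotent (isNilpotent_treeShift (k := k) hF U)
  have h := Measure.map_linearMap_addHaar_eq_smul_addHaar (tupVol (F × Fin k) n)
    (f := 1 - treeShift hF U) (by rw [hdet]; exact one_ne_zero)
  rw [hdet] at h
  refine ⟨?_, h.trans (by simp)⟩
  exact (LinearMap.continuous_of_finiteDimensional (1 - treeShift (k := k) hF U)).measurable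

/-- The isometry by which a defect along an edge differs from the defect at its child. -/
noncomputable def edgeIsometry (U : S → unitaryGroup (Fin n) ℂ) (s : S) (x : EdgeSet F s) :
    Cn n ≃ₗᵢ[ℂ] Cn n :=
  if x.1 ≠ 1 ∧ wordParent x.1 = (FreeGroup.of s)⁻¹ * x.1 then LinearIsometryEquiv.refl ℂ _
  else (uact n (U s)).trans (LinearIsometryEquiv.neg ℂ)

/-- If the child is the end of the edge, the defect is the value of `W - treeShift hF U W` there; if
it is the beginning, the defect is `-U s` applied to that value. -/
theorem edgeIsometry_apply (hF : SuffixClosed F) (U : S → unitaryGroup (Fin n) ℂ)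
    (W : F × Fin k → Cn n) (s : S) (p : EdgeSet F s × Fin k) :
    edgeIsometry U s p.1 ((W - treeShift hF U W) (edgeEquiv hF k (Sum.inr ⟨s, p⟩)))
      = edgeDiff U W s p := by
  obtain ⟨x, i⟩ := p
  have he : edgeEquiv hF k (Sum.inr ⟨s, (x, i)⟩) = (edgeChild ⟨s, x⟩, i) := rfl
  have hne := edgeChild_ne_one ⟨s, x⟩
  rw [he, Pi.sub_apply, treeShift_apply hF U W hne]
  by_cases h : x.1 ≠ 1 ∧ wordParent x.1 = (FreeGroup.of s)⁻¹ * x.1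
  · have hc : edgeChild ⟨s, x⟩ = edgeTgt x := if_pos h
    have hp : (⟨wordParent (edgeChild ⟨s, x⟩).1, hF.2 _ (edgeChild ⟨s, x⟩).2 hne⟩ : F)
        = edgeSrc x := Subtype.ext ((congrArg (fun g : F => wordParent g.1) hc).trans h.2)
    have hl : (edgeChild ⟨s, x⟩).1 * (wordParent (edgeChild ⟨s, x⟩).1)⁻¹ = FreeGroup.of s := by
      rw [hc]
      change x.1 * (wordParent x.1)⁻¹ = _
      rw [h.2]; group
    simp only [edgeIsometry, if_pos h]
    rw [hl, hp, hc, FreeGroup.lift_apply_of]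
    rfl
  · have hc : edgeChild ⟨s, x⟩ = edgeSrc x := if_neg h
    have h' := ((edge_cases s x.1).resolve_left h).2
    have hp : (⟨wordParent (edgeChild ⟨s, x⟩).1, hF.2 _ (edgeChild ⟨s, x⟩).2 hne⟩ : F)
        = edgeTgt x := Subtype.ext ((congrArg (fun g : F => wordParent g.1) hc).trans h')
    have hl : (edgeChild ⟨s, x⟩).1 * (wordParent (edgeChild ⟨s, x⟩).1)⁻¹
        = (FreeGroup.of s)⁻¹ := by
      rw [hc]
      change ((FreeGroup.of s)⁻¹ * x.1) * (wordParent ((FreeGroup.of s)⁻¹ * x.1))⁻¹ = _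
      rw [h']; group
    simp only [edgeIsometry, if_neg h]
    rw [hl, hp, hc, map_inv, FreeGroup.lift_apply_of, map_inv, LinearIsometryEquiv.trans_apply,
      map_sub, LinearIsometryEquiv.inv_def, LinearIsometryEquiv.apply_symm_apply]
    simp [edgeDiff]

/-- Subtracting the tree shift is unipotent, hence preserves volume, and the defects then differ
from the new coordinates only by isometries. -/
theorem tupVol_edgeDiff (hF : SuffixClosed F) (U : S → unitaryGroup (Fin n) ℂ)
    {B : Set (Fin k → Cn n)} (hB : MeasurableSet B)
    {C : ∀ s : S, Set (EdgeSet F s × Fin k → Cn n)} (hC : ∀ s, MeasurableSet (C s)) :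
    tupVol (F × Fin k) n {W | (fun i => W (⟨1, hF.1⟩, i)) ∈ B ∧ ∀ s, edgeDiff U W s ∈ C s}
      = tupVol (Fin k) n B * ∏ s, tupVol (EdgeSet F s × Fin k) n (C s) := by
  have hR : ∀ s : S, MeasurePreserving
      (fun (Z : EdgeSet F s × Fin k → Cn n) p => edgeIsometry U s p.1 (Z p))
      (tupVol (EdgeSet F s × Fin k) n) (tupVol (EdgeSet F s × Fin k) n) := fun s =>
    measurePreserving_pi (fun _ => ballVol n) (fun _ => ballVol n)
      fun p : EdgeSet F s × Fin k => measurePreserving_ballVol (edgeIsometry U s p.1)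
  have h := tupVol_split (edgeEquiv hF k) hB (fun s => (hR s).measurable (hC s))
  simp only [(hR _).measure_preimage (hC _).nullMeasurableSet] at h
  rw [← h, ← (measurePreserving_one_sub_treeShift hF U).measure_preimage (measurableSet_split
    (edgeEquiv hF k) hB (fun s => (hR s).measurable (hC s))).nullMeasurableSet]
  congr 1
  ext W
  refine and_congr ?_ (forall_congr' fun s => ?_)
  · have : (fun i => (W - treeShift hF U W) (edgeEquiv hF k (Sum.inl i)))
        = fun i => W (⟨1, hF.1⟩, i) := by
      funext i
      rw [Pi.sub_apply, treeShift_apply_one hF U W rfl, sub_zero]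
      rfl
    rw [this]
  · rw [← funext (edgeIsometry_apply hF U W s)]
    rfl

end Tree

/-! ### Orbits of a tuple and conjugation invariance -/

section Orbit

variable {S : Type*} {F : Finset (FreeGroup S)} {k n : ℕ}

/-- The translates `π(g) V` of the tuple `V`, for `g ∈ F`, in the representation given by `U`. -/
noncomputable def orbitTuple (F : Finset (FreeGroup S)) (U : S → unitaryGroup (Fin n) ℂ)
    (V : Fin k → Cn n) : F × Fin k → Cn n :=
  fun p => uact n (FreeGroup.lift U p.1.1) (V p.2)

theorem continuous_lift (g : FreeGroup S) :
    Continuous fun U : S → unitaryGroup (Fin n) ℂ => FreeGroup.lift U g := by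
  induction g using FreeGroup.induction_on with
  | C1 => simpa using continuous_const
  | of s => simpa using continuous_apply s
  | inv_of s h =>
    simp only [map_inv, FreeGroup.lift_apply_of]
    exact (continuous_apply s).inv
  | mul g h hg hh =>
    simp only [map_mul]
    exact hg.mul hh

theorem continuous_orbitTuple : Continuous fun p : (Fin k → Cn n) × (S → unitaryGroup (Fin n) ℂ) =>
    orbitTuple F p.2 p.1 :=
  continuous_pi fun q => ((continuous_lift q.1.1).comp continuous_snd).uact
    ((continuous_apply q.2).comp continuous_fst)

theorem continuous_orbitTuple_right (V : Fin k → Cn n) :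
    Continuous fun U : S → unitaryGroup (Fin n) ℂ => orbitTuple F U V :=
  continuous_pi fun q => (continuous_lift q.1.1).uact continuous_const

theorem isOpen_gram_orbitTuple (V : Fin k → Cn n) (q : Matrix (F × Fin k) (F × Fin k) ℂ) (ε : ℝ) :
    IsOpen {U : S → unitaryGroup (Fin n) ℂ | gram ℂ (orbitTuple F U V) ∈ entryBall q ε} :=
  (isOpen_entryBall q ε).preimage (continuous_gram.comp (continuous_orbitTuple_right V))

theorem norm_orbitTuple (U : S → unitaryGroup (Fin n) ℂ) (V : Fin k → Cn n) (p : F × Fin k) :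
    ‖orbitTuple F U V p‖ = ‖V p.2‖ := LinearIsometryEquiv.norm_map _ _

/-- The vectors have norms at most three and two, so each inner product changes by at most `3η +
2η`. -/
theorem gram_mem_entryBall_of_near {ι : Type*} [Fintype ι] {W W' : ι → Cn n} {q : Matrix ι ι ℂ}
    {η ε ε' : ℝ} (hW' : ∀ p, ‖W' p‖ ≤ 2) (h : ∀ p, ‖W p - W' p‖ ≤ η) (hη1 : η ≤ 1)
    (hε : ε + 5 * η ≤ ε') :
    (gram ℂ W ∈ entryBall q ε → gram ℂ W' ∈ entryBall q ε') ∧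
      (gram ℂ W' ∈ entryBall q ε → gram ℂ W ∈ entryBall q ε') := by
  have key : ∀ i j, ‖gram ℂ W i j - gram ℂ W' i j‖ ≤ 5 * η := by
    intro i j
    have e : gram ℂ W i j - gram ℂ W' i j
        = inner ℂ (W i - W' i) (W j) + inner ℂ (W' i) (W j - W' j) := by
      simp only [gram_apply, inner_sub_left, inner_sub_right]; ring
    have hη : 0 ≤ η := (norm_nonneg _).trans (h i)
    have hWj : ‖W j‖ ≤ 3 := by
      have := norm_add_le (W j - W' j) (W' j)
      rw [sub_add_cancel] at this
      linarith [h j, hW' j]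
    rw [e]
    have h1 : ‖inner ℂ (W i - W' i) (W j)‖ ≤ η * 3 := (norm_inner_le_norm _ _).trans
      (mul_le_mul (h i) hWj (norm_nonneg _) hη)
    have h2 : ‖inner ℂ (W' i) (W j - W' j)‖ ≤ 2 * η := (norm_inner_le_norm _ _).trans
      (mul_le_mul (hW' i) (h j) (norm_nonneg _) two_pos.le)
    linarith [norm_add_le (inner ℂ (W i - W' i) (W j)) (inner ℂ (W' i) (W j - W' j))]
  constructor <;> intro hM i j
  · have := norm_sub_le_norm_sub_add_norm_sub (gram ℂ W' i j) (gram ℂ W i j) (q i j)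
    have h1 := key i j
    rw [norm_sub_rev] at h1
    linarith [hM i j]
  · have := norm_sub_le_norm_sub_add_norm_sub (gram ℂ W i j) (gram ℂ W' i j) (q i j)
    linarith [hM i j, key i j]

theorem lift_conj (G : unitaryGroup (Fin n) ℂ) (U : S → unitaryGroup (Fin n) ℂ)
    (g : FreeGroup S) :
    FreeGroup.lift (fun s => G * U s * G⁻¹) g = G * FreeGroup.lift U g * G⁻¹ := by
  have : (MulAut.conj G).toMonoidHom.comp (FreeGroup.lift U)
      = FreeGroup.lift (fun s => G * U s * G⁻¹) := by
    ext1 s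
    simp
  rw [← this]
  simp

theorem measurePreserving_conj (ν : Measure (unitaryGroup (Fin n) ℂ)) [ν.IsHaarMeasure]
    [IsProbabilityMeasure ν] (G : unitaryGroup (Fin n) ℂ) :
    MeasurePreserving (fun U => G * U * G⁻¹) ν ν := by
  have hc : Continuous fun U : unitaryGroup (Fin n) ℂ => G * U * G⁻¹ := by fun_prop
  have h1 : (ν.map (MulAut.conj G)).IsHaarMeasure :=
    MulEquiv.isHaarMeasure_map ν (MulAut.conj G) hc (by
      change Continuous fun U : unitaryGroup (Fin n) ℂ => G⁻¹ * U * G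
      fun_prop)
  have h2 : IsProbabilityMeasure (ν.map (MulAut.conj G)) :=
    Measure.isProbabilityMeasure_map hc.measurable.aemeasurable
  exact ⟨hc.measurable, Measure.isHaarMeasure_eq_of_isProbabilityMeasure (ν.map (MulAut.conj G)) ν⟩

variable [Fintype S]

/-- Conjugating all `U s` by one unitary preserves the product of Haar measures, so the law of the
Gram matrix of the orbit depends on `V` only up to a unitary. This lets the double count average
over `V`. -/
theorem measure_gram_orbitTuple_le {V V' : Fin k → Cn n} (ν : S → Measure (unitaryGroup (Fin n) ℂ))
    [∀ s, (ν s).IsHaarMeasure] [∀ s, IsProbabilityMeasure (ν s)] {H : Cn n ≃ₗᵢ[ℂ] Cn n}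
    {η ε ε' : ℝ} {q : Matrix (F × Fin k) (F × Fin k) ℂ}
    (hH : ∀ j, ‖H (V j) - V' j‖ ≤ η) (hV' : ∀ j, ‖V' j‖ ≤ 2) (hη1 : η ≤ 1)
    (hε : ε + 5 * η ≤ ε') :
    Measure.pi ν {U | gram ℂ (orbitTuple F U V) ∈ entryBall q ε}
        ≤ Measure.pi ν {U | gram ℂ (orbitTuple F U V') ∈ entryBall q ε'} ∧
      Measure.pi ν {U | gram ℂ (orbitTuple F U V') ∈ entryBall q ε}
        ≤ Measure.pi ν {U | gram ℂ (orbitTuple F U V) ∈ entryBall q ε'} := by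
  obtain ⟨G, rfl⟩ := (uact n).surjective H
  have hP : MeasurePreserving (fun (U : S → unitaryGroup (Fin n) ℂ) s => G * U s * G⁻¹)
      (Measure.pi ν) (Measure.pi ν) :=
    measurePreserving_pi ν ν fun s => measurePreserving_conj (ν s) G
  have hgram : ∀ U : S → unitaryGroup (Fin n) ℂ,
      gram ℂ (orbitTuple F (fun s => G * U s * G⁻¹) fun j => uact n G (V j))
        = gram ℂ (orbitTuple F U V) := by
    intro U
    rw [← gram_isometry (uact n G) (orbitTuple F U V)]
    congr 1
    funext p
    simp [orbitTuple, lift_conj]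
  have heq : ∀ ε, Measure.pi ν {U | gram ℂ (orbitTuple F U V) ∈ entryBall q ε}
      = Measure.pi ν {U | gram ℂ (orbitTuple F U fun j => uact n G (V j)) ∈ entryBall q ε} := by
    intro ε
    refine Eq.trans ?_ (hP.measure_preimage
      (isOpen_gram_orbitTuple (fun j => uact n G (V j)) q ε).measurableSet.nullMeasurableSet)
    refine congrArg _ (Set.ext fun U => ?_)
    change _ ↔ gram ℂ (orbitTuple F (fun s => G * U s * G⁻¹) fun j => uact n G (V j)) ∈
      entryBall q ε
    rw [hgram]
    exact Iff.rfl
  have hnear : ∀ (U : S → unitaryGroup (Fin n) ℂ) (p : F × Fin k),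
      ‖orbitTuple F U (fun j => uact n G (V j)) p - orbitTuple F U V' p‖ ≤ η := by
    intro U p
    rw [orbitTuple, orbitTuple, ← map_sub, LinearIsometryEquiv.norm_map]
    exact hH p.2
  have hnorm : ∀ (U : S → unitaryGroup (Fin n) ℂ) (p : F × Fin k),
      ‖orbitTuple F U V' p‖ ≤ 2 := fun U p => (norm_orbitTuple U V' p).trans_le (hV' _)
  rw [heq, heq]
  exact ⟨measure_mono fun U hU =>
      (gram_mem_entryBall_of_near (hnorm U) (hnear U) hη1 hε).1 hU,
    measure_mono fun U hU => (gram_mem_entryBall_of_near (hnorm U) (hnear U) hη1 hε).2 hU⟩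

end Orbit

/-! ### Double counting of nearly equivariant tuples -/

section Identity

variable {S : Type*} [DecidableEq S] [Fintype S] {F : Finset (FreeGroup S)} {k n : ℕ}

/-- The subtuple at the ends of the edges with label `s`. -/
def tgtTuple (W : F × Fin k → Cn n) (s : S) : EdgeSet F s × Fin k → Cn n :=
  fun p => W (edgeTgt p.1, p.2)

/-- The subtuple at the beginnings of the edges with label `s`. -/
def srcTuple (W : F × Fin k → Cn n) (s : S) : EdgeSet F s × Fin k → Cn n :=
  fun p => W (edgeSrc p.1, p.2)

/-- The tuple `W` is nearly equivariant along the edges, up to defects in the images of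
polyballs under the matrices `D s`. -/
def EdgeNear (D : ∀ s : S, Matrix (EdgeSet F s × Fin k) (EdgeSet F s × Fin k) ℂ) (ρ : ℝ)
    (U : S → unitaryGroup (Fin n) ℂ) (W : F × Fin k → Cn n) : Prop :=
  ∀ s, edgeDiff U W s ∈ comb (D s)⁻¹ ⁻¹' polyball _ n ρ

variable (D : ∀ s : S, Matrix (EdgeSet F s × Fin k) (EdgeSet F s × Fin k) ℂ) {ρ : ℝ}

theorem isOpen_edgeNear (s : S) : IsOpen (comb (n := n) (D s)⁻¹ ⁻¹' polyball _ n ρ) :=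
  (isOpen_polyball ρ).preimage (LinearMap.continuous_of_finiteDimensional _)

/-- For fixed `W`, edges with different labels constrain different, independent unitaries. -/
theorem pi_edgeNear (ν : S → Measure (unitaryGroup (Fin n) ℂ)) [∀ s, SigmaFinite (ν s)]
    (W : F × Fin k → Cn n) :
    Measure.pi ν {U | EdgeNear D ρ U W}
      = ∏ s, hit (ν s) (comb (D s)⁻¹ (srcTuple W s)) (comb (D s)⁻¹ (tgtTuple W s)) ρ := by
  simp only [hit]
  rw [← Measure.pi_pi]
  congr 1
  ext U
  simp only [Set.mem_univ_pi, Set.mem_ofPred_eq, EdgeNear]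
  refine forall_congr' fun s => forall_congr' fun j => ?_
  have : edgeDiff U W s = tgtTuple W s - fun p => uact n (U s) (srcTuple W s p) := rfl
  rw [this, map_sub, comb_isometry]
  rfl

theorem tupVol_preimage_comb {ι : Type*} [Fintype ι] [DecidableEq ι] {D : Matrix ι ι ℂ}
    (hD : D.det ≠ 0) (hρ : 0 < ρ) :
    tupVol ι n (comb D⁻¹ ⁻¹' polyball _ n ρ)
      = ENNReal.ofReal (‖D.det‖ ^ 2 * ρ ^ (2 * Fintype.card ι)) ^ n := by
  have : comb D⁻¹ ⁻¹' polyball _ n ρ = comb D '' polyball _ n ρ := by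
    ext W
    constructor
    · exact fun hW => ⟨_, hW, comb_inv_comb hD W⟩
    · rintro ⟨Z, hZ, rfl⟩
      rwa [Set.mem_preimage, comb_comb_inv hD]
  rw [this, tupVol_image_comb, tupVol_polyball hρ, ENNReal.ofReal_mul (by positivity), mul_pow,
    ENNReal.ofReal_pow hρ.le, ← pow_mul]
  ring

/-- Double counting of the tuples that are nearly equivariant along the edges. -/
theorem lintegral_edgeNear (hF : SuffixClosed F) (ν : S → Measure (unitaryGroup (Fin n) ℂ))
    [∀ s, IsProbabilityMeasure (ν s)] (hD : ∀ s, (D s).det ≠ 0) (hρ : 0 < ρ)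
    {B : Set ((Fin k → Cn n) × (S → unitaryGroup (Fin n) ℂ))} (hB : IsOpen B) :
    ∫⁻ W, Measure.pi ν {U | ((fun i => W (⟨1, hF.1⟩, i)), U) ∈ B ∧ EdgeNear D ρ U W}
        ∂(tupVol (F × Fin k) n)
      = (∫⁻ V, Measure.pi ν {U | (V, U) ∈ B} ∂(tupVol (Fin k) n)) *
        ∏ s, ENNReal.ofReal (‖(D s).det‖ ^ 2 *
          ρ ^ (2 * Fintype.card (EdgeSet F s × Fin k))) ^ n := by
  set T : Set ((F × Fin k → Cn n) × (S → unitaryGroup (Fin n) ℂ)) :=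
    {p | ((fun i => p.1 (⟨1, hF.1⟩, i)), p.2) ∈ B ∧ EdgeNear D ρ p.2 p.1}
  have hT : IsOpen T := by
    refine IsOpen.inter (hB.preimage (by fun_prop)) ?_
    have : {p : (F × Fin k → Cn n) × (S → unitaryGroup (Fin n) ℂ) | EdgeNear D ρ p.2 p.1}
        = ⋂ s, (fun p => edgeDiff p.2 p.1 s) ⁻¹' (comb (D s)⁻¹ ⁻¹' polyball _ n ρ) := by
      ext p; simp [EdgeNear]
    change IsOpen {p : (F × Fin k → Cn n) × (S → unitaryGroup (Fin n) ℂ) | EdgeNear D ρ p.2 p.1}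
    rw [this]
    refine isOpen_iInter_of_finite fun s => (isOpen_edgeNear D s).preimage ?_
    refine continuous_pi fun p => ?_
    refine ((continuous_apply _).comp continuous_fst).sub ?_
    exact ((continuous_apply s).comp continuous_snd).uact
      ((continuous_apply (edgeSrc p.1, p.2)).comp continuous_fst)
  have h1 := Measure.prod_apply (μ := tupVol (F × Fin k) n) (ν := Measure.pi ν) hT.measurableSet
  have h2 := Measure.prod_apply_symm (μ := tupVol (F × Fin k) n) (ν := Measure.pi ν)
    hT.measurableSet
  have h3 := Measure.prod_apply (μ := tupVol (Fin k) n) (ν := Measure.pi ν) hB.measurableSet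
  have h4 := Measure.prod_apply_symm (μ := tupVol (Fin k) n) (ν := Measure.pi ν) hB.measurableSet
  -- The volume in `W` is taken first, for fixed `U`, where `tupVol_edgeDiff` applies; a second use
  -- of Fubini restores the integral over `V`.
  refine h1.symm.trans (h2.trans ?_)
  refine Eq.trans ?_ (congrArg (· * _) (h4.symm.trans h3))
  rw [← lintegral_mul_const' _ _ (ENNReal.prod_ne_top fun _ _ => by finiteness)]
  refine lintegral_congr fun U => ?_
  have hBU : MeasurableSet ((fun V => (V, U)) ⁻¹' B : Set (Fin k → Cn n)) :=
    (hB.preimage (by fun_prop)).measurableSet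
  refine (tupVol_edgeDiff hF U hBU fun s => (isOpen_edgeNear D (ρ := ρ) s).measurableSet).trans ?_
  congr 1
  exact Finset.prod_congr rfl fun s _ => tupVol_preimage_comb (hD s) hρ

/-- Nearly equivariant tuples are near the orbit of their member at the identity. -/
theorem exists_norm_sub_orbitTuple_le (hF : SuffixClosed F) (hD : ∀ s, (D s).det ≠ 0) :
    ∃ C > 0, ∀ (n : ℕ) (ρ : ℝ) (U : S → unitaryGroup (Fin n) ℂ) (W : F × Fin k → Cn n), 0 < ρ →
      EdgeNear D ρ U W →
      ∀ p, ‖W p - orbitTuple F U (fun i => W (⟨1, hF.1⟩, i)) p‖ ≤ C * ρ := by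
  obtain ⟨M, hM⟩ := Finite.exists_le fun p : Σ s : S, EdgeSet F s × Fin k =>
    (((D p.1)ᴴ * D p.1) p.2 p.2).re
  set b := max M 1
  have hb : 0 < b := lt_max_of_lt_right one_pos
  have hbM : M ≤ b ^ 2 := by
    have h1 : M ≤ b := le_max_left _ _
    have h2 : 1 ≤ b := le_max_right _ _
    nlinarith
  set C := b * Fintype.card (F × Fin k)
  have hC : 0 ≤ C := by positivity
  -- Unitaries do not amplify errors, so defects add up along the path to the identity, whose length
  -- is at most the supremum. The `+ 1` only makes the constant positive.
  refine ⟨F.sup FreeGroup.norm * C + 1, by positivity, fun n ρ U W hρ h => ?_⟩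
  have hedge : ∀ (s : S) (p : EdgeSet F s × Fin k),
      ‖W (edgeTgt p.1, p.2) - uact n (U s) (W (edgeSrc p.1, p.2))‖ ≤ C * ρ := by
    intro s p
    have h1 := norm_comb_lt hb (fun j => (hM ⟨s, j⟩).trans hbM) (h s) p
    rw [comb_inv_comb (hD s)] at h1
    refine h1.trans ?_
    have h2 : Fintype.card (EdgeSet F s × Fin k) ≤ Fintype.card (F × Fin k) := by
      simp only [Fintype.card_prod, Fintype.card_coe]
      exact Nat.mul_le_mul_right _ (Finset.card_le_card Finset.inter_subset_left)
    have h3 : (Fintype.card (EdgeSet F s × Fin k) : ℝ) ≤ Fintype.card (F × Fin k) := by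
      exact_mod_cast h2
    exact mul_le_mul_of_nonneg_right (mul_le_mul_of_nonneg_left h3 hb.le) hρ.le
  have key : ∀ (m : ℕ) (g : F) (i : Fin k), g.1.norm = m →
      ‖W (g, i) - uact n (FreeGroup.lift U g.1) (W (⟨1, hF.1⟩, i))‖ ≤ m * (C * ρ) := by
    intro m
    induction m with
    | zero =>
      intro g i hg
      have hg : g = ⟨1, hF.1⟩ := Subtype.ext (FreeGroup.norm_eq_zero.1 hg)
      subst hg
      simp
    | succ m ih =>
      intro g i hg
      have hg1 : g.1 ≠ 1 := by intro h; rw [h] at hg; simp at hg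
      obtain ⟨⟨s, x⟩, hx⟩ := hF.exists_edgeChild_eq hg1
      have hm : (wordParent g.1).norm = m := by have := norm_wordParent hg1; omega
      have hspec := edgeChild_spec ⟨s, x⟩
      have he := hedge s (x, i)
      rw [hx] at hspec
      push_cast
      rcases hspec with ⟨h1, -, h2⟩ | ⟨h1, -, h2⟩
      · have hgt : edgeTgt x = g := Subtype.ext h1.symm
        have ih' := ih (edgeSrc x) i (by rw [← hm, h2]; rfl)
        have hlift : FreeGroup.lift U g.1 = U s * FreeGroup.lift U (edgeSrc x).1 := by
          rw [← FreeGroup.lift_apply_of (f := U), ← map_mul, h1]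
          simp [edgeSrc]
        simp only [hgt] at he
        have e : W (g, i) - uact n (FreeGroup.lift U g.1) (W (⟨1, hF.1⟩, i))
            = (W (g, i) - uact n (U s) (W (edgeSrc x, i))) + uact n (U s) (W (edgeSrc x, i)
              - uact n (FreeGroup.lift U (edgeSrc x).1) (W (⟨1, hF.1⟩, i))) := by
          rw [hlift, map_mul, map_sub, LinearIsometryEquiv.coe_mul, Function.comp_apply]; abel
        rw [e]
        refine (norm_add_le _ _).trans ?_
        rw [LinearIsometryEquiv.norm_map]
        linarith
      · have hgs : edgeSrc x = g := Subtype.ext h1.symm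
        have ih' := ih (edgeTgt x) i (by rw [← hm, h2]; rfl)
        have hlift : FreeGroup.lift U (edgeTgt x).1 = U s * FreeGroup.lift U g.1 := by
          rw [← FreeGroup.lift_apply_of (f := U), ← map_mul, h1]
          simp [edgeTgt]
        simp only [hgs] at he
        have e : uact n (U s) (W (g, i) - uact n (FreeGroup.lift U g.1) (W (⟨1, hF.1⟩, i)))
            = (W (edgeTgt x, i) - uact n (FreeGroup.lift U (edgeTgt x).1) (W (⟨1, hF.1⟩, i)))
              - (W (edgeTgt x, i) - uact n (U s) (W (g, i))) := by
          rw [hlift, map_mul, map_sub, LinearIsometryEquiv.coe_mul, Function.comp_apply]; abel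
        rw [← LinearIsometryEquiv.norm_map (uact n (U s)), e]
        refine (norm_sub_le _ _).trans ?_
        linarith
  rintro ⟨g, i⟩
  refine (key _ g i rfl).trans ?_
  have h1 : (g.1.norm : ℝ) ≤ F.sup FreeGroup.norm := by
    exact_mod_cast Finset.le_sup (f := FreeGroup.norm) g.2
  calc (g.1.norm : ℝ) * (C * ρ) ≤ F.sup FreeGroup.norm * (C * ρ) := by gcongr
    _ ≤ _ := by linarith

end Identity

/-! ### Probability that the Gram matrix is near `q`: upper bound -/

theorem eventually_const_mul_pow_le {a b : ℝ} (K : ℝ) (ha : 0 ≤ a) (hab : a < b) :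
    ∀ᶠ n : ℕ in atTop, K * a ^ n ≤ b ^ n := by
  have hb : 0 < b := ha.trans_lt hab
  have h : Tendsto (fun n : ℕ => K * (a / b) ^ n) atTop (𝓝 (K * 0)) :=
    (tendsto_pow_atTop_nhds_zero_of_lt_one (by positivity) ((div_lt_one hb).2 hab)).const_mul K
  rw [mul_zero] at h
  filter_upwards [h.eventually_le_const one_pos] with n hn
  rw [div_pow, mul_div_assoc', div_le_one (by positivity)] at hn
  exact hn

theorem prod_ofReal_pow {σ : Type*} [Fintype σ] {f : σ → ℝ} (hf : ∀ s, 0 ≤ f s) (n : ℕ) :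
    ∏ s, ENNReal.ofReal (f s) ^ n = ENNReal.ofReal (∏ s, f s) ^ n := by
  rw [Finset.prod_pow, ENNReal.ofReal_prod_of_nonneg fun s _ => hf s]

section Local

variable {S : Type*} [DecidableEq S] [Fintype S] {F : Finset (FreeGroup S)} {k n : ℕ}

/-- The position in `F` of the end of an edge, in block matrices. -/
def tgtIdx (s : S) (p : EdgeSet F s × Fin k) : F × Fin k := (edgeTgt p.1, p.2)

/-- The position in `F` of the beginning of an edge, in block matrices. -/
def srcIdx (s : S) (p : EdgeSet F s × Fin k) : F × Fin k := (edgeSrc p.1, p.2)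

/-- The block matrix indexed by `F ∩ sF` inside a block matrix indexed by `F`. -/
abbrev edgeBlock (q : Matrix (F × Fin k) (F × Fin k) ℂ) (s : S) :
    Matrix (EdgeSet F s × Fin k) (EdgeSet F s × Fin k) ℂ :=
  q.submatrix (tgtIdx s) (tgtIdx s)

theorem exists_edge_factors {q : Matrix (F × Fin k) (F × Fin k) ℂ}
    (hs : ∀ s : S, (edgeBlock q s).PosDef) :
    ∃ D : ∀ s : S, Matrix (EdgeSet F s × Fin k) (EdgeSet F s × Fin k) ℂ,
      (∀ s, (D s).det ≠ 0) ∧ (∀ s, ((D s)⁻¹)ᴴ * edgeBlock q s * (D s)⁻¹ = 1) ∧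
      ∀ s, ‖(D s).det‖ ^ 2 = (edgeBlock q s).det.re := by
  choose D hD hD0 hdet using fun s => exists_conjTranspose_mul_self (hs s)
  refine ⟨D, hD0, fun s => ?_, hdet⟩
  have hu := (hD0 s).isUnit
  rw [← hD, ← Matrix.mul_assoc, ← conjTranspose_mul, mul_nonsing_inv _ hu, conjTranspose_one,
    Matrix.one_mul, mul_nonsing_inv _ hu]

theorem eventually_normalised_mem {ι κ : Type*} [Fintype ι] [DecidableEq ι] [Fintype κ]
    {q : Matrix κ κ ℂ} {D : Matrix ι ι ℂ} {f : ι → κ}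
    (h : (D⁻¹)ᴴ * q.submatrix f f * D⁻¹ = 1) {N : Set (Matrix ι ι ℂ)} (hN : N ∈ 𝓝 1) :
    ∀ᶠ M in 𝓝 q, (D⁻¹)ᴴ * M.submatrix f f * D⁻¹ ∈ N := by
  have hc : Continuous fun M : Matrix κ κ ℂ => (D⁻¹)ᴴ * M.submatrix f f * D⁻¹ := by fun_prop
  have ht := hc.tendsto q
  rw [h] at ht
  exact ht hN

/-- The probability that a random representation yields a Gram matrix near `q` is at most
`exp (n h_F(q) + o(n))`. -/
theorem exists_nhds_measure_gram_orbitTuple_le (hF : SuffixClosed F)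
    {q : Matrix (F × Fin k) (F × Fin k) ℂ} (hq : q.PosSemidef)
    (hs : ∀ s : S, (edgeBlock q s).PosDef) {c : ℝ}
    (hc : q.det.re < c * ∏ s : S, (edgeBlock q s).det.re) :
    ∃ N ∈ 𝓝 q, IsOpen N ∧ ∀ᶠ n in atTop, ∀ (ν : S → Measure (unitaryGroup (Fin n) ℂ))
      [∀ s, (ν s).IsHaarMeasure] [∀ s, IsProbabilityMeasure (ν s)] (V : Fin k → Cn n),
      gram ℂ V = 1 →
      Measure.pi ν {U | gram ℂ (orbitTuple F U V) ∈ N} ≤ ENNReal.ofReal (c ^ n) := by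
  obtain ⟨D, hD0, hDq, hdet⟩ := exists_edge_factors hs
  obtain ⟨P, hPdef⟩ : ∃ P : ℝ, P = ∏ s : S, (edgeBlock q s).det.re := ⟨_, rfl⟩
  rw [← hPdef] at hc
  have hPs : ∀ s : S, 0 < (edgeBlock q s).det.re := fun s => (Complex.lt_def.1 (hs s).det_pos).1
  have hP : 0 < P := hPdef ▸ Finset.prod_pos fun s _ => hPs s
  have hq0 : 0 ≤ q.det.re := (Complex.le_def.1 hq.det_nonneg).1
  -- The gap between `c₁` and `c` will absorb the bounded powers of two, and that between `c'` and
  -- `c₁ * P` the factors `1 + κ`.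
  obtain ⟨c₁, hc₁, hc₁c⟩ := exists_between ((div_lt_iff₀ hP).2 hc)
  have hc₁0 : 0 ≤ c₁ := (div_nonneg hq0 hP.le).trans hc₁.le
  obtain ⟨c', hc', hc'c₁⟩ := exists_between ((div_lt_iff₀ hP).1 hc₁)
  have hc'0 : 0 ≤ c' := hq0.trans hc'.le
  obtain ⟨κ, hκ, hκ0⟩ : ∃ κ : ℝ, c' * (1 + κ) ^ Fintype.card S < c₁ * P ∧ 0 < κ := by
    have hcont : Continuous fun κ : ℝ => c' * (1 + κ) ^ Fintype.card S := by fun_prop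
    have := (hcont.tendsto 0).eventually_lt_const (show _ < c₁ * P by simpa using hc'c₁)
    exact ((this.filter_mono nhdsWithin_le_nhds).and
      (self_mem_nhdsWithin : Set.Ioi (0 : ℝ) ∈ 𝓝[>] 0)).exists
  obtain ⟨N₂, hN₂, -, hvol⟩ := exists_nhds_tupVol_gram_le hq hc'
  choose N hN hhit using fun s : S => exists_nhds_one_hit_le (EdgeSet F s × Fin k) hκ0
  -- `ε` can be fixed before `ρ` because the neighbourhoods `N s` do not depend on `ρ`.
  obtain ⟨ε, hε, hεN⟩ := exists_entryBall_subset (Filter.inter_mem hN₂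
    (eventually_all.2 fun s => eventually_normalised_mem (hDq s) (hN s)))
  obtain ⟨C, hC, hCorb⟩ := exists_norm_sub_orbitTuple_le D hF hD0
  -- Then `5 * η ≤ ε / 6`, so each of the two comparisons of Gram matrices, from `ε / 3` to `2 * ε /
  -- 3` and from there to `ε`, has room.
  set η := min 1 (ε / 30)
  have hη : 0 < η := by positivity
  have hη1 : η ≤ 1 := min_le_left _ _
  have hηε : η ≤ ε / 30 := min_le_right _ _
  set ρ := η / C
  have hρ : 0 < ρ := by positivity
  have hCρ : C * ρ = η := mul_div_cancel₀ _ hC.ne'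
  obtain ⟨N₄, hN₄, hst⟩ := exists_nhds_one_linearIsometryEquiv (Fin k) hη
  obtain ⟨δ, hδ, hδN⟩ := exists_entryBall_subset hN₄
  refine ⟨entryBall q (ε / 3), entryBall_mem_nhds q (by positivity), isOpen_entryBall _ _, ?_⟩
  filter_upwards [eventually_half_le_tupVol_nearOrtho (Fin k) Empty hδ,
    eventually_all.2 fun s => hhit s ρ hρ,
    eventually_const_mul_pow_le (2 ^ (Fintype.card S + 1)) hc₁0 hc₁c] with n hn1 hn2 hn3
  intro ν _ _ V hV
  have hvol1 := hn1 Empty.elim (fun i => i.elim)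
  obtain ⟨p, hp⟩ : ∃ p, p = Measure.pi ν {U | gram ℂ (orbitTuple F U V) ∈ entryBall q (ε / 3)} := ⟨_, rfl⟩
  rw [← hp]
  set B : Set ((Fin k → Cn n) × (S → unitaryGroup (Fin n) ℂ)) :=
    {x | x.1 ∈ nearOrtho δ (Empty.elim : Empty → Cn n) ∧
      gram ℂ (orbitTuple F x.2 x.1) ∈ entryBall q (2 * ε / 3)}
  have hB : IsOpen B := ((isOpen_nearOrtho _ _).preimage continuous_fst).inter
    ((isOpen_entryBall _ _).preimage (continuous_gram.comp continuous_orbitTuple))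
  have hid := lintegral_edgeNear D hF ν hD0 hρ hB
  set R : S → ℝ := fun s => ρ ^ (2 * Fintype.card (EdgeSet F s × Fin k))
  have hR : ∀ s, 0 < R s := fun s => by positivity
  -- Each nearly orthonormal `V'` does at least as well as `V`, at the cost of enlarging the radius.
  have hlow : p * ENNReal.ofReal (1 / 2)
      ≤ ∫⁻ V', Measure.pi ν {U | (V', U) ∈ B} ∂(tupVol (Fin k) n) := by
    calc p * ENNReal.ofReal (1 / 2)
        ≤ p * tupVol (Fin k) n (nearOrtho δ (Empty.elim : Empty → Cn n)) := by gcongr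
      _ = ∫⁻ _ in nearOrtho δ (Empty.elim : Empty → Cn n), p ∂(tupVol (Fin k) n) := by
          rw [setLIntegral_const]
      _ ≤ ∫⁻ V' in nearOrtho δ (Empty.elim : Empty → Cn n),
            Measure.pi ν {U | (V', U) ∈ B} ∂(tupVol (Fin k) n) := by
          refine setLIntegral_mono_ae' (isOpen_nearOrtho _ _).measurableSet
            (ae_of_all _ fun V' hV' => ?_)
          rw [hp]
          obtain ⟨H, hH⟩ := hst n V V' (hV ▸ mem_of_mem_nhds hN₄) (hδN hV'.2.1)
          refine (measure_gram_orbitTuple_le (q := q) (ε := ε / 3) (ε' := 2 * ε / 3) ν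
            (fun j => (hH j).le) (fun j => by linarith [hV'.1 j]) hη1 (by linarith)).1.trans ?_
          exact measure_mono fun U hU => ⟨hV', hU⟩
      _ ≤ _ := setLIntegral_le_lintegral _ _
  -- Only `W` with Gram matrix within `ε` of `q` contribute, since `W` is within `η` of the orbit of
  -- its block at the identity.
  have hup : ∫⁻ W, Measure.pi ν {U | ((fun i => W (⟨1, hF.1⟩, i)), U) ∈ B ∧ EdgeNear D ρ U W}
      ∂(tupVol (F × Fin k) n)
      ≤ ENNReal.ofReal c' ^ n * ∏ s, (2 * ENNReal.ofReal ((1 + κ) * R s) ^ n) := by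
    set K := ∏ s, (2 * ENNReal.ofReal ((1 + κ) * R s) ^ n)
    have hN₃ : IsOpen {W : F × Fin k → Cn n | gram ℂ W ∈ entryBall q ε} :=
      (isOpen_entryBall q ε).preimage continuous_gram
    calc _ ≤ ∫⁻ W, Set.indicator {W : F × Fin k → Cn n | gram ℂ W ∈ entryBall q ε}
          (fun _ => K) W ∂(tupVol (F × Fin k) n) := by
          refine lintegral_mono fun W => ?_
          by_cases hW : gram ℂ W ∈ entryBall q ε
          · rw [Set.indicator_of_mem (by exact hW)]
            refine (measure_mono fun U hU => hU.2 : _ ≤ Measure.pi ν {U | EdgeNear D ρ U W}).trans ?_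
            rw [pi_edgeNear]
            refine Finset.prod_le_prod' fun s _ => hn2 s (ν s) _ _ ?_
            rw [gram_comb]
            exact (hεN hW).2 s
          · rw [Set.indicator_of_notMem (by exact hW)]
            refine (measure_mono fun U hU => hW ?_ : _ ≤ Measure.pi ν ∅).trans (by simp)
            refine (gram_mem_entryBall_of_near (fun p => ?_)
              (hCorb n ρ U W hρ hU.2) (hCρ.trans_le hη1) (by rw [hCρ]; linarith)).2 hU.1.2
            rw [norm_orbitTuple]
            linarith [hU.1.1.1 p.2]
      _ = K * tupVol (F × Fin k) n {W | gram ℂ W ∈ entryBall q ε} := by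
          rw [lintegral_indicator_const hN₃.measurableSet]
      _ ≤ K * tupVol (F × Fin k) n {W | gram ℂ W ∈ N₂} := by
          gcongr
          exact fun W hW => (hεN hW).1
      _ ≤ K * ENNReal.ofReal c' ^ n := by gcongr; exact hvol n
      _ = _ := mul_comm _ _
  rw [hid] at hup
  have hmain := (mul_le_mul_left hlow _).trans hup
  simp only [hdet] at hmain
  rw [prod_ofReal_pow (fun s => mul_nonneg (hPs s).le (hR s).le), Finset.prod_mul_distrib,
    Finset.prod_mul_distrib, prod_ofReal_pow (fun s => mul_nonneg (by linarith) (hR s).le),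
    Finset.prod_mul_distrib, Finset.prod_const, Finset.prod_const, Finset.card_univ] at hmain
  rw [← hPdef] at hmain
  set Q := ∏ s, R s
  have hQ : 0 < Q := Finset.prod_pos fun s _ => hR s
  have h1 : ENNReal.ofReal c' ^ n * ENNReal.ofReal ((1 + κ) ^ Fintype.card S * Q) ^ n
      ≤ ENNReal.ofReal c₁ ^ n * ENNReal.ofReal (P * Q) ^ n := by
    rw [← mul_pow, ← mul_pow, ← ENNReal.ofReal_mul hc'0, ← ENNReal.ofReal_mul hc₁0]
    refine pow_le_pow_left' (ENNReal.ofReal_le_ofReal ?_) n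
    rw [← mul_assoc, ← mul_assoc]
    exact mul_le_mul_of_nonneg_right hκ.le hQ.le
  have h2 : ENNReal.ofReal (P * Q) ^ n ≠ 0 := pow_ne_zero _ (by simpa using mul_pos hP hQ)
  have h3 : ENNReal.ofReal (P * Q) ^ n ≠ ⊤ := by finiteness
  have h4 : p * ENNReal.ofReal (1 / 2) ≤ 2 ^ Fintype.card S * ENNReal.ofReal c₁ ^ n := by
    rw [← ENNReal.mul_le_mul_iff_left h2 h3]
    refine hmain.trans ?_
    rw [mul_left_comm, mul_assoc]
    gcongr
  have h5 : (2 : ENNReal) * ENNReal.ofReal (1 / 2) = 1 := by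
    rw [← ENNReal.ofReal_ofNat, ← ENNReal.ofReal_mul (by norm_num)]; norm_num
  calc p = 2 * (p * ENNReal.ofReal (1 / 2)) := by rw [mul_left_comm, h5, mul_one]
    _ ≤ 2 * (2 ^ Fintype.card S * ENNReal.ofReal c₁ ^ n) := by gcongr
    _ = ENNReal.ofReal (2 ^ (Fintype.card S + 1) * c₁ ^ n) := by
        rw [ENNReal.ofReal_mul (by positivity), ENNReal.ofReal_pow (by norm_num),
          ENNReal.ofReal_pow hc₁0, ENNReal.ofReal_ofNat, pow_succ]
        ring
    _ ≤ _ := ENNReal.ofReal_le_ofReal hn3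

end Local

/-! ### Probability that the Gram matrix is near `q`: lower bound -/

theorem eventually_le_tupVol_gram {ι : Type*} [Fintype ι] [DecidableEq ι] {q : Matrix ι ι ℂ}
    (hq : q.PosDef) {N : Set (Matrix ι ι ℂ)} (hN : N ∈ 𝓝 q) :
    ∀ᶠ n in atTop, ENNReal.ofReal (1 / 2) * ENNReal.ofReal q.det.re ^ n
      ≤ tupVol ι n {W | gram ℂ W ∈ N} := by
  obtain ⟨D, rfl, -, hdet⟩ := exists_conjTranspose_mul_self hq
  have hc : Continuous fun M : Matrix ι ι ℂ => Dᴴ * M * D := by fun_prop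
  have ht := hc.tendsto 1
  rw [Matrix.mul_one] at ht
  obtain ⟨δ, hδ, hδN⟩ := exists_entryBall_subset (ht hN)
  filter_upwards [eventually_half_le_tupVol_nearOrtho ι Empty hδ] with n hn
  calc _ ≤ tupVol ι n (nearOrtho δ (Empty.elim : Empty → Cn n)) * ENNReal.ofReal _ ^ n :=
        mul_le_mul_left (hn Empty.elim fun i => i.elim) _
    _ = tupVol ι n (comb D '' nearOrtho δ (Empty.elim : Empty → Cn n)) := by
        rw [tupVol_image_comb, hdet, mul_comm]
    _ ≤ _ := by
        refine measure_mono ?_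
        rintro _ ⟨Z, hZ, rfl⟩
        have := hδN hZ.2.1
        rwa [Set.mem_preimage, ← gram_comb] at this

section Local

variable {S : Type*} [DecidableEq S] [Fintype S] {F : Finset (FreeGroup S)} {k n : ℕ}

/-- The probability that a random representation yields a Gram matrix near `q` is at least
`exp (n h_F(q) - o(n))`. -/
theorem eventually_le_measure_gram_orbitTuple (hF : SuffixClosed F)
    {q : Matrix (F × Fin k) (F × Fin k) ℂ} (hq : q.PosDef)
    (hq1 : q.submatrix (fun i : Fin k => ((⟨1, hF.1⟩ : F), i)) (fun i => (⟨1, hF.1⟩, i)) = 1)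
    (hsrc : ∀ s : S, q.submatrix (srcIdx s) (srcIdx s) = edgeBlock q s) {c : ℝ} (hc0 : 0 ≤ c)
    (hc : c * ∏ s : S, (edgeBlock q s).det.re < q.det.re)
    {N₀ : Set (Matrix (F × Fin k) (F × Fin k) ℂ)} (hN₀ : N₀ ∈ 𝓝 q) :
    ∀ᶠ n in atTop, ∀ (ν : S → Measure (unitaryGroup (Fin n) ℂ))
      [∀ s, (ν s).IsHaarMeasure] [∀ s, IsProbabilityMeasure (ν s)] (V : Fin k → Cn n),
      gram ℂ V = 1 →
      ENNReal.ofReal (c ^ n) ≤ Measure.pi ν {U | gram ℂ (orbitTuple F U V) ∈ N₀} := by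
  have hs : ∀ s : S, (edgeBlock q s).PosDef := fun s => hq.submatrix (by
    rintro ⟨x, i⟩ ⟨y, j⟩ h
    simp only [tgtIdx, edgeTgt, Prod.mk.injEq, Subtype.mk.injEq] at h
    exact Prod.ext (Subtype.ext h.1) h.2)
  obtain ⟨D, hD0, hDq, hdet⟩ := exists_edge_factors hs
  have hPs : ∀ s : S, 0 < (edgeBlock q s).det.re := fun s => (Complex.lt_def.1 (hs s).det_pos).1
  obtain ⟨P, hPdef⟩ : ∃ P : ℝ, P = ∏ s : S, (edgeBlock q s).det.re := ⟨_, rfl⟩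
  rw [← hPdef] at hc
  have hP : 0 < P := hPdef ▸ Finset.prod_pos fun s _ => hPs s
  obtain ⟨d, hd⟩ : ∃ d, d = q.det.re := ⟨_, rfl⟩
  rw [← hd] at hc
  obtain ⟨c₁, hcc₁, hc₁⟩ := exists_between ((lt_div_iff₀ hP).2 hc)
  rw [lt_div_iff₀ hP] at hc₁
  have hc₁0 : 0 ≤ c₁ := hc0.trans hcc₁.le
  have hd0 : 0 ≤ d := (mul_nonneg hc₁0 hP.le).trans hc₁.le
  obtain ⟨κ, ⟨hκ, hκ1⟩, hκ0⟩ : ∃ κ : ℝ, (c₁ * P * (1 + κ) ^ k < d * (1 - κ) ^ Fintype.card S ∧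
      κ < 1) ∧ 0 < κ := by
    have h1 : Continuous fun κ : ℝ => c₁ * P * (1 + κ) ^ k := by fun_prop
    have h2 : Continuous fun κ : ℝ => d * (1 - κ) ^ Fintype.card S := by fun_prop
    have := (h1.tendsto 0).eventually_lt (h2.tendsto 0) (by simpa using hc₁)
    exact (((this.and (gt_mem_nhds one_pos)).filter_mono nhdsWithin_le_nhds).and
      (self_mem_nhdsWithin : Set.Ioi (0 : ℝ) ∈ 𝓝[>] 0)).exists
  obtain ⟨ε, hε, hεN⟩ := exists_entryBall_subset hN₀
  obtain ⟨C, hC, hCorb⟩ := exists_norm_sub_orbitTuple_le D hF hD0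
  obtain ⟨η, hη, hη1, hηε⟩ : ∃ η, 0 < η ∧ η ≤ 1 ∧ η ≤ ε / 30 :=
    ⟨min 1 (ε / 30), by positivity, min_le_left _ _, min_le_right _ _⟩
  choose ρ₀ hρ₀ hhit₀ using fun s : S =>
    exists_nhds_one_le_hit (EdgeSet F s × Fin k) hκ0 hκ1
  -- Here `ρ` comes before the neighbourhoods `N s`, which depend on it; the radius `ε₁` for the
  -- Gram matrices of `W` is then adapted to them.
  obtain ⟨ρ, ⟨hρρ, hρη⟩, hρ⟩ : ∃ ρ, ((∀ s, ρ < ρ₀ s) ∧ ρ < η / C) ∧ 0 < ρ :=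
    ((((eventually_all.2 fun s => gt_mem_nhds (hρ₀ s)).and
      (gt_mem_nhds (div_pos hη hC))).filter_mono nhdsWithin_le_nhds).and
      (self_mem_nhdsWithin : Set.Ioi (0 : ℝ) ∈ 𝓝[>] 0)).exists
  have hCρ : C * ρ ≤ η := by rw [mul_comm]; exact ((lt_div_iff₀ hC).1 hρη).le
  choose N hN hhit using fun s => hhit₀ s ρ hρ (hρρ s).le
  obtain ⟨N₄, hN₄, hst⟩ := exists_nhds_one_linearIsometryEquiv (Fin k) hη
  obtain ⟨δ₀, hδ₀, hδ₀N⟩ := exists_entryBall_subset hN₄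
  obtain ⟨δ, hδ, hδδ₀, hδκ⟩ : ∃ δ, 0 < δ ∧ δ ≤ δ₀ ∧ δ ≤ κ :=
    ⟨min δ₀ κ, lt_min hδ₀ hκ0, min_le_left _ _, min_le_right _ _⟩
  have hδN : entryBall 1 δ ⊆ N₄ := (entryBall_mono 1 hδδ₀).trans hδ₀N
  have hev1 : ∀ᶠ M in 𝓝 q, M.submatrix (fun i : Fin k => ((⟨1, hF.1⟩ : F), i))
      (fun i => ((⟨1, hF.1⟩ : F), i)) ∈ entryBall 1 δ := by
    have hcont : Continuous fun M : Matrix (F × Fin k) (F × Fin k) ℂ =>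
      M.submatrix (fun i : Fin k => ((⟨1, hF.1⟩ : F), i)) (fun i => ((⟨1, hF.1⟩ : F), i)) := by
      fun_prop
    have ht := hcont.tendsto q
    rw [hq1] at ht
    exact ht (entryBall_mem_nhds 1 hδ)
  have hev2 : ∀ᶠ M in 𝓝 q, M ∈ entryBall q (ε / 3) := entryBall_mem_nhds q (by positivity)
  -- The lower bound on hits needs both tuples of an edge nearly orthonormal after normalisation by
  -- the same `D s`; `hsrc` provides this for the beginnings.
  obtain ⟨ε₁, hε₁, hε₁N⟩ := exists_entryBall_subset (hev1.and (hev2.and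
    ((eventually_all.2 fun s => eventually_normalised_mem (hDq s) (hN s)).and
    (eventually_all.2 fun s => eventually_normalised_mem
      ((hsrc s).symm ▸ hDq s : ((D s)⁻¹)ᴴ * q.submatrix (srcIdx s) (srcIdx s) * (D s)⁻¹ = 1)
      (hN s)))))
  filter_upwards [eventually_le_tupVol_gram hq (entryBall_mem_nhds q hε₁),
    eventually_all.2 fun s => hhit s,
    eventually_const_mul_pow_le (2 ^ (Fintype.card S + 1)) hc0 hcc₁] with n hn1 hn2 hn3
  intro ν _ _ V hV
  refine le_trans ?_ (measure_mono fun U hU => hεN hU :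
    Measure.pi ν {U | gram ℂ (orbitTuple F U V) ∈ entryBall q ε} ≤ _)
  obtain ⟨p, hp⟩ : ∃ p, p = Measure.pi ν {U | gram ℂ (orbitTuple F U V) ∈ entryBall q ε} :=
    ⟨_, rfl⟩
  rw [← hp]
  set B : Set ((Fin k → Cn n) × (S → unitaryGroup (Fin n) ℂ)) :=
    {x | gram ℂ x.1 ∈ entryBall 1 δ ∧
      gram ℂ (orbitTuple F x.2 x.1) ∈ entryBall q (2 * ε / 3)}
  have hBo : IsOpen {V' : Fin k → Cn n | gram ℂ V' ∈ entryBall 1 δ} :=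
    (isOpen_entryBall 1 δ).preimage continuous_gram
  have hB : IsOpen B := (hBo.preimage continuous_fst).inter
    ((isOpen_entryBall _ _).preimage (continuous_gram.comp continuous_orbitTuple))
  have hid := lintegral_edgeNear D hF ν hD0 hρ hB
  have hnorm : ∀ V' : Fin k → Cn n, gram ℂ V' ∈ entryBall 1 δ → ∀ j, ‖V' j‖ ≤ 2 := by
    intro V' hV' j
    have := norm_sq_lt_of_gram_mem_entryBall hV' j
    nlinarith [norm_nonneg (V' j)]
  obtain ⟨R, hRdef⟩ : ∃ R : S → ℝ, R = fun s => ρ ^ (2 * Fintype.card (EdgeSet F s × Fin k)) :=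
    ⟨_, rfl⟩
  have hR : ∀ s, 0 < R s := fun s => by rw [hRdef]; positivity
  have hup : ∫⁻ V', Measure.pi ν {U | (V', U) ∈ B} ∂(tupVol (Fin k) n)
      ≤ p * ENNReal.ofReal ((1 + κ) ^ k) ^ n := by
    calc _ ≤ ∫⁻ V', Set.indicator {V' : Fin k → Cn n | gram ℂ V' ∈ entryBall 1 δ}
          (fun _ => p) V' ∂(tupVol (Fin k) n) := by
          refine lintegral_mono fun V' => ?_
          by_cases hV' : gram ℂ V' ∈ entryBall 1 δ
          · rw [Set.indicator_of_mem (by exact hV'), hp]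
            obtain ⟨H, hH⟩ := hst n V V' (hV ▸ mem_of_mem_nhds hN₄) (hδN hV')
            refine le_trans ?_ (measure_gram_orbitTuple_le (q := q) (ε := 2 * ε / 3) (ε' := ε) ν
              (fun j => (hH j).le) (hnorm V' hV') hη1 (by linarith)).2
            exact measure_mono fun U hU => hU.2
          · rw [Set.indicator_of_notMem (by exact hV')]
            exact (measure_mono fun U hU => hV' hU.1 : _ ≤ Measure.pi ν ∅).trans (by simp)
      _ = p * tupVol (Fin k) n {V' | gram ℂ V' ∈ entryBall 1 δ} := by
          rw [lintegral_indicator_const hBo.measurableSet]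
      _ ≤ _ := by
          gcongr
          simpa using tupVol_gram_entryBall_le (ι := Fin k) (n := n) hδ hδκ
  have hlow : (ENNReal.ofReal (1 / 2) * ENNReal.ofReal d ^ n) *
      ∏ s, (ENNReal.ofReal (1 / 2) * ENNReal.ofReal ((1 - κ) * R s) ^ n)
      ≤ ∫⁻ W, Measure.pi ν {U | ((fun i => W (⟨1, hF.1⟩, i)), U) ∈ B ∧ EdgeNear D ρ U W}
        ∂(tupVol (F × Fin k) n) := by
    obtain ⟨K, hK⟩ : ∃ K, K = ∏ s, (ENNReal.ofReal (1 / 2) * ENNReal.ofReal ((1 - κ) * R s) ^ n) :=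
      ⟨_, rfl⟩
    have hA : IsOpen {W : F × Fin k → Cn n | gram ℂ W ∈ entryBall q ε₁} :=
      (isOpen_entryBall q ε₁).preimage continuous_gram
    rw [← hK]
    calc _ ≤ tupVol (F × Fin k) n {W | gram ℂ W ∈ entryBall q ε₁} * K := by
          rw [hd]; exact mul_le_mul_left hn1 _
      _ = ∫⁻ W in {W | gram ℂ W ∈ entryBall q ε₁}, K ∂(tupVol (F × Fin k) n) := by
          rw [setLIntegral_const, mul_comm]
      _ ≤ ∫⁻ W in {W | gram ℂ W ∈ entryBall q ε₁},
            Measure.pi ν {U | ((fun i => W (⟨1, hF.1⟩, i)), U) ∈ B ∧ EdgeNear D ρ U W}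
            ∂(tupVol (F × Fin k) n) := by
          refine setLIntegral_mono_ae' hA.measurableSet (ae_of_all _ fun W hW => ?_)
          obtain ⟨hW1, hW2, hW3, hW4⟩ := hε₁N hW
          refine le_trans ?_ (measure_mono (s := {U | EdgeNear D ρ U W}) fun U hU =>
            ⟨⟨hW1, ?_⟩, hU⟩)
          · rw [pi_edgeNear, hK, hRdef]
            refine Finset.prod_le_prod' fun s _ => hn2 s (ν s) _ _ ?_ ?_
            · rw [gram_comb]; exact hW4 s
            · rw [gram_comb]; exact hW3 s
          · refine (gram_mem_entryBall_of_near (fun p => ?_)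
              (hCorb n ρ U W hρ hU) (hCρ.trans hη1) (by linarith)).1 hW2
            rw [norm_orbitTuple]
            exact hnorm _ hW1 p.2
      _ ≤ _ := setLIntegral_le_lintegral _ _
  rw [hid] at hlow
  have hmain := hlow.trans (mul_le_mul_left hup _)
  obtain ⟨Q, hQdef⟩ : ∃ Q, Q = ∏ s, R s := ⟨_, rfl⟩
  have hQ : 0 < Q := hQdef ▸ Finset.prod_pos fun s _ => hR s
  have e1 : ∏ s, ENNReal.ofReal (‖(D s).det‖ ^ 2 *
      ρ ^ (2 * Fintype.card (EdgeSet F s × Fin k))) ^ n = ENNReal.ofReal (P * Q) ^ n := by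
    rw [prod_ofReal_pow fun s => by positivity, Finset.prod_mul_distrib, hPdef, hQdef, hRdef]
    simp only [hdet]
  have e2 : ∏ s, (ENNReal.ofReal (1 / 2) * ENNReal.ofReal ((1 - κ) * R s) ^ n)
      = ENNReal.ofReal (1 / 2) ^ Fintype.card S *
        ENNReal.ofReal ((1 - κ) ^ Fintype.card S * Q) ^ n := by
    rw [Finset.prod_mul_distrib, prod_ofReal_pow fun s => mul_nonneg (by linarith) (hR s).le,
      Finset.prod_mul_distrib, Finset.prod_const, Finset.prod_const, Finset.card_univ, hQdef]
  rw [e1, e2] at hmain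
  have hκ1' : 0 < 1 - κ := by linarith
  have h1 : ENNReal.ofReal c₁ ^ n * (ENNReal.ofReal ((1 + κ) ^ k) ^ n * ENNReal.ofReal (P * Q) ^ n)
      ≤ ENNReal.ofReal d ^ n * ENNReal.ofReal ((1 - κ) ^ Fintype.card S * Q) ^ n := by
    rw [← mul_pow, ← mul_pow, ← mul_pow, ← ENNReal.ofReal_mul (by positivity),
      ← ENNReal.ofReal_mul hc₁0, ← ENNReal.ofReal_mul hd0]
    refine pow_le_pow_left' (ENNReal.ofReal_le_ofReal ?_) n
    have := mul_le_mul_of_nonneg_right hκ.le hQ.le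
    linarith
  have h2 : ENNReal.ofReal ((1 + κ) ^ k) ^ n * ENNReal.ofReal (P * Q) ^ n ≠ 0 :=
    mul_ne_zero (pow_ne_zero _ (by simp; positivity)) (pow_ne_zero _ (by simp; positivity))
  have h3 : ENNReal.ofReal ((1 + κ) ^ k) ^ n * ENNReal.ofReal (P * Q) ^ n ≠ ⊤ := by finiteness
  have h4 : ENNReal.ofReal (1 / 2) ^ (Fintype.card S + 1) * ENNReal.ofReal c₁ ^ n ≤ p := by
    rw [← ENNReal.mul_le_mul_iff_left h2 h3, mul_assoc]
    refine (mul_le_mul_right h1 _).trans ?_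
    rw [← mul_assoc p]
    refine le_trans (le_of_eq ?_) hmain
    rw [pow_succ]
    ring
  refine le_trans ?_ h4
  rw [← ENNReal.ofReal_pow (by norm_num), ← ENNReal.ofReal_pow hc₁0,
    ← ENNReal.ofReal_mul (by positivity)]
  refine ENNReal.ofReal_le_ofReal ?_
  rw [one_div, inv_pow, ← div_eq_inv_mul, le_div_iff₀ (by positivity), mul_comm]
  exact hn3

end Local

/-! ### Restrictions of a positive definite map -/

section Restriction

variable {Γ : Type*} [Group Γ] {k : ℕ} (φ : unitalPD Γ k) {E F : Finset Γ}

theorem restrictPD_submatrix_eq {m : Type*} {f : m → F} {g : m → E}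
    (h : ∀ x y, (f x : Γ)⁻¹ * f y = (g x : Γ)⁻¹ * g y) :
    (restrictPD φ F).1.submatrix (fun p : m × Fin k => (f p.1, p.2))
        (fun p : m × Fin k => (f p.1, p.2))
      = (restrictPD φ E).1.submatrix (fun p : m × Fin k => (g p.1, p.2))
        (fun p : m × Fin k => (g p.1, p.2)) := by
  ext p q
  simp [restrictPD, h]

theorem posDef_restrictPD_submatrix [DecidableEq Γ] (hE : IsUnit (restrictPD φ E).1) {m : Type*}
    {f : m → F} {g : m → E} (hg : Function.Injective g)
    (h : ∀ x y, (f x : Γ)⁻¹ * f y = (g x : Γ)⁻¹ * g y) :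
    ((restrictPD φ F).1.submatrix (fun p : m × Fin k => (f p.1, p.2))
      (fun p => (f p.1, p.2))).PosDef := by
  rw [restrictPD_submatrix_eq φ h]
  refine ((restrictPD φ E).2.1.posDef_iff_isUnit.2 hE).submatrix ?_
  rintro ⟨x, i⟩ ⟨y, j⟩ hxy
  simp only [Prod.mk.injEq] at hxy
  exact Prod.ext (hg hxy.1) hxy.2

theorem isUnit_restrictPD_of_subset [DecidableEq Γ] (h : E ⊆ F) (hF : IsUnit (restrictPD φ F).1) :
    IsUnit (restrictPD φ E).1 := by
  rw [← (restrictPD φ E).2.1.posDef_iff_isUnit]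
  exact posDef_restrictPD_submatrix φ (f := fun x : E => x) (g := fun x : E => ⟨x.1, h x.2⟩) hF
    (fun x y hxy => Subtype.ext (congrArg Subtype.val hxy :)) fun _ _ => rfl

end Restriction

/-! ### Minimal singular sets -/

section Words

variable {S : Type*} [DecidableEq S] {F : Finset (FreeGroup S)}

theorem edgeTgt_injective {s : S} : Function.Injective (edgeTgt (F := F) (s := s)) :=
  fun _ _ h => Subtype.ext (congrArg Subtype.val h :)

theorem of_mul_ne_inv_of_mul (s : S) (g : FreeGroup S) :
    FreeGroup.of s * g ≠ (FreeGroup.of s)⁻¹ * g := by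
  intro h
  have := congrArg FreeGroup.toWord (mul_right_cancel h)
  simp [FreeGroup.toWord_inv, FreeGroup.invRev] at this

/-- An element of maximal length is not both the end and the beginning of edges with the same
label. -/
theorem notMem_edgeSet_or {g : FreeGroup S} (hg : ∀ h ∈ F, h.norm ≤ g.norm) (s : S) :
    g ∉ EdgeSet F s ∨ FreeGroup.of s * g ∉ EdgeSet F s := by
  by_contra! h
  obtain ⟨⟨-, h1⟩, ⟨h2, -⟩⟩ := And.intro (mem_edgeSet.1 h.1) (mem_edgeSet.1 h.2)
  -- Both neighbours of `g` along `s` would be no longer than `g`, so both would be its parent; but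
  -- they are distinct.
  have e1 := edge_cases s g
  have e2 := edge_cases s (FreeGroup.of s * g)
  rw [inv_mul_cancel_left] at e2
  rcases e1 with e1 | e1
  · rcases e2 with e2 | e2
    · have := norm_wordParent e2.1
      rw [e2.2] at this
      have := hg _ h2
      omega
    · exact of_mul_ne_inv_of_mul s g (e2.2.symm.trans e1.2)
  · have := norm_wordParent e1.1
    rw [e1.2] at this
    have := hg _ h1
    omega

theorem SuffixClosed.erase (hF : SuffixClosed F) {g : FreeGroup S} (hg1 : g ≠ 1)
    (hg : ∀ h ∈ F, h.norm ≤ g.norm) : SuffixClosed (F.erase g) := by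
  refine ⟨Finset.mem_erase.2 ⟨hg1.symm, hF.1⟩, fun h hh h1 => Finset.mem_erase.2 ⟨?_, ?_⟩⟩
  · rintro rfl
    have := norm_wordParent h1
    have := hg h (Finset.mem_of_mem_erase hh)
    omega
  · exact hF.2 h (Finset.mem_of_mem_erase hh) h1

theorem suffixClosed_singleton : SuffixClosed ({1} : Finset (FreeGroup S)) := by
  simp [SuffixClosed]

variable {k : ℕ} (φ : unitalPD (FreeGroup S) k)

theorem posDef_edgeBlock_of_isUnit (h : IsUnit (restrictPD φ F).1) (s : S) :
    (edgeBlock (restrictPD φ F).1 s).PosDef :=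
  posDef_restrictPD_submatrix φ h edgeTgt_injective fun _ _ => rfl

theorem submatrix_srcIdx_eq (s : S) :
    (restrictPD φ F).1.submatrix (srcIdx s) (srcIdx s) = edgeBlock (restrictPD φ F).1 s :=
  restrictPD_submatrix_eq φ fun x y => by simp only [edgeSrc, edgeTgt]; group

/-- A minimal suffix closed set at which `φ` is singular has nonsingular edge blocks. -/
theorem exists_singular_posDef_edgeBlock (hF : SuffixClosed F)
    (h : ¬ IsUnit (restrictPD φ F).1) :
    ∃ F', SuffixClosed F' ∧ ¬ IsUnit (restrictPD φ F').1 ∧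
      ∀ s, (edgeBlock (restrictPD φ F').1 s).PosDef := by
  induction hm : F.card using Nat.strong_induction_on generalizing F with
  | _ m ih =>
  -- A longest element is removed. If `φ` becomes nonsingular, then for each label the ends or the
  -- beginnings of the edges avoid `g`, and translation invariance makes the edge block a submatrix
  -- over `F.erase g` either way.
  obtain ⟨g, hgF, hg⟩ := F.exists_max_image FreeGroup.norm ⟨1, hF.1⟩
  by_cases hE : IsUnit (restrictPD φ (F.erase g)).1
  · refine ⟨F, hF, h, fun s => ?_⟩
    rcases notMem_edgeSet_or hg s with h' | h'
    · exact posDef_restrictPD_submatrix φ (g := fun x : EdgeSet F s =>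
        (⟨x.1, Finset.mem_erase.2 ⟨fun e => h' (e ▸ x.2), (mem_edgeSet.1 x.2).1⟩⟩ :
          F.erase g)) hE (fun x y hxy => Subtype.ext (congrArg Subtype.val hxy :)) fun _ _ => rfl
    · refine posDef_restrictPD_submatrix φ (g := fun x : EdgeSet F s =>
        (⟨(FreeGroup.of s)⁻¹ * x.1, Finset.mem_erase.2 ⟨fun e => h' ?_, (mem_edgeSet.1 x.2).2⟩⟩ :
          F.erase g)) hE (fun x y hxy => Subtype.ext
            (mul_left_cancel (congrArg Subtype.val hxy :))) fun x y => ?_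
      · rw [← e, mul_inv_cancel_left]
        exact x.2
      · simp only [edgeTgt]; group
  · have hg1 : g ≠ 1 := by
      rintro rfl
      -- If the identity is longest, it is the only element, and an empty matrix is nonsingular.
      have : F.erase 1 = ∅ := by
        ext x
        simp only [Finset.mem_erase, Finset.notMem_empty, iff_false, not_and]
        intro hx1 hx
        have := hg x hx
        rw [FreeGroup.norm_one, Nat.le_zero, FreeGroup.norm_eq_zero] at this
        exact hx1 this
      rw [this] at hE
      exact hE ((Matrix.isUnit_iff_isUnit_det _).2 (by simp))
    exact ih _ (hm ▸ Finset.card_erase_lt_of_mem hgF) (hF.erase hg1 hg) hE rfl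

variable [Fintype S]

theorem hF_of_isUnit (h : IsUnit (restrictPD φ F).1) :
    hF F (restrictPD φ F) = ((Real.log (restrictPD φ F).1.det.re
      - ∑ s : S, Real.log (edgeBlock (restrictPD φ F).1 s).det.re : ℝ) : EReal) := by
  obtain rfl : ‹DecidableEq S› = fun a b => Classical.propDecidable (a = b) :=
    Subsingleton.elim _ _
  rw [hF, if_pos]
  · rfl
  · convert h

end Words

/-! ### Probability bounds in terms of `h_F`, and monotonicity -/

section Entropy

variable {S : Type*} [DecidableEq S] [Fintype S] {F : Finset (FreeGroup S)} {k : ℕ}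
  (φ : unitalPD (FreeGroup S) k)

theorem hF_of_not_isUnit (h : ¬ IsUnit (restrictPD φ F).1) : hF F (restrictPD φ F) = ⊥ := by
  rw [hF, if_neg]
  convert h

theorem det_edgeBlock_pos (h : IsUnit (restrictPD φ F).1) (s : S) :
    0 < (edgeBlock (restrictPD φ F).1 s).det.re :=
  (Complex.lt_def.1 (posDef_edgeBlock_of_isUnit φ h s).det_pos).1

theorem det_restrictPD_pos (h : IsUnit (restrictPD φ F).1) : 0 < (restrictPD φ F).1.det.re :=
  (Complex.lt_def.1 ((restrictPD φ F).2.1.posDef_iff_isUnit.2 h).det_pos).1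

theorem hF_eq_log (h : IsUnit (restrictPD φ F).1) :
    hF F (restrictPD φ F) = ((Real.log (restrictPD φ F).1.det.re
      - Real.log (∏ s : S, (edgeBlock (restrictPD φ F).1 s).det.re) : ℝ) : EReal) := by
  rw [hF_of_isUnit φ h, Real.log_prod fun s _ => (det_edgeBlock_pos φ h s).ne']

theorem hF_lt_iff (h : IsUnit (restrictPD φ F).1) (a : ℝ) :
    hF F (restrictPD φ F) < a ↔ (restrictPD φ F).1.det.re
      < Real.exp a * ∏ s : S, (edgeBlock (restrictPD φ F).1 s).det.re := by
  have hP := Finset.prod_pos fun s (_ : s ∈ Finset.univ) => det_edgeBlock_pos φ h s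
  rw [hF_eq_log φ h, EReal.coe_lt_coe_iff, sub_lt_iff_lt_add,
    Real.log_lt_iff_lt_exp (det_restrictPD_pos φ h), Real.exp_add, Real.exp_log hP]

theorem lt_hF_iff (h : IsUnit (restrictPD φ F).1) (a : ℝ) :
    a < hF F (restrictPD φ F) ↔ Real.exp a * ∏ s : S, (edgeBlock (restrictPD φ F).1 s).det.re
      < (restrictPD φ F).1.det.re := by
  have hP := Finset.prod_pos fun s (_ : s ∈ Finset.univ) => det_edgeBlock_pos φ h s
  rw [hF_eq_log φ h, EReal.coe_lt_coe_iff, lt_sub_iff_add_lt,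
    Real.lt_log_iff_exp_lt (det_restrictPD_pos φ h), Real.exp_add, Real.exp_log hP]

theorem hF_singleton_one : hF {1} (restrictPD φ {1}) = 0 := by
  have h1 : (restrictPD φ {1}).1 = 1 := by
    ext ⟨⟨g, hg⟩, i⟩ ⟨⟨h, hh⟩, j⟩
    rw [Finset.mem_singleton] at hg hh
    subst hg hh
    rw [(restrictPD φ {1}).2.2.1]
    simp [Matrix.one_apply]
  have h2 : ∀ s : S, IsEmpty (EdgeSet ({1} : Finset (FreeGroup S)) s) := fun s =>
    ⟨fun x => by
      have := mem_edgeSet.1 x.2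
      simp only [Finset.mem_singleton] at this
      rw [this.1, mul_one, inv_eq_one] at this
      exact FreeGroup.of_ne_one s this.2⟩
  rw [hF_eq_log φ (by rw [h1]; exact isUnit_one), h1]
  simp [Matrix.det_isEmpty]

/-- If `h_F(φ[F]) < a` then restrictions of `φ` are improbable at rate `a`. -/
theorem exists_measure_le_exp (hF' : SuffixClosed F) {a : ℝ} (h : hF F (restrictPD φ F) < a) :
    ∃ E, SuffixClosed E ∧ ∃ N ∈ 𝓝 (restrictPD φ E).1, IsOpen N ∧
      ∀ᶠ n in atTop, ∀ (ν : S → Measure (unitaryGroup (Fin n) ℂ))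
      [∀ s, (ν s).IsHaarMeasure] [∀ s, IsProbabilityMeasure (ν s)] (V : Fin k → Cn n),
      gram ℂ V = 1 →
      Measure.pi ν {U | gram ℂ (orbitTuple E U V) ∈ N} ≤ ENNReal.ofReal (Real.exp a ^ n) := by
  by_cases hu : IsUnit (restrictPD φ F).1
  · exact ⟨F, hF', exists_nhds_measure_gram_orbitTuple_le hF' (restrictPD φ F).2.1
      (posDef_edgeBlock_of_isUnit φ hu) ((hF_lt_iff φ hu a).1 h)⟩
  -- On a minimal singular set the determinant vanishes while the edge blocks have positive
  -- determinant, so the bound holds for every `a`.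
  · obtain ⟨E, hE, hEu, hs⟩ := exists_singular_posDef_edgeBlock φ hF' hu
    refine ⟨E, hE, exists_nhds_measure_gram_orbitTuple_le hE (restrictPD φ E).2.1 hs ?_⟩
    have h0 : (restrictPD φ E).1.det = 0 := by
      rwa [Matrix.isUnit_iff_isUnit_det, isUnit_iff_ne_zero, not_not] at hEu
    rw [h0, Complex.zero_re]
    exact mul_pos (Real.exp_pos a)
      (Finset.prod_pos fun s _ => (Complex.lt_def.1 (hs s).det_pos).1)

/-- If `a < h_F(φ[F])` then restrictions of `φ` to `F` are probable at rate `a`. -/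
theorem eventually_exp_le_measure (hF' : SuffixClosed F) {a : ℝ}
    (h : (a : EReal) < hF F (restrictPD φ F)) {N : Set (Matrix (F × Fin k) (F × Fin k) ℂ)}
    (hN : N ∈ 𝓝 (restrictPD φ F).1) :
    ∀ᶠ n in atTop, ∀ (ν : S → Measure (unitaryGroup (Fin n) ℂ))
      [∀ s, (ν s).IsHaarMeasure] [∀ s, IsProbabilityMeasure (ν s)] (V : Fin k → Cn n),
      gram ℂ V = 1 →
      ENNReal.ofReal (Real.exp a ^ n) ≤ Measure.pi ν {U | gram ℂ (orbitTuple F U V) ∈ N} := by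
  have hu : IsUnit (restrictPD φ F).1 := by
    by_contra hu
    rw [hF_of_not_isUnit φ hu] at h
    exact not_lt_bot h
  refine eventually_le_measure_gram_orbitTuple hF'
    ((restrictPD φ F).2.1.posDef_iff_isUnit.2 hu) ?_ (submatrix_srcIdx_eq φ)
    (Real.exp_pos a).le ((lt_hF_iff φ hu a).1 h) hN
  ext i j
  exact (restrictPD φ F).2.2.1 _ i j

theorem exists_haar_probability (n : ℕ) :
    ∃ ν : Measure (unitaryGroup (Fin n) ℂ), ν.IsHaarMeasure ∧ IsProbabilityMeasure ν := by
  refine ⟨Measure.haarMeasure ⊤, inferInstance, ⟨?_⟩⟩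
  simpa using Measure.haarMeasure_self (K₀ := (⊤ : TopologicalSpace.PositiveCompacts
    (unitaryGroup (Fin n) ℂ)))

theorem exists_gram_eq_one {k n : ℕ} (h : k ≤ n) : ∃ V : Fin k → Cn n, gram ℂ V = 1 := by
  refine ⟨fun i => EuclideanSpace.single (Fin.castLE h i) 1, ?_⟩
  ext i j
  simp [gram_apply, Matrix.one_apply, EuclideanSpace.inner_single_left]

/-- If the inequality failed, then for large `n` the event that the type is near `φ` on `F` would be
more probable than the event on `E` that it implies. -/
theorem hF_anti {E : Finset (FreeGroup S)} (hE : SuffixClosed E) (hF' : SuffixClosed F)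
    (hEF : E ⊆ F) : hF F (restrictPD φ F) ≤ hF E (restrictPD φ E) := by
  by_cases hu : IsUnit (restrictPD φ F).1
  swap
  · rw [hF_of_not_isUnit φ hu]
    exact bot_le
  by_contra! hlt
  obtain ⟨b', hb1, hb2⟩ := EReal.exists_between_coe_real hlt
  obtain ⟨b, hb3, hb4⟩ := EReal.exists_between_coe_real hb1
  have huE := isUnit_restrictPD_of_subset φ hEF hu
  obtain ⟨N, hN, -, hup⟩ := exists_nhds_measure_gram_orbitTuple_le hE (restrictPD φ E).2.1
    (posDef_edgeBlock_of_isUnit φ huE) ((hF_lt_iff φ huE b).1 hb3)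
  set ι : E × Fin k → F × Fin k := fun p => (⟨p.1.1, hEF p.1.2⟩, p.2)
  have hcont : Continuous fun M : Matrix (F × Fin k) (F × Fin k) ℂ => M.submatrix ι ι := by
    fun_prop
  have hlow := eventually_exp_le_measure φ hF' hb2 (hcont.continuousAt.preimage_mem_nhds hN)
  obtain ⟨n, h1, h2, hkn, hn⟩ := (hup.and (hlow.and ((eventually_ge_atTop k).and
    (eventually_gt_atTop 0)))).exists
  obtain ⟨ν, hν1, hν2⟩ := exists_haar_probability n
  obtain ⟨V, hV⟩ := exists_gram_eq_one hkn
  have h3 := (h2 (fun _ => ν) V hV).trans (h1 (fun _ => ν) V hV)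
  rw [ENNReal.ofReal_le_ofReal_iff (by positivity)] at h3
  have h4 := pow_lt_pow_left₀ (Real.exp_lt_exp.2 (EReal.coe_lt_coe_iff.1 hb4))
    (Real.exp_pos b).le hn.ne'
  exact h4.not_ge h3

/-- By `hF_anti`, since the balls are grounded and eventually contain every finite set. -/
theorem tendsto_hF_cayleyBall :
    Tendsto (fun n : ℕ => hF (cayleyBall S n) (restrictPD φ (cayleyBall S n))) atTop
      (𝓝 (⨅ (F : Finset (FreeGroup S)) (_ : IsGrounded F), hF F (restrictPD φ F))) := by
  refine tendsto_order.2 ⟨fun b hb => Eventually.of_forall fun n => hb.trans_le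
    (iInf₂_le _ (suffixClosed_cayleyBall n).isGrounded), fun b hb => ?_⟩
  obtain ⟨F, hb⟩ := iInf_lt_iff.1 hb
  obtain ⟨hF', hb⟩ := iInf_lt_iff.1 hb
  obtain ⟨m, hm⟩ := exists_subset_cayleyBall F
  filter_upwards [eventually_ge_atTop m] with n hn
  exact (hF_anti φ hF'.suffixClosed (suffixClosed_cayleyBall n)
    (hm.trans (cayleyBall_mono hn))).trans_lt hb

end Entropy

/-! ### Compactness of the space of positive definite maps -/

section Space

variable {Γ : Type*} [Group Γ] {k : ℕ}

theorem continuous_unitalPD_apply (g : Γ) :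
    Continuous fun φ : unitalPD Γ k => φ.1 g := (continuous_apply g).comp continuous_subtype_val

/-- The two-by-two minor at `(1, i)` and `(g, j)` equals `1 - ‖φ.1 g i j‖ ^ 2` and is nonnegative.
-/
theorem norm_unitalPD_apply_le_one (φ : unitalPD Γ k) (g : Γ) (i j : Fin k) :
    ‖φ.1 g i j‖ ≤ 1 := by
  have h := φ.2.2.submatrix (![(1, i), (g, j)] : Fin 2 → Γ × Fin k)
  have h1 := h.det_nonneg
  have h2 := h.1.apply 1 0
  rw [Matrix.det_fin_two, ← h2] at h1
  simp [φ.2.1] at h1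
  rw [Complex.mul_conj', Complex.le_def] at h1
  have h3 := h1.1
  norm_cast at h3
  exact (sq_le_one_iff₀ (norm_nonneg _)).1 h3

theorem isClosed_unitalPD : IsClosed (unitalPD Γ k) := by
  refine (isClosed_eq (continuous_apply 1) continuous_const).inter ?_
  refine IsClosed.inter (s₁ := {φ : Γ → Matrix (Fin k) (Fin k) ℂ |
    (Matrix.of fun p q : Γ × Fin k => φ (p.1⁻¹ * q.1) p.2 q.2).IsHermitian})
    (isClosed_eq ?_ ?_) ?_
  · fun_prop
  · fun_prop
  · change IsClosed {φ : Γ → Matrix (Fin k) (Fin k) ℂ | ∀ x : Γ × Fin k →₀ ℂ,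
      0 ≤ x.sum fun p a => x.sum fun q b => star a * φ (p.1⁻¹ * q.1) p.2 q.2 * b}
    rw [Set.ofPred_forall]
    refine isClosed_iInter fun x => isClosed_le continuous_const ?_
    simp only [Finsupp.sum]
    fun_prop

instance : CompactSpace (unitalPD Γ k) := by
  rw [← isCompact_iff_compactSpace]
  have : IsCompact (Set.univ.pi fun _ : Γ => Set.univ.pi fun _ : Fin k => Set.univ.pi
      fun _ : Fin k => Metric.closedBall (0 : ℂ) 1) :=
    isCompact_univ_pi fun _ => isCompact_univ_pi fun _ => isCompact_univ_pi fun _ =>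
      isCompact_closedBall 0 1
  exact this.of_isClosed_subset isClosed_unitalPD fun φ hφ g _ i _ j _ =>
    mem_closedBall_zero_iff.2 (norm_unitalPD_apply_le_one ⟨φ, hφ⟩ g i j)

theorem continuous_restrictPD (F : Finset Γ) :
    Continuous fun φ : unitalPD Γ k => (restrictPD φ F).1 :=
  continuous_matrix fun _ _ => (continuous_unitalPD_apply _).matrix_elem _ _

end Space

/-! ### The law of the random type -/

section Law

variable {k n : ℕ}

/-- The columns of a matrix, as vectors. -/
def columnTuple (V : Matrix (Fin n) (Fin k) ℂ) : Fin k → Cn n :=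
  fun i => WithLp.toLp 2 fun a => V a i

theorem inner_columnTuple (V W : Matrix (Fin n) (Fin k) ℂ) (i j : Fin k) :
    inner ℂ (columnTuple V i) (columnTuple W j) = (Vᴴ * W) i j := by
  simp [columnTuple, PiLp.inner_apply, Matrix.mul_apply, mul_comm]

theorem uact_columnTuple (U : unitaryGroup (Fin n) ℂ) (V : Matrix (Fin n) (Fin k) ℂ) (i : Fin k) :
    uact n U (columnTuple V i) = columnTuple (U.1 * V) i := by
  rw [uact_apply]
  rfl

theorem gram_columnTuple (V : unitaryTuples k n) : gram ℂ (columnTuple V.1) = 1 := by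
  ext i j
  rw [gram_apply, inner_columnTuple, show (V.1)ᴴ * V.1 = 1 from V.2]

variable {S : Type*}

theorem gram_orbitTuple_columnTuple {F : Finset (FreeGroup S)} (U : S → unitaryGroup (Fin n) ℂ)
    (V : unitaryTuples k n) :
    gram ℂ (orbitTuple F U (columnTuple V.1))
      = (restrictPD (typeOf (FreeGroup.lift U) V) F).1 := by
  ext p q
  rw [gram_apply, orbitTuple, orbitTuple, uact_columnTuple, uact_columnTuple, inner_columnTuple]
  change _ = ((V.1)ᴴ * (FreeGroup.lift U (p.1.1⁻¹ * q.1.1)).1 * V.1) p.2 q.2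
  rw [map_mul, map_inv, Matrix.conjTranspose_mul]
  simp [Matrix.mul_assoc, Matrix.star_eq_conjTranspose]

theorem continuous_typeOf_lift (V : unitaryTuples k n) :
    Continuous fun U : S → unitaryGroup (Fin n) ℂ => typeOf (FreeGroup.lift U) V := by
  refine Continuous.subtype_mk (continuous_pi fun g => ?_) _
  exact (continuous_const.matrix_mul (continuous_subtype_val.comp (continuous_lift g))).matrix_mul
    continuous_const

variable {Ω : Type*} [MeasurableSpace Ω] {P : Measure Ω} [IsProbabilityMeasure P]
  {π : Ω → (FreeGroup S →* unitaryGroup (Fin n) ℂ)}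

theorem lift_comp_of (f : FreeGroup S →* unitaryGroup (Fin n) ℂ) :
    FreeGroup.lift (fun s => f (FreeGroup.of s)) = f :=
  FreeGroup.ext_hom _ _ fun _ => FreeGroup.lift_apply_of

variable [Fintype S]

theorem IsUniformRandomRep.measurable_typeOf (hπ : IsUniformRandomRep P π)
    (V : unitaryTuples k n) : Measurable fun ω => typeOf (π ω) V := by
  have := (continuous_typeOf_lift V).measurable.comp (measurable_pi_iff.2 hπ.measurable)
  simpa only [Function.comp_def, lift_comp_of] using this

theorem IsUniformRandomRep.map_typeOf (hπ : IsUniformRandomRep P π)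
    (V : unitaryTuples k n) :
    P.map (fun ω => typeOf (π ω) V)
      = (Measure.pi fun s => P.map fun ω => π ω (FreeGroup.of s)).map
        fun U => typeOf (FreeGroup.lift U) V := by
  rw [← (iIndepFun_iff_map_fun_eq_pi_map fun s => (hπ.measurable s).aemeasurable).1 hπ.indep,
    Measure.map_map (continuous_typeOf_lift V).measurable (measurable_pi_iff.2 hπ.measurable)]
  congr 1
  funext ω
  simp only [Function.comp_apply, lift_comp_of]

theorem IsUniformRandomRep.map_typeOf_apply (hπ : IsUniformRandomRep P π)
    (V : unitaryTuples k n) (F : Finset (FreeGroup S))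
    {N : Set (Matrix (F × Fin k) (F × Fin k) ℂ)} (hN : IsOpen N) :
    P.map (fun ω => typeOf (π ω) V) {φ | (restrictPD φ F).1 ∈ N}
      = Measure.pi (fun s => P.map fun ω => π ω (FreeGroup.of s))
        {U | gram ℂ (orbitTuple F U (columnTuple V.1)) ∈ N} := by
  rw [hπ.map_typeOf]
  refine (Measure.map_apply (continuous_typeOf_lift V).measurable
    (hN.preimage (continuous_restrictPD F)).measurableSet).trans ?_
  simp only [gram_orbitTuple_columnTuple]
  rfl

/-- A basic neighbourhood constrains finitely many values of the map, and these are blocks in the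
identity row of its restriction to a large ball. -/
theorem exists_restrictPD_nhds [DecidableEq S] (φ : unitalPD (FreeGroup S) k)
    {A : Set (unitalPD (FreeGroup S) k)} (hA : A ∈ 𝓝 φ) :
    ∃ F, SuffixClosed F ∧ ∃ N, IsOpen N ∧ (restrictPD φ F).1 ∈ N ∧
      {ψ : unitalPD (FreeGroup S) k | (restrictPD ψ F).1 ∈ N} ⊆ A := by
  rw [nhds_subtype_eq_comap, Filter.mem_comap] at hA
  obtain ⟨T, hT, hTA⟩ := hA
  rw [nhds_pi, Filter.mem_pi] at hT
  obtain ⟨J, hJ, t, ht, hJt⟩ := hT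
  obtain ⟨m, hm⟩ := exists_subset_cayleyBall hJ.toFinset
  have hF := suffixClosed_cayleyBall (S := S) m
  set f : ∀ g : cayleyBall S m, Matrix (cayleyBall S m × Fin k) (cayleyBall S m × Fin k) ℂ →
    Matrix (Fin k) (Fin k) ℂ := fun g M => M.submatrix (fun i => (⟨1, hF.1⟩, i)) (fun i => (g, i))
  have hf : ∀ g, Continuous (f g) := fun g => by simp only [f]; fun_prop
  have hfφ : ∀ (ψ : unitalPD (FreeGroup S) k) g, f g (restrictPD ψ (cayleyBall S m)).1
      = ψ.1 g.1 := by
    intro ψ g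
    ext i j
    simp [f, restrictPD]
  refine ⟨cayleyBall S m, hF, ⋂ g, f g ⁻¹' interior (t g.1),
    isOpen_iInter_of_finite fun g => isOpen_interior.preimage (hf g), ?_, fun ψ hψ => ?_⟩
  · rw [Set.mem_iInter]
    intro g
    rw [Set.mem_preimage, hfφ]
    exact mem_interior_iff_mem_nhds.2 (ht g.1)
  · refine hTA (hJt fun g hg => ?_)
    have := Set.mem_iInter.1 hψ ⟨g, hm (hJ.mem_toFinset.2 hg)⟩
    rw [Set.mem_preimage, hfφ] at this
    exact interior_subset this

end Law

/-! ### The large deviations principle -/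

theorem mainTheorem6 {S : Type*} [Fintype S] (k : ℕ) (hk : 0 < k)
    {Ω : Type*} [MeasurableSpace Ω] (P : Measure Ω) [IsProbabilityMeasure P]
    (π : ∀ n : ℕ, Ω → (FreeGroup S →* unitaryGroup (Fin n) ℂ))
    (hπ : ∀ n : ℕ, IsUniformRandomRep P (π n))
    (V : ∀ n : ℕ, k ≤ n → unitaryTuples k n) :
    LDP (fun (n : ℕ) (hn : k ≤ n) => P.map fun ω => typeOf (π n ω) (V n hn))
      (fun φ : unitalPD (FreeGroup S) k =>
        -⨅ (F : Finset (FreeGroup S)) (_ : IsGrounded F), hF F (restrictPD φ F)) ∧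
    ∀ φ : unitalPD (FreeGroup S) k,
      Tendsto (fun n : ℕ => hF (cayleyBall S n) (restrictPD φ (cayleyBall S n))) atTop
        (𝓝 (⨅ (F : Finset (FreeGroup S)) (_ : IsGrounded F), hF F (restrictPD φ F))) := by
  classical
  have hprob : ∀ (n : ℕ) (hn : k ≤ n),
      IsProbabilityMeasure (P.map fun ω => typeOf (π n ω) (V n hn)) := fun n hn =>
    Measure.isProbabilityMeasure_map ((hπ n).measurable_typeOf (V n hn)).aemeasurable
  have hhaar : ∀ n s, (P.map fun ω => π n ω (FreeGroup.of s)).IsHaarMeasure :=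
    fun n s => (hπ n).haar s
  have hprob' : ∀ n s, IsProbabilityMeasure (P.map fun ω => π n ω (FreeGroup.of s)) :=
    fun n s => Measure.isProbabilityMeasure_map ((hπ n).measurable s).aemeasurable
  refine ⟨⟨hprob, fun φ => ?_, fun φ a ha => ?_, fun φ a ha A hA => ?_, fun a _ => ?_⟩,
    tendsto_hF_cayleyBall⟩
  · rw [EReal.neg_nonneg]
    exact (iInf₂_le _ suffixClosed_singleton.isGrounded).trans (hF_singleton_one φ).le
  · rw [EReal.lt_neg_comm, ← EReal.coe_neg] at ha
    obtain ⟨F, ha⟩ := iInf_lt_iff.1 ha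
    obtain ⟨hF', ha⟩ := iInf_lt_iff.1 ha
    obtain ⟨E, -, N, hN, hNo, hbound⟩ := exists_measure_le_exp φ hF'.suffixClosed ha
    -- The strict inequality for `a` has already absorbed all subexponential factors, so the error
    -- term is zero.
    refine ⟨_, (continuous_restrictPD E).continuousAt.preimage_mem_nhds hN, 0,
      isLittleO_zero _ _, ?_⟩
    filter_upwards [hbound] with n h hn
    refine ENNReal.toReal_le_of_le_ofReal (Real.exp_pos _).le ?_
    refine ((hπ n).map_typeOf_apply (V n hn) E hNo).trans_le ?_
    refine (h _ _ (gram_columnTuple (V n hn))).trans (ENNReal.ofReal_le_ofReal (le_of_eq ?_))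
    rw [← Real.exp_nat_mul, Pi.zero_apply, add_zero, mul_comm]
  · rw [EReal.neg_lt_comm, ← EReal.coe_neg] at ha
    obtain ⟨F, hF', N, hNo, hN, hNA⟩ := exists_restrictPD_nhds φ hA
    have hbound := eventually_exp_le_measure φ hF'
      (ha.trans_le (iInf₂_le _ hF'.isGrounded)) (hNo.mem_nhds hN)
    refine ⟨0, isLittleO_zero _ _, ?_⟩
    filter_upwards [hbound] with n h hn
    refine (ENNReal.ofReal_le_iff_le_toReal (measure_ne_top _ _)).1 ?_
    refine le_trans ?_ (measure_mono hNA)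
    rw [(hπ n).map_typeOf_apply (V n hn) F hNo]
    refine (ENNReal.ofReal_le_ofReal (le_of_eq ?_)).trans (h _ _ (gram_columnTuple (V n hn)))
    rw [← Real.exp_nat_mul, Pi.zero_apply, sub_zero, mul_comm]
  -- Exponential tightness is free because the whole space is compact.
  · refine ⟨Set.univ, isCompact_univ, 0, isLittleO_zero _ _, Eventually.of_forall fun n hn => ?_⟩
    rw [Set.compl_univ, measureReal_empty]
    exact (Real.exp_pos _).le
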